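/- Let $\Gamma=(V,E,(w_v)_{v\in V})$ be a plumbing graph, that is, a finite tree with integral weights $w_v$. Its linking matrix $W\in M_V(\mathbb Z)$ has diagonal entries $w_v$, and for $v\ne v'$ its $(v,v')$-entry is $1$ if $\{v,v'\}\in E$ and $0$ otherwise. Assume that $W$ is negative definite, that $\det W=\pm1$, and that $w_i\le -2$ for every vertex $i$ of degree $1$. Let $k$ be a positive integer. Write $V_{\ge d}$ for the set of vertices of degree at least $d$, let $\overline v$ be the set of vertices of degree $1$ adjacent to $v$, and $\mathbf e(z)=e^{2\pi i z}$. Let $S$ be the $V_{\ge2}\times V_{\ge 2}$ block of $-W^{-1}$ and $Q(x)={}^t x S x$. For $v\in V_{\ge2}$ put $$\mathcal S_v=\Big\{\tfrac12\deg v-1+\sum_{i\in\overline v}\tfrac{l_i}{2w_i}\ :\ (l_i)\in\{\pm1\}^{\overline v}\Big\},$$ and let $\varepsilon_v(\alpha_v)=\prod_{i\in\overline v} l_i$ if $\alpha_v\equiv\frac12\deg v-1+\sum_{i\in\overline v} \frac{l_i}{2w_i}\bmod\mathbb Z$ for some such $(l_i)$ (which is then unique) and $\varepsilon_v(\alpha_v)=0$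 otherwise. Let $\mathcal S=\prod_{v\in V_{\ge2}}\mathcal S_v$, $\varepsilon(\alpha)=\prod_{v\in V_{\ge 2}}\varepsilon_v(\alpha_v)$, and $$P(x)=\prod_{v\in V_{\ge3}}\frac{(x_v+\deg v-3)\cdots(x_v+1)}{(\deg v-3)!}=\sum_{m\in\mathbb Z_{\ge0}^{V_{\ge3}}}p_m\prod_v x_v^{m_v}$$ (a vertex of degree $3$ contributes the factor $1$). Let $f:\mathbb R^{V_{\ge2}}\to\mathbb C$ be a $C^\infty$ function of rapid decay as $x_v\to+\infty$: on every region where all coordinates are bounded below, all products of a power of $\|x\|$ with a derivative of $f$ are bounded. For $t\in\mathbb R_{>0}^{V_{\ge3}}$ set $$F(f;t)=\sum_{\alpha\in\mathcal S}\varepsilon(\alpha)\sum_{n\in\mathbb Z_{\ge0}^{V_{\ge3}}}\mathbf e\big(\tfrac1kQ(n+\alpha)\big)P(n)\,f\big(t(n+\alpha)\big),$$ where $n$ and $t$ are extended by $0$ to the vertices of degree $2$ and $t(n+\alpha)=(t_v(n_v+\alpha_v))_{v\in V_{\ge 2}}$. The coefficients $c_n$, $n\in\mathbb Z^{V_{\ge3}}$,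 of the asymptotic expansion $F(f;t)\sim\sum_n c_n f^{(n)}(0)\prod_v t_v^{n_v}$ as $t\to+0$ (with $g^{(-1)}(x)=-\int_x^\infty g$ in each variable) are $$c_n=\sum_{m\in\mathbb Z_{\ge0}^{V_{\ge3}}}p_m\Big(\prod_{v\in V_{\ge 3}} k^{m_v+n_v}\Big)\sum_{\alpha\in\mathcal S}\varepsilon(\alpha)\sum_{\lambda\in\{0,\dots,k-1\}^{V_{\ge3}}}\mathbf e\big(\tfrac1kQ(\lambda+\alpha)\big)\prod_{v\in V_{\ge3}}\mathbb B_{m_v,n_v}\big(\tfrac{\alpha_v}{k},\tfrac{\lambda_v}{k}\big),$$ where, with $B_j$ the Bernoulli polynomials and integers $m\ge0$ and $n$, $$\mathbb B_{m,n}(a,\lambda)=\begin{cases}-\displaystyle\sum_{0\le l\le m+n+1}\frac{m!}{(m+n+1-l)!}\sum_{0\le j\le\min(l,m)}\binom{m+n-j}{n}\frac{(-1)^j}{j!\,(l-j)!}\,B_{m+n+1-l}(\lambda)\,a^l&(n\ge0),\\[2mm](-1)^n\dfrac{m!}{(m+n+1)!}(-a)^{m+n+1}&(-m-1\le n\le-1),\\0&(n\le-m-2).\end{cases}$$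 Suppose that $|\overline v|+2-\deg v\ge0$ for every $v\in V_{\ge3}$. Then $c_n=0$ for every $n\in\mathbb Z^{V_{\ge3}}$ such that $n_v\le-1$ for some $v\in V_{\ge3}$. Moreover, for every $f$ as above, the series defining $F(f;t)$ converges absolutely for every $t\in\mathbb R_{>0}^{V_{\ge3}}$, the limit of $F(f;t)$ as $t\to0$ in $\mathbb R_{>0}^{V_{\ge3}}$ exists, and $$\lim_{t\to+0}F(f;t)=c_0\,f(0),$$ where $c_0$ does not depend on $f$; in particular the limit equals $c_0$ whenever $f(0)=1$. -/

import Mathlib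

open scoped BigOperators Topology ContDiff Nat

noncomputable section

/-- A plumbing graph: a finite tree with integral weights on its vertices. -/
structure PlumbingGraph (V : Type*) where
  graph : SimpleGraph V
  isTree : graph.IsTree
  weight : V → ℤ

namespace PlumbingGraph

variable {V : Type*} [Fintype V] [DecidableEq V] (Γ : PlumbingGraph V)

open scoped Classical in
/-- The degree of a vertex. -/
def deg (v : V) : ℕ := Γ.graph.degree v

open scoped Classical in
/-- The linking matrix: weights on the diagonal, the adjacency matrix off it. -/
def linkingMatrix : Matrix V V ℤ :=
  Matrix.of fun v v' =>
    if v = v' then Γ.weight v else if Γ.graph.Adj v v' then 1 else 0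

/-- The linking matrix is negative definite. -/
def IsNegDef : Prop :=
  (-(Γ.linkingMatrix.map (fun z : ℤ => (z : ℝ)))).PosDef

/-- The vertices of degree at least two. -/
abbrev V2 : Type _ := {v : V // 2 ≤ Γ.deg v}

/-- The vertices of degree at least three. -/
abbrev V3 : Type _ := {v : V // 3 ≤ Γ.deg v}

open scoped Classical in
/-- The set of all vertices of degree one adjacent to `v`. -/
def leaves (v : V) : Finset V :=
  Finset.univ.filter fun i => Γ.deg i = 1 ∧ Γ.graph.Adj i v

/-- The block of minus the inverse of the linking matrix indexed by the vertices of
degree at least two. -/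
def S : Matrix Γ.V2 Γ.V2 ℚ :=
  (-(Γ.linkingMatrix.map (fun z : ℤ => (z : ℚ)))⁻¹).submatrix Subtype.val Subtype.val

/-- The quadratic form of `S`. -/
def Q (x : Γ.V2 → ℚ) : ℚ := ∑ v, ∑ v', x v * Γ.S v v' * x v'

/-- The number `deg v / 2 - 1 + ∑ i, l i / (2 w i)`, the sum being over the leaves `i` at `v`,
for a choice of signs `l`. -/
def alphaOf (v : V) (l : Γ.leaves v → ℤˣ) : ℚ :=
  (Γ.deg v : ℚ) / 2 - 1 + ∑ i, ((l i : ℤ) : ℚ) / (2 * (Γ.weight i : ℚ))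

/-- The finite set of the numbers `alphaOf v l`, where `l` runs over all choices of signs. -/
def calSv (v : V) : Finset ℚ := Finset.univ.image (Γ.alphaOf v)

open scoped Classical in
/-- The periodic map attached to `v`, as a function on rational numbers that is periodic modulo
one: the product of the signs `l` when `a` is congruent to `alphaOf v l` modulo one (`l` is unique
if the linking matrix is unimodular and all leaves have weight at most `-2`), and zero if `a` is
congruent to no such number. -/
def epsv (v : V) (a : ℚ) : ℤ :=
  if h : ∃ l : Γ.leaves v → ℤˣ, ∃ z : ℤ, a = Γ.alphaOf v l + z then
    ∏ i, ((h.choose i : ℤˣ) : ℤ)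
  else 0

/-- The product of the sets `calSv v` over the vertices of degree at least two. -/
def calS : Finset (Γ.V2 → ℚ) := Fintype.piFinset fun v => Γ.calSv v

/-- The product of the maps `epsv v` over the vertices of degree at least two. -/
def eps (a : Γ.V2 → ℚ) : ℤ := ∏ v : Γ.V2, Γ.epsv v (a v)

/-- Extension by zero from the vertices of degree at least three to those of degree at least
two. -/
def ext0 {R : Type*} [Zero R] (x : Γ.V3 → R) : Γ.V2 → R :=
  fun v => if h : 3 ≤ Γ.deg v then x ⟨v, h⟩ else 0

/-- The polynomial
`∏ v, (x v + deg v - 3) (x v + deg v - 4) ⋯ (x v + 1) / (deg v - 3)!`; a vertex of degree three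
contributes the factor one. -/
def P : MvPolynomial Γ.V3 ℚ :=
  ∏ v : Γ.V3,
    (MvPolynomial.C (1 / ((Γ.deg v - 3)! : ℚ)) *
      ∏ j ∈ Finset.Icc 1 (Γ.deg v - 3), (MvPolynomial.X v + MvPolynomial.C (j : ℚ)))

/-- `e z = exp (2 π i z)`. -/
def e (z : ℚ) : ℂ := Complex.exp (2 * Real.pi * Complex.I * (z : ℂ))

/-- The `n`-th term of the series of `F` that belongs to `a`:
`e (Q (n + a) / k) P(n) f (t (n + a))`. Here `n` and `t` are extended by zero to the vertices of
degree two, and `t (n + a)` is the componentwise product. -/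
def term (k : ℕ) (f : (Γ.V2 → ℝ) → ℂ) (t : Γ.V3 → ℝ) (a : Γ.V2 → ℚ) (n : Γ.V3 → ℕ) : ℂ :=
  e (1 / (k : ℚ) * Γ.Q (fun v => Γ.ext0 (fun u => (n u : ℚ)) v + a v)) *
    ((MvPolynomial.eval (fun v => (n v : ℚ)) Γ.P : ℚ) : ℂ) *
    f (fun v => Γ.ext0 t v * (Γ.ext0 (fun u => (n u : ℝ)) v + (a v : ℝ)))

/-- The series
`F(f; t) = ∑ a ∈ calS, eps a * ∑ n ≥ 0, e (Q (n + a) / k) P(n) f (t (n + a))`. -/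
def F (k : ℕ) (f : (Γ.V2 → ℝ) → ℂ) (t : Γ.V3 → ℝ) : ℂ :=
  ∑ a ∈ Γ.calS, (Γ.eps a : ℂ) * ∑' n : Γ.V3 → ℕ, Γ.term k f t a n

/-- The numbers
`b m n l = m! / (m + n + 1 - l)! * ∑ j ≤ l, binom (m + n - j) n * (-1) ^ j / (j! (l - j)!)`.
The binomial coefficient vanishes for `j > m`, so the sum stops at `min l m`. -/
def bCoeff (m n l : ℕ) : ℚ :=
  (m ! : ℚ) / ((m + n + 1 - l)! : ℚ) *
    ∑ j ∈ Finset.range (min l m + 1),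
      (((m + n - j).choose n : ℕ) : ℚ) * (-1) ^ j / ((j ! : ℚ) * ((l - j)! : ℚ))

/-- The coefficient of `g⁽ⁿ⁾(0) tⁿ` in the asymptotic expansion, as `t → +0`, of the series
`∑ j ≥ 0, (l + j) ^ m * g (t * (a + l + j))`, where `g⁽⁻¹⁾(x)` is minus the integral of `g` from
`x` to infinity, and so on. -/
def bbB (m : ℕ) (n : ℤ) (a l : ℚ) : ℚ :=
  if 0 ≤ n then
    -∑ i ∈ Finset.range (m + n.toNat + 2),
      bCoeff m n.toNat i * (Polynomial.bernoulli (m + n.toNat + 1 - i)).eval l * a ^ i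
  else if -(m : ℤ) - 1 ≤ n then
    (-1) ^ n * ((m ! : ℚ) / ((((m : ℤ) + n + 1).toNat)! : ℚ)) *
      (-a) ^ ((m : ℤ) + n + 1).toNat
  else 0

/-- The coefficient `c_n` of `f⁽ⁿ⁾(0) ∏ v, t_v ^ n_v` in the asymptotic expansion of `F(f; t)`. -/
def c (k : ℕ) (n : Γ.V3 → ℤ) : ℂ :=
  ∑ m ∈ Γ.P.support,
    ((Γ.P.coeff m * ∏ v, (k : ℚ) ^ ((m v : ℤ) + n v) : ℚ) : ℂ) *
      ∑ a ∈ Γ.calS, (Γ.eps a : ℂ) *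
        ∑ l ∈ Fintype.piFinset (fun _ : Γ.V3 => Finset.range k),
          e (1 / (k : ℚ) * Γ.Q (fun v => Γ.ext0 (fun u => (l u : ℚ)) v + a v)) *
            ((∏ v : Γ.V3, bbB (m v) (n v)
                (a ⟨v, le_trans (by norm_num) v.2⟩ / (k : ℚ)) ((l v : ℚ) / (k : ℚ)) : ℚ) : ℂ)

end PlumbingGraph

/-- `f` and all its derivatives decay faster than any power of the norm as the coordinates tend to
`+∞`, that is, on every region where all the coordinates are bounded below. -/
def RapidDecay {ι : Type*} [Fintype ι] (f : (ι → ℝ) → ℂ) : Prop :=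
  ∀ (R : ℝ) (K j : ℕ), ∃ C : ℝ, ∀ x : ι → ℝ, (∀ i, -R ≤ x i) →
    ‖x‖ ^ K * ‖iteratedFDeriv ℝ j f x‖ ≤ C

end

/-!
The terms of `F` at a vertex `v` of degree at least three sit, after rescaling by the product of the
absolute values of its leaf weights, at points of a lattice orthant. So `F` is a finite linear
combination, over residues modulo `k` and leaf signs at all vertices, of sums over a lattice orthant
of products of coefficients of one-variable power series `vertexSeries`, paired with samples of `f`.

A power series that behaves like a constant `A` at `X = 1`, in the sense of `regularAtOne`, acts on
samples of `f` like `A` in the limit of mesh zero: dividing by a power of `1 - X` and summing by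
parts moves differences onto `f`, each of which gains a factor equal to the mesh. This is
`tendsto_tsum_prod_coeff_mul_sample`. A single `vertexSeries` has a pole of order `deg v - 2` at
`X = 1`, but suitable combinations are regular. By Fourier analysis on the residues, the modes with
`ζ ≠ 1` are regular, with value `(1 - ζ) ^ -(deg v - 2)`, which is the regularized sum computed by
Bernoulli polynomials (`twistedSum_binomPoly`). In the mode `ζ = 1` the alternating sum over the leaf
signs produces one factor `1 - X ^ g` for every leaf at `v`; by assumption there are at least
`deg v - 2` leaves, so these factors cancel the pole. On the side of the coefficients the
alternating sum is an iterated difference of a polynomial. Together these facts give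
`sum_smul_vertexSeries_mem_regularAtOne`, for all weights on residues and signs whose sum over the
residues is proportional to the product of the signs. For negative exponents the contribution of the
vertex is a polynomial of degree at most `deg v - 3`, and the same weights annihilate it
(`sum_mul_vertexCoeff_eq_zero`).

The weights `e (Q (r + α) / k)` times the product of the signs have this property in the index at
each single vertex: the sum over the residues at `v` is a Gauss sum, and it does not depend on the
signs at `v`. Unimodularity makes the gradient of `Q` at `r + α` integral and congruent to the leaf
sign modulo the leaf weight; hence the Gauss sum vanishes if a leaf weight has a common factor with
`k`, and otherwise a shift of the residue compensates for a change of sign (`gaussSum_update_eq`).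
Finally, a tensor whose slices in every direction lie in prescribed subspaces is a combination of
products of vectors of these subspaces (`exists_tensor_decomposition`), which reduces the whole
statement to products over the vertices.
-/

/-! ### Iterated differences -/

/-- The difference `f x - f (x + u)` of `f` in direction `u`. -/
def stepDiff {E : Type*} [Add E] (u : E) (f : E → ℂ) : E → ℂ := fun x => f x - f (x + u)

/-- The iterated difference of `f` along a list of directions. -/
def iterDiff {E : Type*} [Add E] (L : List E) (f : E → ℂ) : E → ℂ :=
  L.foldl (fun g u => stepDiff u g) f

@[simp] theorem iterDiff_nil {E : Type*} [Add E] (f : E → ℂ) : iterDiff [] f = f := rfl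

@[simp] theorem iterDiff_cons {E : Type*} [Add E] (u : E) (L : List E) (f : E → ℂ) :
    iterDiff (u :: L) f = iterDiff L (stepDiff u f) := rfl

/-- The iterated mean value inequality. -/
theorem norm_iterDiff_le {ι : Type*} [Fintype ι] (L : List (ι → ℝ)) (hL : ∀ u ∈ L, 0 ≤ u)
    (f : (ι → ℝ) → ℂ) (hf : ContDiff ℝ ∞ f) (x : ι → ℝ) (B : ℝ)
    (hB : ∀ y, x ≤ y → ‖iteratedFDeriv ℝ L.length f y‖ ≤ B) :
    ‖iterDiff L f x‖ ≤ B * (L.map norm).prod := by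
  induction L generalizing f B with
  | nil => simpa using hB x le_rfl
  | cons u L ih =>
    have hu : 0 ≤ u := hL u (by simp)
    have hshift : ContDiff ℝ ∞ fun y => f (y + u) := hf.comp (contDiff_id.add contDiff_const)
    have key := ih (fun v hv => hL v (by simp [hv])) (stepDiff u f) (hf.sub hshift)
      (B * ‖u‖) ?_
    · simpa [mul_assoc] using key
    · intro y hy
      have h1 : iteratedFDeriv ℝ L.length (stepDiff u f) y =
          iteratedFDeriv ℝ L.length f y - iteratedFDeriv ℝ L.length f (y + u) := by
        have := iteratedFDeriv_sub_apply (𝕜 := ℝ) (i := L.length) (x := y) (f := f)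
          (g := fun y => f (y + u)) (hf.of_le (by exact_mod_cast le_top)).contDiffAt
          (hshift.of_le (by exact_mod_cast le_top)).contDiffAt
        rw [iteratedFDeriv_comp_add_right] at this
        exact this
      rw [h1, norm_sub_rev]
      have hdiff : Differentiable ℝ (iteratedFDeriv ℝ L.length f) :=
        hf.differentiable_iteratedFDeriv (by exact_mod_cast ENat.natCast_lt_top _)
      have := (convex_segment y (y + u)).norm_image_sub_le_of_norm_fderiv_le (𝕜 := ℝ)
        (f := iteratedFDeriv ℝ L.length f) (C := B)
        (fun z _ => hdiff z) ?_ (left_mem_segment ℝ _ _) (right_mem_segment ℝ _ _)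
      · simpa using this
      · intro z hz
        rw [norm_fderiv_iteratedFDeriv]
        refine hB z (hy.trans ?_)
        rw [segment_eq_image'] at hz
        obtain ⟨θ, hθ, rfl⟩ := hz
        simpa using smul_nonneg hθ.1 hu

/-! ### Sums of products over a lattice orthant -/

/-- A sum of products over the orthant is bounded by the product of bounds for the factors. -/
theorem summable_and_tsum_prod_le {ι : Type*} [Fintype ι] [DecidableEq ι] (c : ι → ℕ → ℝ)
    (hc : ∀ v z, 0 ≤ c v z) (B : ι → ℝ) (hB : ∀ v (t : Finset ℕ), ∑ z ∈ t, c v z ≤ B v) :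
    Summable (fun z : ι → ℕ => ∏ v, c v (z v)) ∧ ∑' z : ι → ℕ, ∏ v, c v (z v) ≤ ∏ v, B v := by
  have h0 : ∀ z : ι → ℕ, 0 ≤ ∏ v, c v (z v) := fun z => Finset.prod_nonneg fun v _ => hc v _
  have h1 : ∀ s : Finset (ι → ℕ), ∑ z ∈ s, ∏ v, c v (z v) ≤ ∏ v, B v := by
    intro s
    calc ∑ z ∈ s, ∏ v, c v (z v)
        ≤ ∑ z ∈ Fintype.piFinset (fun v => s.image (fun z => z v)), ∏ v, c v (z v) := by
          refine Finset.sum_le_sum_of_subset_of_nonneg ?_ (fun z _ _ => h0 z)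
          intro z hz
          rw [Fintype.mem_piFinset]
          exact fun v => Finset.mem_image_of_mem _ hz
      _ = ∏ v, ∑ z ∈ s.image (fun z => z v), c v z := (Finset.prod_univ_sum _ _).symm
      _ ≤ ∏ v, B v := Finset.prod_le_prod
          (fun v _ => Finset.sum_nonneg fun z _ => hc v z) (fun v _ => hB v _)
  exact ⟨summable_of_sum_le h0 h1, Real.tsum_le_of_sum_le h0 h1⟩

/-- A bound, uniform in the mesh, for the Riemann sums of `1 / (1 + x) ^ 2`. -/
theorem sum_step_mul_inv_sq_le {η : ℝ} (h0 : 0 < η) (h1 : η ≤ 1) (t : Finset ℕ) :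
    ∑ z ∈ t, η * ((1 + η * z) ^ 2)⁻¹ ≤ 2 := by
  obtain ⟨n, hn⟩ := t.exists_nat_subset_range
  have hpos : ∀ z : ℕ, 0 < 1 + η * z := fun z => by positivity
  have hn2 : ∑ z ∈ Finset.range n, η * ((1 + η * z) ^ 2)⁻¹ ≤
      ∑ z ∈ Finset.range n, ((1 + η) * (1 + η * (z : ℕ))⁻¹ - (1 + η) * (1 + η * ((z + 1 : ℕ) : ℝ))⁻¹) := by
    refine Finset.sum_le_sum fun z _ => ?_
    have hz := hpos z
    have hz' := hpos (z + 1)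
    rw [← mul_sub, inv_sub_inv hz.ne' hz'.ne', ← div_eq_mul_inv, mul_div_assoc',
      div_le_div_iff₀ (by positivity) (by positivity)]
    push_cast
    have : 0 ≤ (z : ℝ) := by positivity
    have h2 : (1 + η * (z + 1)) ≤ (1 + η) * (1 + η * z) := by
      nlinarith [mul_nonneg h0.le this, mul_nonneg h0.le (mul_nonneg h0.le this)]
    have h3 := mul_le_mul_of_nonneg_left h2 (mul_pos h0 hz).le
    nlinarith
  have h3 := Finset.sum_range_sub' (fun z : ℕ => (1 + η) * (1 + η * (z : ℝ))⁻¹) n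
  calc ∑ z ∈ t, η * ((1 + η * z) ^ 2)⁻¹ ≤ ∑ z ∈ Finset.range n, η * ((1 + η * z) ^ 2)⁻¹ :=
        Finset.sum_le_sum_of_subset_of_nonneg hn (fun z _ _ => by positivity)
    _ ≤ _ := hn2
    _ = _ := h3
    _ ≤ 2 := by
        have : 0 ≤ (1 + η) * (1 + η * (n : ℝ))⁻¹ := by positivity
        simp only [Nat.cast_zero, mul_zero, add_zero, inv_one, mul_one]
        linarith

/-- Functions on the lattice orthant that decay faster than any power of every coordinate. -/
def LatticeDecay {ι : Type*} [Fintype ι] (g : (ι → ℕ) → ℂ) : Prop :=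
  ∀ K : ℕ, ∃ C : ℝ, ∀ z, ‖g z‖ * ∏ v, (1 + (z v : ℝ)) ^ K ≤ C

/-- Power series whose coefficients grow at most polynomially. -/
def PolyGrowth (M : PowerSeries ℂ) : Prop :=
  ∃ (C : ℝ) (K : ℕ), ∀ z : ℕ, ‖PowerSeries.coeff z M‖ ≤ C * (1 + (z : ℝ)) ^ K

theorem LatticeDecay.stepDiff {ι : Type*} [Fintype ι] {g : (ι → ℕ) → ℂ}
    (hg : LatticeDecay g) (u : ι → ℕ) : LatticeDecay (stepDiff u g) := by
  intro K
  obtain ⟨C, hC⟩ := hg K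
  refine ⟨C + C, fun z => ?_⟩
  have h1 := hC z
  have h2 := hC (z + u)
  have h3 : ∏ v, (1 + (z v : ℝ)) ^ K ≤ ∏ v, (1 + ((z + u) v : ℝ)) ^ K := by
    refine Finset.prod_le_prod (fun v _ => by positivity) fun v _ => ?_
    gcongr
    simp
  have h4 : 0 ≤ ∏ v, (1 + (z v : ℝ)) ^ K := Finset.prod_nonneg fun v _ => by positivity
  calc ‖g z - g (z + u)‖ * ∏ v, (1 + (z v : ℝ)) ^ K
      ≤ (‖g z‖ + ‖g (z + u)‖) * ∏ v, (1 + (z v : ℝ)) ^ K := by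
        gcongr
        exact norm_sub_le _ _
    _ ≤ ‖g z‖ * ∏ v, (1 + (z v : ℝ)) ^ K + ‖g (z + u)‖ * ∏ v, (1 + ((z + u) v : ℝ)) ^ K := by
        rw [add_mul]
        gcongr
    _ ≤ C + C := add_le_add h1 h2

theorem exists_norm_coeff_polynomial_mul_le {M : PowerSeries ℂ} {K : ℕ}
    (hM : ∃ C : ℝ, ∀ z : ℕ, ‖PowerSeries.coeff z M‖ ≤ C * (1 + (z : ℝ)) ^ K)
    (P : Polynomial ℂ) :
    ∃ C : ℝ, ∀ z : ℕ, ‖PowerSeries.coeff z ((P : PowerSeries ℂ) * M)‖ ≤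
      C * (1 + (z : ℝ)) ^ K := by
  obtain ⟨C, hC⟩ := hM
  refine ⟨(∑ i ∈ P.support, ‖P.coeff i‖) * C, fun z => ?_⟩
  rw [PowerSeries.coeff_mul, Finset.Nat.sum_antidiagonal_eq_sum_range_succ_mk]
  have hC0 : 0 ≤ C := by simpa using (norm_nonneg _).trans (hC 0)
  calc ‖∑ i ∈ Finset.range z.succ, PowerSeries.coeff i (P : PowerSeries ℂ) *
          PowerSeries.coeff (z - i) M‖
      ≤ ∑ i ∈ Finset.range z.succ, ‖P.coeff i‖ * (C * (1 + (z : ℝ)) ^ K) := by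
        refine (norm_sum_le _ _).trans (Finset.sum_le_sum fun i hi => ?_)
        rw [norm_mul, Polynomial.coeff_coe]
        gcongr
        refine (hC _).trans ?_
        gcongr
        exact Nat.sub_le _ _
    _ = (∑ i ∈ Finset.range z.succ, ‖P.coeff i‖) * (C * (1 + (z : ℝ)) ^ K) := by
        rw [Finset.sum_mul]
    _ ≤ (∑ i ∈ P.support, ‖P.coeff i‖) * (C * (1 + (z : ℝ)) ^ K) := by
        refine mul_le_mul_of_nonneg_right ?_ (by positivity)
        calc ∑ i ∈ Finset.range z.succ, ‖P.coeff i‖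
            = ∑ i ∈ (Finset.range z.succ).filter (· ∈ P.support), ‖P.coeff i‖ := by
              rw [Finset.sum_filter_of_ne]
              intro i _ hi
              rw [Polynomial.mem_support_iff]
              exact fun h => hi (by simp [h])
          _ ≤ _ := Finset.sum_le_sum_of_subset_of_nonneg
              (fun i hi => (Finset.mem_filter.mp hi).2) (fun i _ _ => norm_nonneg _)
    _ = _ := by ring

theorem PolyGrowth.polynomial_mul {M : PowerSeries ℂ} (hM : PolyGrowth M) (P : Polynomial ℂ) :
    PolyGrowth ((P : PowerSeries ℂ) * M) := by
  obtain ⟨C, K, hC⟩ := hM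
  obtain ⟨C', hC'⟩ := exists_norm_coeff_polynomial_mul_le ⟨C, hC⟩ P
  exact ⟨C', K, hC'⟩

theorem summable_prod_coeff_mul {ι : Type*} [Fintype ι] [DecidableEq ι]
    {M : ι → PowerSeries ℂ} (hM : ∀ v, PolyGrowth (M v)) {g : (ι → ℕ) → ℂ}
    (hg : LatticeDecay g) :
    Summable fun z : ι → ℕ => (∏ v, PowerSeries.coeff (z v) (M v)) * g z := by
  choose C K hC using hM
  obtain ⟨C', hC'⟩ := hg ((∑ v, K v) + 2)
  have hs := (summable_and_tsum_prod_le (fun (_ : ι) z => 1 * ((1 + 1 * (z : ℝ)) ^ 2)⁻¹)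
    (fun v z => by positivity) (fun _ => 2)
    (fun v t => sum_step_mul_inv_sq_le one_pos le_rfl t)).1
  refine Summable.of_norm_bounded (hs.mul_left ((∏ v, C v) * C')) fun z => ?_
  have hC0 : ∀ v, 0 ≤ C v := fun v => by simpa using (norm_nonneg _).trans (hC v 0)
  have hp : ∀ v, 0 < 1 + (z v : ℝ) := fun v => by positivity
  rw [norm_mul, norm_prod]
  have h1 : ∏ v, ‖PowerSeries.coeff (z v) (M v)‖ ≤
      (∏ v, C v) * ∏ v, (1 + (z v : ℝ)) ^ (∑ v, K v) := by
    rw [← Finset.prod_mul_distrib]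
    refine Finset.prod_le_prod (fun v _ => norm_nonneg _) fun v _ => (hC v _).trans ?_
    have := hC0 v
    gcongr
    · simp
    · exact Finset.single_le_sum (f := K) (fun _ _ => Nat.zero_le _) (Finset.mem_univ v)
  have h2 := hC' z
  have h3 : ∏ v, (1 + (z v : ℝ)) ^ ((∑ v, K v) + 2) =
      (∏ v, (1 + (z v : ℝ)) ^ (∑ v, K v)) * ∏ v, (1 + (z v : ℝ)) ^ 2 := by
    rw [← Finset.prod_mul_distrib]
    simp [pow_add]
  have hq : 0 < ∏ v, (1 + (z v : ℝ)) ^ 2 := Finset.prod_pos fun v _ => by have := hp v; positivity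
  have h5 : ∏ v, 1 * ((1 + 1 * (z v : ℝ)) ^ 2)⁻¹ = (∏ v, (1 + (z v : ℝ)) ^ 2)⁻¹ := by
    simp
  rw [h5, ← div_eq_mul_inv, le_div_iff₀ hq]
  have hCp : 0 ≤ ∏ v, C v := Finset.prod_nonneg fun v _ => hC0 v
  calc (∏ v, ‖PowerSeries.coeff (z v) (M v)‖) * ‖g z‖ * ∏ v, (1 + (z v : ℝ)) ^ 2
      ≤ ((∏ v, C v) * ∏ v, (1 + (z v : ℝ)) ^ (∑ v, K v)) * ‖g z‖ *
          ∏ v, (1 + (z v : ℝ)) ^ 2 := by gcongr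
    _ = (∏ v, C v) * (‖g z‖ * ∏ v, (1 + (z v : ℝ)) ^ ((∑ v, K v) + 2)) := by rw [h3]; ring
    _ ≤ (∏ v, C v) * C' := by gcongr

/-! ### Summation by parts -/

/-- A factor `1 - X` of the series in direction `u` turns into a difference of the function. -/
theorem tsum_update_one_sub_X_mul {ι : Type*} [Fintype ι] [DecidableEq ι]
    {M : ι → PowerSeries ℂ} (hM : ∀ v, PolyGrowth (M v)) {g : (ι → ℕ) → ℂ}
    (hg : LatticeDecay g) (u : ι) :
    ∑' z : ι → ℕ, (∏ v, PowerSeries.coeff (z v)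
        (Function.update M u ((1 - PowerSeries.X) * M u) v)) * g z =
      ∑' z : ι → ℕ, (∏ v, PowerSeries.coeff (z v) (M v)) * stepDiff (Pi.single u 1) g z := by
  have hX : PolyGrowth (PowerSeries.X * M u) := by
    simpa using (hM u).polynomial_mul Polynomial.X
  have hM' : ∀ v, PolyGrowth (Function.update M u (PowerSeries.X * M u) v) := by
    intro v
    by_cases h : v = u
    · subst h; simpa using hX
    · simpa [h] using hM v
  have hs1 := summable_prod_coeff_mul hM hg
  have hs2 := summable_prod_coeff_mul hM' hg
  have hg' : LatticeDecay fun z => g (z + Pi.single u 1) := by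
    have h := hg.stepDiff (Pi.single u 1)
    intro K
    obtain ⟨C, hC⟩ := hg K
    refine ⟨C, fun z => le_trans ?_ (hC (z + Pi.single u 1))⟩
    gcongr with v
    simp
  have hs3 := summable_prod_coeff_mul hM hg'
  have hsplit : ∀ z : ι → ℕ, (∏ v, PowerSeries.coeff (z v)
      (Function.update M u ((1 - PowerSeries.X) * M u) v)) =
      (∏ v, PowerSeries.coeff (z v) (M v)) -
        ∏ v, PowerSeries.coeff (z v) (Function.update M u (PowerSeries.X * M u) v) := by
    intro z
    rw [← Finset.mul_prod_erase _ _ (Finset.mem_univ u),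
      ← Finset.mul_prod_erase _ (fun v => PowerSeries.coeff (z v) (M v)) (Finset.mem_univ u),
      ← Finset.mul_prod_erase _ (fun v => PowerSeries.coeff (z v)
        (Function.update M u (PowerSeries.X * M u) v)) (Finset.mem_univ u)]
    have e1 : ∀ N : PowerSeries ℂ, ∏ v ∈ Finset.univ.erase u,
        PowerSeries.coeff (z v) (Function.update M u N v) =
        ∏ v ∈ Finset.univ.erase u, PowerSeries.coeff (z v) (M v) := fun N =>
      Finset.prod_congr rfl fun v hv => by
        rw [Function.update_of_ne (Finset.ne_of_mem_erase hv)]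
    rw [e1, e1, Function.update_self, Function.update_self, sub_mul, one_mul, map_sub, sub_mul]
  have hshift : ∑' z : ι → ℕ, (∏ v, PowerSeries.coeff (z v)
      (Function.update M u (PowerSeries.X * M u) v)) * g z =
      ∑' z : ι → ℕ, (∏ v, PowerSeries.coeff (z v) (M v)) * g (z + Pi.single u 1) := by
    rw [← (add_left_injective (Pi.single u 1 : ι → ℕ)).tsum_eq]
    · refine tsum_congr fun z => ?_
      congr 1
      refine Finset.prod_congr rfl fun v _ => ?_
      by_cases h : v = u
      · subst h
        simp [PowerSeries.coeff_succ_X_mul]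
      · simp [h]
    · intro z hz
      refine ⟨z - Pi.single u 1, ?_⟩
      have hzu : z u ≠ 0 := by
        intro h0
        refine hz ?_
        simp only
        rw [Finset.prod_eq_zero (Finset.mem_univ u), zero_mul]
        rw [Function.update_self, h0]
        simp
      ext v
      by_cases h : v = u
      · subst h
        simp
        omega
      · simp [h]
  rw [tsum_congr fun z => by rw [hsplit z, sub_mul], hs1.tsum_sub hs2, hshift,
    ← hs1.tsum_sub hs3]
  simp only [stepDiff, mul_sub]

theorem PolyGrowth.one_sub_X_pow_mul {M : PowerSeries ℂ} (hM : PolyGrowth M) (n : ℕ) :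
    PolyGrowth ((1 - PowerSeries.X) ^ n * M) := by
  have := hM.polynomial_mul ((1 - Polynomial.X) ^ n)
  rwa [Polynomial.coe_pow, Polynomial.coe_sub, Polynomial.coe_one, Polynomial.coe_X] at this

/-- Multi-dimensional summation by parts. -/
theorem tsum_one_sub_X_pow_count_mul {ι : Type*} [Fintype ι] [DecidableEq ι]
    {M : ι → PowerSeries ℂ} (hM : ∀ v, PolyGrowth (M v)) (L : List ι) {g : (ι → ℕ) → ℂ}
    (hg : LatticeDecay g) :
    ∑' z : ι → ℕ, (∏ v, PowerSeries.coeff (z v)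
        ((1 - PowerSeries.X) ^ L.count v * M v)) * g z =
      ∑' z : ι → ℕ, (∏ v, PowerSeries.coeff (z v) (M v)) *
        iterDiff (L.map fun u => Pi.single u 1) g z := by
  induction L generalizing g with
  | nil => simp
  | cons u L ih =>
    rw [List.map_cons, iterDiff_cons, ← ih (hg.stepDiff _),
      ← tsum_update_one_sub_X_mul (fun v => (hM v).one_sub_X_pow_mul _) hg u]
    refine tsum_congr fun z => ?_
    congr 1
    refine Finset.prod_congr rfl fun v _ => ?_
    by_cases h : v = u
    · subst h
      simp [pow_succ', mul_assoc]
    · simp [h, List.count_cons_of_ne (Ne.symm h)]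

/-! ### Sampling a rapidly decaying function on a fine lattice -/

theorem RapidDecay.exists_bound {ι : Type*} [Fintype ι] {f : (ι → ℝ) → ℂ} (hf : RapidDecay f)
    (R : ℝ) (K j : ℕ) : ∃ C : ℝ, 0 ≤ C ∧ ∀ x : ι → ℝ, (∀ i, -R ≤ x i) →
      ‖iteratedFDeriv ℝ j f x‖ * ∏ i, (1 + |x i|) ^ K ≤ C := by
  obtain ⟨C₁, hC₁⟩ := hf R 0 j
  obtain ⟨C₂, hC₂⟩ := hf R (Fintype.card ι * K) j
  have key : ∀ x : ι → ℝ, (∀ i, -R ≤ x i) → ‖iteratedFDeriv ℝ j f x‖ * ∏ i, (1 + |x i|) ^ K ≤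
      2 ^ (Fintype.card ι * K) * (|C₁| + |C₂|) := by
    intro x hx
    have h1 := (hC₁ x hx).trans (le_abs_self _)
    have h2 := (hC₂ x hx).trans (le_abs_self _)
    have h3 : ∏ i, (1 + |x i|) ^ K ≤ (1 + ‖x‖) ^ (Fintype.card ι * K) := by
      calc ∏ i, (1 + |x i|) ^ K ≤ ∏ _i : ι, (1 + ‖x‖) ^ K := by
            gcongr with i
            exact norm_le_pi_norm x i
        _ = _ := by simp [pow_mul, pow_right_comm]
    have h4 : (1 + ‖x‖) ^ (Fintype.card ι * K) ≤
        2 ^ (Fintype.card ι * K) * (1 + ‖x‖ ^ (Fintype.card ι * K)) := by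
      rcases le_total ‖x‖ 1 with h | h
      · calc (1 + ‖x‖) ^ (Fintype.card ι * K) ≤ (2 : ℝ) ^ (Fintype.card ι * K) := by
              gcongr; linarith
          _ ≤ _ := le_mul_of_one_le_right (by positivity) (by simp)
      · calc (1 + ‖x‖) ^ (Fintype.card ι * K) ≤ (2 * ‖x‖) ^ (Fintype.card ι * K) := by
              gcongr; linarith
          _ ≤ _ := by rw [mul_pow]; gcongr; simp
    calc ‖iteratedFDeriv ℝ j f x‖ * ∏ i, (1 + |x i|) ^ K
        ≤ ‖iteratedFDeriv ℝ j f x‖ *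
            (2 ^ (Fintype.card ι * K) * (1 + ‖x‖ ^ (Fintype.card ι * K))) := by
          gcongr; exact h3.trans h4
      _ = 2 ^ (Fintype.card ι * K) * (‖x‖ ^ 0 * ‖iteratedFDeriv ℝ j f x‖ +
            ‖x‖ ^ (Fintype.card ι * K) * ‖iteratedFDeriv ℝ j f x‖) := by ring
      _ ≤ _ := by gcongr
  exact ⟨_, by positivity, key⟩

/-- The samples of `f` on the lattice with mesh `η v` in direction `v`, shifted by `s`. -/
def sample {ι : Type*} (f : (ι → ℝ) → ℂ) (η s : ι → ℝ) (z : ι → ℕ) : ℂ :=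
  f fun v => η v * (z v + s v)

theorem iterDiff_sample {ι : Type*} [DecidableEq ι] (L : List ι) (f : (ι → ℝ) → ℂ)
    (η s : ι → ℝ) (z : ι → ℕ) :
    iterDiff (L.map fun u => (Pi.single u 1 : ι → ℕ)) (sample f η s) z =
      iterDiff (L.map fun u => (Pi.single u (η u) : ι → ℝ)) f fun v => η v * (z v + s v) := by
  induction L generalizing f with
  | nil => rfl
  | cons u L ih =>
    rw [List.map_cons, List.map_cons, iterDiff_cons, iterDiff_cons, ← ih]
    congr 1
    funext w
    simp only [stepDiff, sample]
    congr 2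
    funext v
    by_cases h : v = u
    · subst h; simp; ring
    · simp [h]

/-- Every difference of the samples gains a factor equal to the mesh, uniformly in the mesh, and the
rapid decay in the rescaled variables is kept. -/
theorem exists_norm_iterDiff_sample_le {ι : Type*} [Fintype ι] [DecidableEq ι]
    {f : (ι → ℝ) → ℂ} (hf : ContDiff ℝ ∞ f) (hR : RapidDecay f) (s : ι → ℝ) (L : List ι)
    (K : ℕ) (T : ℝ) : ∃ C : ℝ, 0 ≤ C ∧ ∀ η : ι → ℝ, (∀ v, 0 < η v) → (∀ v, η v ≤ T) → ∀ z : ι → ℕ,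
      ‖iterDiff (L.map fun u => (Pi.single u 1 : ι → ℕ)) (sample f η s) z‖ *
        ∏ v, (1 + η v * z v) ^ K ≤ C * (L.map η).prod := by
  obtain ⟨C, hC0, hC⟩ := hR.exists_bound (∑ v, T * |s v|) K L.length
  refine ⟨(∏ v, (1 + |T| * |s v|) ^ K) * C, by positivity, fun η h0 hT z => ?_⟩
  have hP : 0 < ∏ v, (1 + η v * z v) ^ K := Finset.prod_pos fun v _ => by
    have := h0 v
    positivity
  rw [iterDiff_sample]
  have hnn : ∀ u ∈ L.map fun u => (Pi.single u (η u) : ι → ℝ), 0 ≤ u := by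
    intro u hu
    obtain ⟨v, _, rfl⟩ := List.mem_map.mp hu
    exact Pi.single_nonneg.mpr (h0 v).le
  have key := norm_iterDiff_le _ hnn f hf (fun v => η v * (z v + s v))
    ((∏ v, (1 + |T| * |s v|) ^ K) * C / ∏ v, (1 + η v * z v) ^ K) ?_
  · rw [List.map_map] at key
    have hm : (norm ∘ fun u => (Pi.single u (η u) : ι → ℝ)) = η := by
      funext u
      simp [Pi.norm_single, abs_of_pos (h0 u)]
    rw [hm, div_mul_eq_mul_div, le_div_iff₀ hP] at key
    exact key
  · intro y hy
    have hs : ∀ v, η v * |s v| ≤ T * |s v| := fun v =>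
      mul_le_mul_of_nonneg_right (hT v) (abs_nonneg _)
    have hlow : ∀ v, η v * z v - η v * |s v| ≤ y v := fun v => by
      have h1 := hy v
      have h2 := mul_le_mul_of_nonneg_left (neg_abs_le (s v)) (h0 v).le
      simp only at h1
      nlinarith
    have hyR : ∀ v, -(∑ v, T * |s v|) ≤ y v := by
      intro v
      have h1 : T * |s v| ≤ ∑ v, T * |s v| :=
        Finset.single_le_sum (f := fun v => T * |s v|) (fun w _ =>
          (mul_nonneg (h0 w).le (abs_nonneg _)).trans (hs w)) (Finset.mem_univ v)
      have h2 : 0 ≤ η v * z v := mul_nonneg (h0 v).le (Nat.cast_nonneg _)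
      linarith [hlow v, hs v]
    rw [List.length_map, le_div_iff₀ hP]
    have h6 : ∏ v, (1 + η v * z v) ^ K ≤
        (∏ v, (1 + |T| * |s v|) ^ K) * ∏ v, (1 + |y v|) ^ K := by
      rw [← Finset.prod_mul_distrib]
      refine Finset.prod_le_prod (fun v _ => by have := h0 v; positivity) fun v _ => ?_
      rw [← mul_pow]
      have h3 : 1 + η v * z v ≤ (1 + |T| * |s v|) * (1 + |y v|) := by
        have h4 : T * |s v| ≤ |T| * |s v| :=
          mul_le_mul_of_nonneg_right (le_abs_self T) (abs_nonneg _)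
        have h5 : 0 ≤ |T| * |s v| * |y v| := by positivity
        nlinarith [hlow v, hs v, le_abs_self (y v)]
      have := h0 v
      gcongr
    calc _ ≤ ‖iteratedFDeriv ℝ L.length f y‖ *
          ((∏ v, (1 + |T| * |s v|) ^ K) * ∏ v, (1 + |y v|) ^ K) := by gcongr
      _ = (∏ v, (1 + |T| * |s v|) ^ K) *
          (‖iteratedFDeriv ℝ L.length f y‖ * ∏ v, (1 + |y v|) ^ K) := by ring
      _ ≤ _ := by gcongr; exact hC y hyR

theorem latticeDecay_sample {ι : Type*} [Fintype ι] [DecidableEq ι]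
    {f : (ι → ℝ) → ℂ} (hf : ContDiff ℝ ∞ f) (hR : RapidDecay f) (s η : ι → ℝ)
    (hη : ∀ v, 0 < η v) : LatticeDecay (sample f η s) := by
  intro K
  obtain ⟨C, hC0, hC⟩ := exists_norm_iterDiff_sample_le hf hR s [] K (∑ v, η v)
  refine ⟨(∏ v, (1 + (η v)⁻¹) ^ K) * C, fun z => ?_⟩
  have h := hC η hη (fun v => Finset.single_le_sum (fun w _ => (hη w).le) (Finset.mem_univ v)) z
  simp only [List.map_nil, iterDiff_nil, List.prod_nil, mul_one] at h
  have h1 : ∏ v, (1 + (z v : ℝ)) ^ K ≤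
      (∏ v, (1 + (η v)⁻¹) ^ K) * ∏ v, (1 + η v * z v) ^ K := by
    rw [← Finset.prod_mul_distrib]
    refine Finset.prod_le_prod (fun v _ => by positivity) fun v _ => ?_
    rw [← mul_pow]
    have h2 : 1 + (z v : ℝ) ≤ (1 + (η v)⁻¹) * (1 + η v * z v) := by
      have h3 := hη v
      have h4 : (η v)⁻¹ * (η v * z v) = z v := by field_simp
      have h5 : 0 ≤ η v * z v := by positivity
      have h6 : 0 < (η v)⁻¹ := by positivity
      nlinarith
    gcongr
  have hc : 0 ≤ ∏ v, (1 + (η v)⁻¹) ^ K := Finset.prod_nonneg fun v _ => by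
    have := hη v
    positivity
  calc _ ≤ ‖sample f η s z‖ * ((∏ v, (1 + (η v)⁻¹) ^ K) * ∏ v, (1 + η v * z v) ^ K) := by gcongr
    _ = (∏ v, (1 + (η v)⁻¹) ^ K) * (‖sample f η s z‖ * ∏ v, (1 + η v * z v) ^ K) := by ring
    _ ≤ _ := by gcongr

/-! ### Regular power series and the limit of their pairing with samples -/

/-- Pairs `(a, A)` of a power series and a number such that `a` behaves like the constant `A` at
`X = 1`: the coefficients of `a / (1 - X) ^ (p + 2)` differ from those of
`A / (1 - X) ^ (p + 2)` by `O(z ^ p)` only. -/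
def regularAtOne (p : ℕ) : Submodule ℂ (PowerSeries ℂ × ℂ) where
  carrier := {x | ∃ M : PowerSeries ℂ, x.1 = (1 - PowerSeries.X) ^ (p + 2) * M ∧
    ∃ C : ℝ, ∀ z : ℕ, ‖PowerSeries.coeff z M - x.2 * ((z + (p + 1)).choose (p + 1) : ℕ)‖ ≤
      C * (1 + (z : ℝ)) ^ p}
  add_mem' := by
    rintro x y ⟨M, hM, C, hC⟩ ⟨N, hN, D, hD⟩
    refine ⟨M + N, by rw [Prod.fst_add, hM, hN, mul_add], C + D, fun z => ?_⟩
    rw [map_add, Prod.snd_add, add_mul, add_sub_add_comm, add_mul]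
    exact (norm_add_le _ _).trans (add_le_add (hC z) (hD z))
  zero_mem' := ⟨0, by simp, 0, fun z => by simp⟩
  smul_mem' := by
    rintro c x ⟨M, hM, C, hC⟩
    refine ⟨c • M, by rw [Prod.smul_fst, hM, mul_smul_comm], ‖c‖ * C, fun z => ?_⟩
    rw [Prod.smul_snd, PowerSeries.coeff_smul, smul_eq_mul, smul_eq_mul, mul_assoc, ← mul_sub,
      norm_mul, mul_assoc]
    exact mul_le_mul_of_nonneg_left (hC z) (norm_nonneg c)

theorem choose_add_le_succ_pow (z d : ℕ) : (z + d).choose d ≤ (1 + z) ^ d := by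
  induction d with
  | zero => simp
  | succ d ih =>
    have h := Nat.add_one_mul_choose_eq (z + d) d
    have h1 : (z + (d + 1)).choose (d + 1) * (d + 1) ≤ (1 + z) ^ (d + 1) * (d + 1) := by
      rw [← add_assoc, ← h, pow_succ]
      calc (z + d + 1) * (z + d).choose d ≤ ((1 + z) * (d + 1)) * (1 + z) ^ d :=
            Nat.mul_le_mul (by nlinarith) ih
        _ = _ := by ring
    exact Nat.le_of_mul_le_mul_right h1 (Nat.succ_pos d)

/-- The telescoping estimate for a difference of two products. -/
theorem norm_prod_sub_prod_le_sum {ι : Type*} [DecidableEq ι] (t : Finset ι) (x y : ι → ℂ)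
    (b e : ι → ℝ) (hx : ∀ v, ‖x v‖ ≤ b v) (hy : ∀ v, ‖y v‖ ≤ b v)
    (he : ∀ v, ‖x v - y v‖ ≤ e v) :
    ‖∏ v ∈ t, x v - ∏ v ∈ t, y v‖ ≤ ∑ u ∈ t, ∏ v ∈ t, Function.update b u (e u) v := by
  have hb : ∀ v, 0 ≤ b v := fun v => (norm_nonneg _).trans (hx v)
  have he0 : ∀ v, 0 ≤ e v := fun v => (norm_nonneg _).trans (he v)
  induction t using Finset.induction_on with
  | empty => simp
  | insert a t ha ih =>
    rw [Finset.prod_insert ha, Finset.prod_insert ha, Finset.sum_insert ha]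
    have h1 : x a * ∏ v ∈ t, x v - y a * ∏ v ∈ t, y v =
        (x a - y a) * ∏ v ∈ t, x v + y a * (∏ v ∈ t, x v - ∏ v ∈ t, y v) := by ring
    rw [h1]
    refine (norm_add_le _ _).trans (add_le_add ?_ ?_)
    · rw [norm_mul, norm_prod, Finset.prod_insert ha, Function.update_self]
      refine mul_le_mul (he a) ?_ (Finset.prod_nonneg fun v _ => norm_nonneg _) (he0 a)
      refine Finset.prod_le_prod (fun v _ => norm_nonneg _) fun v hv => ?_
      rw [Function.update_of_ne (ne_of_mem_of_not_mem hv ha)]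
      exact hx v
    · rw [norm_mul]
      calc ‖y a‖ * ‖∏ v ∈ t, x v - ∏ v ∈ t, y v‖
          ≤ b a * ∑ u ∈ t, ∏ v ∈ t, Function.update b u (e u) v :=
            mul_le_mul (hy a) ih (norm_nonneg _) (hb a)
        _ = _ := by
            rw [Finset.mul_sum]
            refine Finset.sum_congr rfl fun u hu => ?_
            rw [Finset.prod_insert ha, Function.update_of_ne (ne_of_mem_of_not_mem hu ha).symm]

theorem exists_list_count_eq {ι : Type*} [Fintype ι] [DecidableEq ι] (r : ι → ℕ) :
    ∃ L : List ι, ∀ v, L.count v = r v := by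
  refine ⟨(Finsupp.toMultiset (Finsupp.equivFunOnFinite.symm r)).toList, fun v => ?_⟩
  rw [← Multiset.coe_count, Multiset.coe_toList, Finsupp.count_toMultiset]
  rfl

theorem one_sub_X_pow_mul_mk_choose (p : ℕ) (A : ℂ) :
    (1 - PowerSeries.X) ^ (p + 2) *
      (PowerSeries.C A * PowerSeries.mk fun z => ((z + (p + 1)).choose (p + 1) : ℂ)) =
      PowerSeries.C A := by
  have h := PowerSeries.mk_add_choose_mul_one_sub_pow_eq_one ℂ (p + 1)
  calc _ = PowerSeries.C A * ((PowerSeries.mk fun z => ((p + 1 + z).choose (p + 1) : ℂ)) *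
        (1 - PowerSeries.X) ^ (p + 1 + 1)) := by
        simp only [add_comm (p + 1)]
        ring
    _ = _ := by rw [h, mul_one]

/-- Pairing a product of power series regular at `X = 1` with samples of `f`: as the mesh tends to
zero, only the values of the power series at `X = 1` and of `f` at the origin survive. -/
theorem tendsto_tsum_prod_coeff_mul_sample {ι : Type*} [Fintype ι] [DecidableEq ι] (p : ι → ℕ)
    (a : ι → PowerSeries ℂ) (A : ι → ℂ) (ha : ∀ v, (a v, A v) ∈ regularAtOne (p v))
    {f : (ι → ℝ) → ℂ} (hf : ContDiff ℝ ∞ f) (hR : RapidDecay f) (s : ι → ℝ) :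
    Filter.Tendsto (fun η : ι → ℝ =>
        ∑' z : ι → ℕ, (∏ v, PowerSeries.coeff (z v) (a v)) * sample f η s z)
      (𝓝[{η | ∀ v, 0 < η v}] 0) (𝓝 ((∏ v, A v) * f 0)) := by
  choose M hM C hC using ha
  simp only at hM hC
  -- take `p v + 2` differences in direction `v`, one for every factor `1 - X` of `a v`
  obtain ⟨L, hL⟩ := exists_list_count_eq fun v => p v + 2
  -- the quotient by `(1 - X) ^ (p v + 2)` of the constant `A v`; for constants the sum is explicit
  set N : ι → PowerSeries ℂ := fun v => PowerSeries.C (A v) *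
    PowerSeries.mk fun z => ((z + (p v + 1)).choose (p v + 1) : ℂ) with hN
  have hNc : ∀ v z, PowerSeries.coeff z (N v) = A v * ((z + (p v + 1)).choose (p v + 1) : ℕ) := by
    intro v z
    simp [hN, PowerSeries.coeff_C_mul]
  have hNb : ∀ v (z : ℕ), ‖PowerSeries.coeff z (N v)‖ ≤ ‖A v‖ * (1 + (z : ℝ)) ^ (p v + 1) := by
    intro v z
    rw [hNc, norm_mul]
    gcongr
    rw [Complex.norm_natCast]
    exact_mod_cast choose_add_le_succ_pow z (p v + 1)
  have hC0 : ∀ v, 0 ≤ C v := fun v => by simpa using (norm_nonneg _).trans (hC v 0)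
  have hMN : ∀ v (z : ℕ), ‖PowerSeries.coeff z (M v) - PowerSeries.coeff z (N v)‖ ≤
      C v * (1 + (z : ℝ)) ^ p v := fun v z => by rw [hNc]; exact hC v z
  have hMb : ∀ v (z : ℕ), ‖PowerSeries.coeff z (M v)‖ ≤
      (‖A v‖ + C v) * (1 + (z : ℝ)) ^ (p v + 1) := by
    intro v z
    have h1 : ‖PowerSeries.coeff z (M v)‖ ≤ ‖PowerSeries.coeff z (N v)‖ +
        ‖PowerSeries.coeff z (M v) - PowerSeries.coeff z (N v)‖ := by
      have := norm_add_le (PowerSeries.coeff z (N v))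
        (PowerSeries.coeff z (M v) - PowerSeries.coeff z (N v))
      simpa using this
    have h2 : (1 + (z : ℝ)) ^ p v ≤ (1 + (z : ℝ)) ^ (p v + 1) :=
      pow_le_pow_right₀ (by simp) (Nat.le_succ _)
    have h3 := mul_le_mul_of_nonneg_left h2 (hC0 v)
    rw [add_mul]
    linarith [hNb v z, hMN v z]
  have hMg : ∀ v, PolyGrowth (M v) := fun v => ⟨_, _, hMb v⟩
  have hNg : ∀ v, PolyGrowth (N v) := fun v => ⟨_, _, hNb v⟩
  obtain ⟨D, hD0, hD⟩ := exists_norm_iterDiff_sample_le hf hR s L ((∑ v, p v) + 3) 1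
  set b : ι → ℝ := fun v => ‖A v‖ + C v with hb
  have hb0 : ∀ v, 0 ≤ b v := fun v => add_nonneg (norm_nonneg _) (hC0 v)
  -- the error made by replacing every `a v` by the constant `A v`
  have herr : ∀ η : ι → ℝ, (∀ v, 0 < η v) → (∀ v, η v ≤ 1) →
      ‖(∑' z : ι → ℕ, (∏ v, PowerSeries.coeff (z v) (a v)) * sample f η s z) -
        (∏ v, A v) * f fun v => η v * s v‖ ≤
      ∑ u, D * ∏ v, Function.update (fun v => b v * 2) u (b u * (η u * 2)) v := by
    intro η h0 h1
    have hdec := latticeDecay_sample hf hR s η h0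
    have e1 := tsum_one_sub_X_pow_count_mul hMg L hdec
    have e2 := tsum_one_sub_X_pow_count_mul hNg L hdec
    simp only [hL, ← hM] at e1
    have e3 : ∑' z : ι → ℕ, (∏ v, PowerSeries.coeff (z v)
        ((1 - PowerSeries.X) ^ L.count v * N v)) * sample f η s z =
        (∏ v, A v) * f fun v => η v * s v := by
      simp only [hL, hN, one_sub_X_pow_mul_mk_choose]
      rw [tsum_eq_single 0]
      · simp [sample]
      · intro z hz
        obtain ⟨v, hv⟩ := Function.ne_iff.mp hz
        rw [Finset.prod_eq_zero (Finset.mem_univ v), zero_mul]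
        rw [PowerSeries.coeff_C, if_neg (by simpa using hv)]
    have hdecL : LatticeDecay
        (iterDiff (L.map fun u => (Pi.single u 1 : ι → ℕ)) (sample f η s)) := by
      generalize L.map (fun u => (Pi.single u 1 : ι → ℕ)) = L'
      generalize sample f η s = g at hdec
      induction L' generalizing g with
      | nil => exact hdec
      | cons u L' ih => exact ih _ (hdec.stepDiff u)
    rw [← e3, e1, e2, ← (summable_prod_coeff_mul hMg hdecL).tsum_sub
      (summable_prod_coeff_mul hNg hdecL)]
    -- the difference of the quotients gains one power of `η u` in some direction `u`; in the other
    -- directions the sum over `z` is a bounded Riemann sum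
    have hterm : ∀ u v (z : ℕ), 0 ≤ Function.update
        (fun v (z : ℕ) => b v * (η v * ((1 + η v * (z : ℝ)) ^ 2)⁻¹)) u
        (fun z => b u * (η u * (η u * ((1 + η u * (z : ℝ)) ^ 2)⁻¹))) v z := by
      intro u v z
      have := h0 v; have := hb0 v
      by_cases h : v = u
      · subst h; rw [Function.update_self]; positivity
      · rw [Function.update_of_ne h]; positivity
    have hsum := fun u => summable_and_tsum_prod_le _ (hterm u)
      (Function.update (fun v => b v * 2) u (b u * (η u * 2))) (by
        intro v t
        have hv := sum_step_mul_inv_sq_le (h0 v) (h1 v) t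
        by_cases h : v = u
        · subst h
          rw [Function.update_self, Function.update_self, ← Finset.mul_sum, ← Finset.mul_sum]
          have := h0 v; have := hb0 v
          gcongr
        · rw [Function.update_of_ne h, Function.update_of_ne h, ← Finset.mul_sum]
          have := hb0 v
          gcongr)
    have hbound : ∀ z : ι → ℕ, ‖(∏ v, PowerSeries.coeff (z v) (M v)) *
          iterDiff (L.map fun u => Pi.single u 1) (sample f η s) z -
        (∏ v, PowerSeries.coeff (z v) (N v)) *
          iterDiff (L.map fun u => Pi.single u 1) (sample f η s) z‖ ≤
        ∑ u, D * ∏ v, Function.update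
        (fun v (z : ℕ) => b v * (η v * ((1 + η v * (z : ℝ)) ^ 2)⁻¹)) u
        (fun z => b u * (η u * (η u * ((1 + η u * (z : ℝ)) ^ 2)⁻¹))) v (z v) := by
      intro z
      have hpos : ∀ v, 1 ≤ 1 + η v * z v := fun v => by
        have := h0 v
        have : 0 ≤ η v * z v := by positivity
        linarith
      have hcmp : ∀ v, η v * (1 + (z v : ℝ)) ≤ 1 + η v * z v := fun v => by
        linarith [h1 v]
      rw [← sub_mul, norm_mul]
      have k1 := norm_prod_sub_prod_le_sum Finset.univ
        (fun v => PowerSeries.coeff (z v) (M v)) (fun v => PowerSeries.coeff (z v) (N v))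
        (fun v => b v * (1 + (z v : ℝ)) ^ (p v + 1)) (fun v => b v * (1 + (z v : ℝ)) ^ p v)
        (fun v => hMb v _) (fun v => (hNb v _).trans (by
          have := hC0 v
          gcongr
          simp [hb, this]))
        (fun v => (hMN v _).trans (by
          gcongr
          simp [hb]))
      have hP : 0 < ∏ v, (1 + η v * z v) ^ ((∑ v, p v) + 3) :=
        Finset.prod_pos fun v _ => pow_pos (one_pos.trans_le (hpos v)) _
      have k2 := hD η h0 h1 z
      rw [← le_div_iff₀ hP, Finset.prod_list_map_count, mul_div_assoc] at k2
      have k3 : ∏ m ∈ L.toFinset, η m ^ L.count m = ∏ v, η v ^ (p v + 2) := by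
        rw [← Finset.prod_subset (Finset.subset_univ L.toFinset)]
        · exact Finset.prod_congr rfl fun v _ => by rw [hL]
        · intro v _ hv
          rw [← hL, List.count_eq_zero_of_not_mem (by simpa using hv), pow_zero]
      rw [k3, ← Finset.prod_div_distrib] at k2
      refine (mul_le_mul k1 k2 (norm_nonneg _) (Finset.sum_nonneg fun u _ =>
        Finset.prod_nonneg fun v _ => ?_)).trans ?_
      · have := hb0 v; have := hb0 u
        by_cases h : v = u
        · subst h; rw [Function.update_self]; positivity
        · rw [Function.update_of_ne h]; positivity
      · rw [Finset.sum_mul]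
        refine Finset.sum_le_sum fun u _ => ?_
        rw [mul_left_comm, ← Finset.prod_mul_distrib]
        refine mul_le_mul_of_nonneg_left (Finset.prod_le_prod (fun v _ => ?_) fun v _ => ?_) hD0
        · have := hb0 v; have := hb0 u; have := h0 v
          by_cases h : v = u
          · subst h; rw [Function.update_self]; positivity
          · rw [Function.update_of_ne h]; positivity
        · have hq : 0 < 1 + η v * z v := one_pos.trans_le (hpos v)
          have hz0 : (0 : ℝ) ≤ 1 + z v := by positivity
          have hpe : (1 + η v * z v) ^ (p v + 1) * (1 + η v * z v) ^ 2 ≤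
              (1 + η v * z v) ^ ((∑ v, p v) + 3) := by
            rw [← pow_add]
            refine pow_le_pow_right₀ (hpos v) ?_
            have := Finset.single_le_sum (f := p) (fun _ _ => Nat.zero_le _) (Finset.mem_univ v)
            omega
          have hη := h0 v
          have hbv := hb0 v
          by_cases h : v = u
          · subst h
            rw [Function.update_self, Function.update_self, mul_assoc]
            refine mul_le_mul_of_nonneg_left ?_ hbv
            rw [← mul_assoc (η v), ← div_eq_mul_inv, mul_div_assoc',
              div_le_div_iff₀ (by positivity) (by positivity)]
            have g1 : (η v * (1 + (z v : ℝ))) ^ p v ≤ (1 + η v * z v) ^ (p v + 1) :=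
              (pow_le_pow_left₀ (by positivity) (hcmp v) _).trans
                (pow_le_pow_right₀ (hpos v) (Nat.le_succ _))
            calc (1 + (z v : ℝ)) ^ p v * η v ^ (p v + 2) * (1 + η v * z v) ^ 2
                = η v * η v * ((η v * (1 + (z v : ℝ))) ^ p v * (1 + η v * z v) ^ 2) := by
                  rw [mul_pow]; ring
              _ ≤ η v * η v * ((1 + η v * z v) ^ (p v + 1) * (1 + η v * z v) ^ 2) := by gcongr
              _ ≤ _ := by gcongr
          · rw [Function.update_of_ne h, Function.update_of_ne h, mul_assoc]
            refine mul_le_mul_of_nonneg_left ?_ hbv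
            rw [← div_eq_mul_inv, mul_div_assoc', div_le_div_iff₀ (by positivity) (by positivity)]
            have g1 : (η v * (1 + (z v : ℝ))) ^ (p v + 1) ≤ (1 + η v * z v) ^ (p v + 1) :=
              pow_le_pow_left₀ (by positivity) (hcmp v) _
            calc (1 + (z v : ℝ)) ^ (p v + 1) * η v ^ (p v + 2) * (1 + η v * z v) ^ 2
                = η v * ((η v * (1 + (z v : ℝ))) ^ (p v + 1) * (1 + η v * z v) ^ 2) := by
                  rw [mul_pow]; ring
              _ ≤ η v * ((1 + η v * z v) ^ (p v + 1) * (1 + η v * z v) ^ 2) := by gcongr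
              _ ≤ _ := by gcongr
    have hS := summable_sum fun u (_ : u ∈ Finset.univ) => (hsum u).1.mul_left D
    refine (tsum_of_norm_bounded hS.hasSum hbound).trans ?_
    rw [Summable.tsum_finsetSum fun u _ => (hsum u).1.mul_left D]
    refine Finset.sum_le_sum fun u _ => ?_
    rw [tsum_mul_left]
    exact mul_le_mul_of_nonneg_left (hsum u).2 hD0
  have hlim0 : Filter.Tendsto (fun η : ι → ℝ =>
      ∑ u, D * ∏ v, Function.update (fun v => b v * 2) u (b u * (η u * 2)) v)
      (𝓝[{η | ∀ v, 0 < η v}] 0) (𝓝 0) := by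
    refine tendsto_nhdsWithin_of_tendsto_nhds ?_
    have hcont : Continuous (fun η : ι → ℝ =>
        ∑ u, D * ∏ v, Function.update (fun v => b v * 2) u (b u * (η u * 2)) v) := by
      refine continuous_finsetSum _ fun u _ => continuous_const.mul
        (continuous_finsetProd _ fun v _ => ?_)
      by_cases h : v = u
      · subst h
        simp only [Function.update_self]
        fun_prop
      · simp only [Function.update_of_ne h]
        fun_prop
    have h := hcont.tendsto 0
    have h0 : (∑ u, D * ∏ v, Function.update (fun v => b v * 2) u
        (b u * ((0 : ι → ℝ) u * 2)) v) = 0 := by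
      refine Finset.sum_eq_zero fun u _ => ?_
      rw [Finset.prod_eq_zero (Finset.mem_univ u), mul_zero]
      simp
    rwa [h0] at h
  have hev : ∀ᶠ η : ι → ℝ in 𝓝[{η | ∀ v, 0 < η v}] 0, (∀ v, 0 < η v) ∧ ∀ v, η v ≤ 1 := by
    refine (eventually_mem_nhdsWithin).and (Filter.Eventually.filter_mono nhdsWithin_le_nhds ?_)
    filter_upwards [Metric.ball_mem_nhds (0 : ι → ℝ) one_pos] with η hη v
    have h1 := norm_le_pi_norm η v
    rw [mem_ball_zero_iff] at hη
    exact (le_abs_self _).trans (h1.trans hη.le)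
  have hz := squeeze_zero_norm' (hev.mono fun η h => herr η h.1 h.2) hlim0
  have hmain : Filter.Tendsto (fun η : ι → ℝ => (∏ v, A v) * f fun v => η v * s v)
      (𝓝[{η | ∀ v, 0 < η v}] 0) (𝓝 ((∏ v, A v) * f 0)) := by
    refine tendsto_nhdsWithin_of_tendsto_nhds (Filter.Tendsto.const_mul _ ?_)
    have hcont : Continuous fun η : ι → ℝ => f fun v => η v * s v :=
      hf.continuous.comp (by fun_prop)
    have h := hcont.tendsto 0
    simpa [← Pi.zero_def] using h
  simpa using hz.add hmain

/-! ### Binomial series and their regularity -/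

/-- The series `∑ n, ζ ^ n * binom (n + d) d * X ^ (N * n)`. -/
def binomSeries (ζ : ℂ) (N d : ℕ) : PowerSeries ℂ :=
  PowerSeries.mk fun z => if N ∣ z then ζ ^ (z / N) * ((z / N + d).choose d : ℕ) else 0

theorem binomSeries_mul_one_sub (ζ : ℂ) {N : ℕ} (hN : 0 < N) (d : ℕ) :
    binomSeries ζ N d * (1 - PowerSeries.C ζ * PowerSeries.X ^ N) ^ (d + 1) = 1 := by
  have hcoeff : ∀ e z, PowerSeries.coeff z
      (binomSeries ζ N e * (1 - PowerSeries.C ζ * PowerSeries.X ^ N)) =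
      PowerSeries.coeff z (binomSeries ζ N e) -
        ζ * (if N ≤ z then PowerSeries.coeff (z - N) (binomSeries ζ N e) else 0) := by
    intro e z
    rw [mul_sub, mul_one, mul_left_comm, map_sub, PowerSeries.coeff_C_mul,
      PowerSeries.coeff_mul_X_pow']
  induction d with
  | zero =>
    ext z
    rw [zero_add, pow_one, hcoeff]
    simp only [binomSeries, PowerSeries.coeff_mk, add_zero, Nat.choose_zero_right, Nat.cast_one,
      mul_one, PowerSeries.coeff_one]
    by_cases hz : N ∣ z
    · obtain ⟨n, rfl⟩ := hz
      rcases n with _ | n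
      · simp [hN.ne']
      · have h1 : N * (n + 1) - N = N * n := by rw [Nat.mul_succ]; omega
        have h2 : N ≤ N * (n + 1) := Nat.le_mul_of_pos_right _ (Nat.succ_pos _)
        rw [h1]
        simp [h2, hN.ne', pow_succ']
    · have hz0 : z ≠ 0 := fun h => hz (h ▸ dvd_zero N)
      rw [if_neg hz, if_neg hz0]
      by_cases h2 : N ≤ z
      · rw [if_pos h2, if_neg
          (fun h => hz (by simpa [Nat.sub_add_cancel h2] using dvd_add h (dvd_refl N)))]
        simp
      · rw [if_neg h2]; simp
  | succ d ih =>
    have h : binomSeries ζ N (d + 1) * (1 - PowerSeries.C ζ * PowerSeries.X ^ N) =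
        binomSeries ζ N d := by
      ext z
      rw [hcoeff]
      simp only [binomSeries, PowerSeries.coeff_mk]
      by_cases hz : N ∣ z
      · obtain ⟨n, rfl⟩ := hz
        rcases n with _ | n
        · simp [hN.ne']
        · have h1 : N * (n + 1) - N = N * n := by rw [Nat.mul_succ]; omega
          have h2 : N ≤ N * (n + 1) := Nat.le_mul_of_pos_right _ (Nat.succ_pos _)
          rw [h1]
          simp only [dvd_mul_right, if_true, h2, Nat.mul_div_cancel_left _ hN]
          have h3 : (n + 1 + (d + 1)).choose (d + 1) =
              (n + 1 + d).choose d + (n + (d + 1)).choose (d + 1) := by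
            rw [← add_assoc, Nat.choose_succ_succ', show n + 1 + d = n + (d + 1) by ring]
          rw [h3]
          push_cast
          ring
      · rw [if_neg hz, if_neg hz]
        by_cases h2 : N ≤ z
        · rw [if_pos h2, if_neg
          (fun h => hz (by simpa [Nat.sub_add_cancel h2] using dvd_add h (dvd_refl N)))]
          simp
        · rw [if_neg h2]; simp
    rw [pow_succ', ← mul_assoc, h, ih]

theorem norm_coeff_binomSeries_le {ζ : ℂ} (hζ : ‖ζ‖ = 1) (N d z : ℕ) :
    ‖PowerSeries.coeff z (binomSeries ζ N d)‖ ≤ 1 * (1 + (z : ℝ)) ^ d := by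
  rw [binomSeries, PowerSeries.coeff_mk]
  split_ifs
  · rw [norm_mul, norm_pow, hζ, one_pow, one_mul, one_mul, Complex.norm_natCast]
    calc (((z / N + d).choose d : ℕ) : ℝ) ≤ (((1 + z / N) ^ d : ℕ) : ℝ) := by
          exact_mod_cast choose_add_le_succ_pow _ _
      _ ≤ (1 + (z : ℝ)) ^ d := by
          push_cast
          gcongr
          exact_mod_cast Nat.div_le_self z N
  · rw [norm_zero]; positivity

/-- The factor theorem, in the form that exhibits a factor `1 - X` for `x = 1`. -/
theorem exists_eq_C_eval_add (A : Polynomial ℂ) (x : ℂ) :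
    ∃ A' : Polynomial ℂ, A = Polynomial.C (A.eval x) + (Polynomial.C x - Polynomial.X) * A' := by
  obtain ⟨B, hB⟩ := Polynomial.X_sub_C_dvd_sub_C_eval (a := x) (p := A)
  exact ⟨-B, by linear_combination hB⟩

/-- A numerator that agrees to order `d + 2` at `X = 1` with a multiple `A` of the denominator
gives a quotient that behaves like the constant `A 1` there. -/
theorem mul_binomSeries_mem_regularAtOne {ζ : ℂ} (hζ : ‖ζ‖ = 1) {N : ℕ} (hN : 0 < N) (d : ℕ)
    (P A B : Polynomial ℂ)
    (h : P = A * (1 - Polynomial.C ζ * Polynomial.X ^ N) ^ (d + 1) +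
      B * (1 - Polynomial.X) ^ (d + 2)) :
    ((P : PowerSeries ℂ) * binomSeries ζ N d, A.eval 1) ∈ regularAtOne d := by
  obtain ⟨A', hA'⟩ := exists_eq_C_eval_add A 1
  have hE := binomSeries_mul_one_sub ζ hN d
  have h1 := one_sub_X_pow_mul_mk_choose d (A.eval 1)
  have h2 := binomSeries_mul_one_sub 1 one_pos d
  rw [map_one, one_mul, pow_one] at h2
  obtain ⟨C₁, hC₁⟩ := exists_norm_coeff_polynomial_mul_le
    ⟨1, norm_coeff_binomSeries_le (ζ := 1) (by simp) 1 d⟩ A'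
  obtain ⟨C₂, hC₂⟩ := exists_norm_coeff_polynomial_mul_le
    ⟨1, norm_coeff_binomSeries_le hζ N d⟩ B
  have hA'' : (A : PowerSeries ℂ) = PowerSeries.C (A.eval 1) +
      (1 - PowerSeries.X) * (A' : PowerSeries ℂ) := by
    conv_lhs => rw [hA']
    push_cast
    simp
  have hP : (P : PowerSeries ℂ) = (A : PowerSeries ℂ) *
      (1 - PowerSeries.C ζ * PowerSeries.X ^ N) ^ (d + 1) +
      (B : PowerSeries ℂ) * (1 - PowerSeries.X) ^ (d + 2) := by
    rw [h]
    push_cast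
    simp
  refine ⟨PowerSeries.C (A.eval 1) * (PowerSeries.mk fun z => ((z + (d + 1)).choose (d + 1) : ℂ)) +
    (A' : PowerSeries ℂ) * binomSeries 1 1 d + (B : PowerSeries ℂ) * binomSeries ζ N d, ?_,
    C₁ + C₂, fun z => ?_⟩
  · simp only
    rw [hP]
    calc _ = (A : PowerSeries ℂ) * (binomSeries ζ N d *
            (1 - PowerSeries.C ζ * PowerSeries.X ^ N) ^ (d + 1)) +
          (B : PowerSeries ℂ) * (1 - PowerSeries.X) ^ (d + 2) * binomSeries ζ N d := by ring
      _ = PowerSeries.C (A.eval 1) + (1 - PowerSeries.X) * (A' : PowerSeries ℂ) *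
            (binomSeries 1 1 d * (1 - PowerSeries.X) ^ (d + 1)) +
          (B : PowerSeries ℂ) * (1 - PowerSeries.X) ^ (d + 2) * binomSeries ζ N d := by
          rw [hE, h2, hA'']; ring
      _ = _ := by
          conv_lhs => rw [← h1]
          ring
  · have hz : PowerSeries.coeff z (PowerSeries.C (A.eval 1) *
        (PowerSeries.mk fun z => ((z + (d + 1)).choose (d + 1) : ℂ))) =
        A.eval 1 * ((z + (d + 1)).choose (d + 1) : ℕ) := by
      rw [PowerSeries.coeff_C_mul, PowerSeries.coeff_mk]
    rw [map_add, map_add, hz, add_assoc, add_sub_cancel_left, add_mul]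
    exact (norm_add_le _ _).trans (add_le_add (hC₁ z) (hC₂ z))

/-- If `ζ ≠ 1`, the denominator does not vanish at `X = 1`, so the series is regular there. -/
theorem X_pow_mul_binomSeries_mem_regularAtOne {ζ : ℂ} (hζ : ‖ζ‖ = 1) (h1 : ζ ≠ 1) {N : ℕ}
    (hN : 0 < N) (d o : ℕ) :
    (PowerSeries.X ^ o * binomSeries ζ N d, ((1 - ζ) ^ (d + 1))⁻¹) ∈ regularAtOne d := by
  have h0 : 1 - ζ ≠ 0 := sub_ne_zero.mpr h1.symm
  obtain ⟨Q, hQ⟩ := exists_eq_C_eval_add (1 - Polynomial.C ζ * Polynomial.X ^ N) 1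
  have hcop : IsCoprime (1 - Polynomial.C ζ * Polynomial.X ^ N) (1 - Polynomial.X : Polynomial ℂ) := by
    refine ⟨Polynomial.C (1 - ζ)⁻¹, -Polynomial.C (1 - ζ)⁻¹ * Q, ?_⟩
    have hev : (1 - Polynomial.C ζ * Polynomial.X ^ N : Polynomial ℂ).eval 1 = 1 - ζ := by simp
    rw [hev] at hQ
    have hc : Polynomial.C (1 - ζ)⁻¹ * Polynomial.C (1 - ζ) = (1 : Polynomial ℂ) := by
      rw [← Polynomial.C_mul, inv_mul_cancel₀ h0, Polynomial.C_1]
    rw [map_one] at hQ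
    linear_combination Polynomial.C (1 - ζ)⁻¹ * hQ + hc
  obtain ⟨U, V, hUV⟩ := hcop.pow (m := d + 1) (n := d + 2)
  have key := mul_binomSeries_mem_regularAtOne hζ hN d (Polynomial.X ^ o)
    (Polynomial.X ^ o * U) (Polynomial.X ^ o * V)
    (by linear_combination -(Polynomial.X : Polynomial ℂ) ^ o * hUV)
  have hev : (Polynomial.X ^ o * U).eval 1 = ((1 - ζ) ^ (d + 1))⁻¹ := by
    have := congrArg (Polynomial.eval 1) hUV
    simp at this
    refine eq_inv_of_mul_eq_one_left ?_
    simpa using this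
  rw [hev] at key
  simpa using key

/-- At `ζ = 1`, the pole at `X = 1` is cancelled by a product of at least `d + 1` factors
`1 - X ^ g i`. -/
theorem prod_one_sub_mul_binomSeries_mem_regularAtOne {J : Type*} [Fintype J] (g : J → ℕ) {N : ℕ}
    (hN : 0 < N) (d : ℕ) (hd : d + 1 ≤ Fintype.card J) :
    ((∏ i, (1 - PowerSeries.X ^ g i)) * binomSeries 1 N d,
      if Fintype.card J = d + 1 then ((∏ i, (g i : ℂ)) / (N : ℂ) ^ (d + 1)) else 0) ∈
      regularAtOne d := by
  have hfac : ∀ m : ℕ, (1 - Polynomial.X ^ m : Polynomial ℂ) =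
      (1 - Polynomial.X) * ∑ i ∈ Finset.range m, Polynomial.X ^ i := fun m =>
    (mul_neg_geom_sum _ m).symm
  -- numerator and denominator after division by `(1 - X) ^ (d + 1)`
  set R : Polynomial ℂ := (1 - Polynomial.X) ^ (Fintype.card J - (d + 1)) *
    ∏ i, ∑ j ∈ Finset.range (g i), Polynomial.X ^ j with hR
  set T : Polynomial ℂ := (∑ j ∈ Finset.range N, Polynomial.X ^ j) ^ (d + 1) with hT
  have hN0 : (N : ℂ) ^ (d + 1) ≠ 0 := pow_ne_zero _ (Nat.cast_ne_zero.mpr hN.ne')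
  have hTev : T.eval 1 = (N : ℂ) ^ (d + 1) := by simp [hT, Polynomial.eval_finsetSum]
  have hRev : R.eval 1 = if Fintype.card J = d + 1 then ∏ i, (g i : ℂ) else 0 := by
    simp only [hR, Polynomial.eval_mul, Polynomial.eval_pow, Polynomial.eval_prod,
      Polynomial.eval_finsetSum, Polynomial.eval_sub, Polynomial.eval_one, Polynomial.eval_X,
      one_pow, sub_self]
    split_ifs with h
    · simp [h]
    · rw [zero_pow (by omega), zero_mul]
  obtain ⟨B, hB⟩ := exists_eq_C_eval_add
    (R - Polynomial.C (R.eval 1 / (N : ℂ) ^ (d + 1)) * T) 1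
  have h0 : (R - Polynomial.C (R.eval 1 / (N : ℂ) ^ (d + 1)) * T).eval 1 = 0 := by
    rw [Polynomial.eval_sub, Polynomial.eval_mul (p := Polynomial.C _), Polynomial.eval_C, hTev]
    field_simp
    ring
  rw [h0, map_zero, zero_add, map_one] at hB
  have key := mul_binomSeries_mem_regularAtOne (ζ := 1) (by simp) hN d
    (∏ i, (1 - Polynomial.X ^ g i)) (Polynomial.C (R.eval 1 / (N : ℂ) ^ (d + 1))) B (by
      have hcard : (∏ i, (1 - Polynomial.X ^ g i) : Polynomial ℂ) =
          (1 - Polynomial.X) ^ (d + 1) * R := by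
        simp only [hfac, Finset.prod_mul_distrib, Finset.prod_const, Finset.card_univ, hR]
        rw [← mul_assoc, ← pow_add, Nat.add_sub_cancel' hd]
      rw [hcard, map_one, one_mul, hfac N, mul_pow, ← hT]
      linear_combination (1 - Polynomial.X) ^ (d + 1) * hB)
  rw [Polynomial.eval_C, hRev] at key
  have hcoe : ((∏ i, (1 - Polynomial.X ^ g i) : Polynomial ℂ) : PowerSeries ℂ) =
      ∏ i, (1 - PowerSeries.X ^ g i) := by
    rw [← Polynomial.coeToPowerSeries.ringHom_apply, map_prod]
    simp
  rw [hcoe] at key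
  split_ifs at key ⊢ with h
  · exact key
  · simpa using key

theorem C_mem_regularAtOne (p : ℕ) (A : ℂ) : (PowerSeries.C A, A) ∈ regularAtOne p := by
  refine ⟨_, (one_sub_X_pow_mul_mk_choose p A).symm, 0, fun z => ?_⟩
  rw [PowerSeries.coeff_C_mul, PowerSeries.coeff_mk]
  simp

/-! ### Fourier analysis on residues -/

/-- If the nontrivial Fourier modes of `y` lie in `S`, then modulo `S` a combination of the `y r`
depends on the sum of its coefficients only. -/
theorem sum_smul_sub_mean_mem {E : Type*} [AddCommGroup E] [Module ℂ E] (S : Submodule ℂ E)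
    {k : ℕ} (hk : 0 < k) (y : Fin k → E)
    (h : ∀ ζ : ℂ, ζ ^ k = 1 → ζ ≠ 1 → ∑ r : Fin k, ζ ^ (r : ℕ) • y r ∈ S) (x : Fin k → ℂ) :
    ∑ r, x r • y r - ((∑ r, x r) / k) • ∑ r, y r ∈ S := by
  have hk0 : (k : ℂ) ≠ 0 := Nat.cast_ne_zero.mpr hk.ne'
  have hρ := Complex.isPrimitiveRoot_exp k hk.ne'
  set ρ := Complex.exp (2 * Real.pi * Complex.I / k) with hρdef
  have hρ0 : ρ ≠ 0 := Complex.exp_ne_zero _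
  have horth : ∀ r q : Fin k, ∑ s ∈ Finset.range k, ((ρ ^ (q : ℕ))⁻¹ * ρ ^ (r : ℕ)) ^ s =
      if r = q then (k : ℂ) else 0 := by
    intro r q
    split_ifs with hrq
    · subst hrq
      rw [inv_mul_cancel₀ (pow_ne_zero _ hρ0)]
      simp
    · have h1 : (ρ ^ (q : ℕ))⁻¹ * ρ ^ (r : ℕ) - 1 ≠ 0 := by
        intro h0
        rw [sub_eq_zero, inv_mul_eq_one₀ (pow_ne_zero _ hρ0)] at h0
        exact hrq (Fin.ext (hρ.pow_inj q.2 r.2 h0).symm)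
      have h2 := mul_geom_sum ((ρ ^ (q : ℕ))⁻¹ * ρ ^ (r : ℕ)) k
      rw [mul_pow, inv_pow, ← pow_mul, ← pow_mul, mul_comm _ k, mul_comm _ k, pow_mul, pow_mul,
        hρ.pow_eq_one, one_pow, one_pow, inv_one, one_mul, sub_self] at h2
      exact (mul_eq_zero.mp h2).resolve_left h1
  have hexp : ∑ r, x r • y r = ∑ s ∈ Finset.range k,
      ((∑ q, x q * (ρ ^ (q : ℕ))⁻¹ ^ s) / k) • ∑ r : Fin k, (ρ ^ s) ^ (r : ℕ) • y r := by
    simp only [Finset.smul_sum, smul_smul]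
    rw [Finset.sum_comm]
    refine Finset.sum_congr rfl fun r _ => ?_
    rw [← Finset.sum_smul]
    congr 1
    simp only [Finset.sum_div, Finset.sum_mul]
    rw [Finset.sum_comm]
    have : ∀ q : Fin k, ∑ s ∈ Finset.range k,
        x q * (ρ ^ (q : ℕ))⁻¹ ^ s / k * (ρ ^ s) ^ (r : ℕ) = if r = q then x q else 0 := by
      intro q
      have h3 := congrArg (fun t => x q / k * t) (horth r q)
      simp only [Finset.mul_sum] at h3
      rw [Finset.sum_congr rfl (fun s _ => ?_), h3]
      · split_ifs
        · field_simp
        · simp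
      · rw [mul_pow, ← pow_mul, ← pow_mul ρ, mul_comm s (r : ℕ)]
        ring
    rw [Finset.sum_congr rfl fun q _ => this q, Finset.sum_ite_eq, if_pos (Finset.mem_univ r)]
  rw [hexp, ← Finset.add_sum_erase _ _ (Finset.mem_range.mpr hk)]
  simp only [pow_zero, mul_one, one_pow, one_smul, add_sub_cancel_left]
  refine S.sum_mem fun s hs => S.smul_mem _ (h _ ?_ ?_)
  · rw [← pow_mul, mul_comm, pow_mul, hρ.pow_eq_one, one_pow]
  · have hs' := Finset.mem_erase.mp hs
    exact hρ.pow_ne_one_of_pos_of_lt hs'.1 (Finset.mem_range.mp hs'.2)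

/-! ### Finite differences of polynomials -/

/-- The iterated difference with steps `y i`, `i ∈ S`, of a polynomial of degree at most `#S` is a
constant determined by the leading coefficient. -/
theorem sum_powerset_neg_one_pow_mul_eval {J : Type*} [DecidableEq J] (S : Finset J) (y : J → ℚ)
    (q : Polynomial ℚ) (hq : q.natDegree ≤ S.card) (x : ℚ) :
    ∑ T ∈ S.powerset, (-1) ^ T.card * q.eval (x + ∑ i ∈ T, y i) =
      (-1) ^ S.card * (S.card ! : ℚ) * (∏ i ∈ S, y i) * q.coeff S.card := by
  induction S using Finset.induction_on generalizing q with
  | empty =>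
    rw [Finset.card_empty, Nat.le_zero] at hq
    rw [Polynomial.eq_C_of_natDegree_eq_zero hq]
    simp
  | insert a S ha ih =>
    rw [Finset.card_insert_of_notMem ha] at hq ⊢
    set m := S.card with hm
    have hz : ∀ n, m + 1 < n → q.coeff n = 0 := fun n hn =>
      Polynomial.coeff_eq_zero_of_natDegree_lt (hq.trans_lt hn)
    have hH : ∀ n, m + 1 ≤ n → Polynomial.hasseDeriv n q = Polynomial.C (q.coeff n) := by
      intro n hn
      ext j
      rw [Polynomial.hasseDeriv_coeff, Polynomial.coeff_C]
      rcases j with _ | j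
      · simp
      · rw [hz _ (by omega)]; simp
    have hH' : Polynomial.hasseDeriv m q =
        Polynomial.C (q.coeff m) + Polynomial.C ((m + 1) * q.coeff (m + 1)) * Polynomial.X := by
      ext j
      rw [Polynomial.hasseDeriv_coeff, Polynomial.coeff_add, Polynomial.coeff_C,
        Polynomial.coeff_C_mul, Polynomial.coeff_X]
      rcases j with _ | _ | j
      · simp
      · simp [add_comm 1 m]
      · rw [hz _ (by omega)]; simp
    -- one difference lowers the degree and controls the next coefficient
    have hdeg : (q - Polynomial.taylor (y a) q).natDegree ≤ m := by
      rw [Polynomial.natDegree_le_iff_coeff_eq_zero]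
      intro n hn
      rw [Polynomial.coeff_sub, Polynomial.taylor_coeff, hH n hn, Polynomial.eval_C, sub_self]
    have hco : (q - Polynomial.taylor (y a) q).coeff m = -((m + 1) * q.coeff (m + 1) * y a) := by
      rw [Polynomial.coeff_sub, Polynomial.taylor_coeff, hH']
      simp
    rw [Finset.sum_powerset_insert ha, ← Finset.sum_add_distrib, Finset.prod_insert ha]
    calc _ = ∑ T ∈ S.powerset, (-1) ^ T.card *
          (q - Polynomial.taylor (y a) q).eval (x + ∑ i ∈ T, y i) := by
          refine Finset.sum_congr rfl fun T hT => ?_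
          have haT : a ∉ T := fun h => ha (Finset.mem_powerset.mp hT h)
          rw [Finset.card_insert_of_notMem haT, Finset.sum_insert haT, Polynomial.eval_sub,
            Polynomial.taylor_eval, pow_succ]
          ring_nf
      _ = _ := by
          rw [ih _ hdeg, hco, Nat.factorial_succ]
          push_cast
          ring

/-! ### Sign vectors -/

section Signs

variable {J : Type*} [Fintype J]

/-- The product of the signs of a sign vector. -/
def signProd (l : J → ℤˣ) : ℤ := ∏ i, (l i : ℤ)

/-- The sum of the reciprocals of the weights at which the sign vector is negative. -/
def signShift (wt : J → ℕ) (l : J → ℤˣ) : ℚ := ∑ i, if l i = -1 then (wt i : ℚ)⁻¹ else 0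

/-- `signShift` scaled by the product of all weights, a natural number. -/
def signOffset (wt : J → ℕ) (l : J → ℤˣ) : ℕ := ∑ i, if l i = -1 then (∏ j, wt j) / wt i else 0

theorem signOffset_cast {wt : J → ℕ} (hwt : ∀ i, 0 < wt i) (l : J → ℤˣ) :
    (signOffset wt l : ℚ) = (∏ j, wt j : ℕ) * signShift wt l := by
  rw [signOffset, signShift, Nat.cast_sum, Finset.mul_sum]
  refine Finset.sum_congr rfl fun i _ => ?_
  split_ifs
  · rw [Nat.cast_div (Finset.dvd_prod_of_mem _ (Finset.mem_univ i))
      (Nat.cast_ne_zero.mpr (hwt i).ne'), div_eq_mul_inv]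
  · simp

variable [DecidableEq J]

theorem sum_signProd_mul (F : Finset J → ℚ) :
    ∑ l : J → ℤˣ, (signProd l : ℚ) * F (Finset.univ.filter fun i => l i = -1) =
      ∑ T ∈ (Finset.univ : Finset J).powerset, (-1) ^ T.card * F T := by
  refine Finset.sum_bij' (fun l _ => Finset.univ.filter fun i => l i = -1)
    (fun T _ i => if i ∈ T then -1 else 1) ?_ ?_ ?_ ?_ ?_
  · simp
  · simp
  · intro l _
    funext i
    rcases Int.units_eq_one_or (l i) with h | h <;> simp [h]
  · intro T _
    ext i
    by_cases h : i ∈ T <;> simp [h]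
  · intro l _
    congr 1
    rw [signProd, ← Finset.prod_filter_mul_prod_filter_not Finset.univ (fun i => l i = -1)]
    have h1 : ∏ i ∈ Finset.univ.filter (fun i => l i = -1), (l i : ℤ) =
        (-1) ^ (Finset.univ.filter fun i => l i = -1).card := by
      rw [Finset.prod_congr rfl (g := fun _ => (-1 : ℤ)) (fun i hi => by
        rw [(Finset.mem_filter.mp hi).2]; rfl), Finset.prod_const]
    have h2 : ∏ i ∈ Finset.univ.filter (fun i => ¬ l i = -1), (l i : ℤ) = 1 := by
      refine Finset.prod_eq_one fun i hi => ?_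
      rw [(Int.units_eq_one_or (l i)).resolve_right (Finset.mem_filter.mp hi).2]
      rfl
    rw [h1, h2]
    simp

/-- Alternating sums over sign vectors are finite differences. -/
theorem sum_signProd_mul_eval (wt : J → ℕ) (q : Polynomial ℚ) (hq : q.natDegree ≤ Fintype.card J)
    (x : ℚ) :
    ∑ l : J → ℤˣ, (signProd l : ℚ) * q.eval (x + signShift wt l) =
      (-1) ^ Fintype.card J * ((Fintype.card J)! : ℚ) * (∏ i, (wt i : ℚ)⁻¹) *
        q.coeff (Fintype.card J) := by
  have h := sum_powerset_neg_one_pow_mul_eval Finset.univ (fun i => (wt i : ℚ)⁻¹) q hq x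
  rw [Finset.card_univ] at h
  rw [← h, ← sum_signProd_mul fun T => q.eval (x + ∑ i ∈ T, (wt i : ℚ)⁻¹)]
  refine Finset.sum_congr rfl fun l _ => ?_
  rw [signShift, Finset.sum_filter]

theorem sum_signProd_smul_X_pow (wt : J → ℕ) :
    ∑ l : J → ℤˣ, (signProd l : ℂ) • (PowerSeries.X ^ signOffset wt l : PowerSeries ℂ) =
      ∏ i, (1 - PowerSeries.X ^ ((∏ j, wt j) / wt i)) := by
  have h : ∀ i, (1 - PowerSeries.X ^ ((∏ j, wt j) / wt i) : PowerSeries ℂ) =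
      ∑ e : ℤˣ, ((e : ℤ) : ℂ) • PowerSeries.X ^ (if e = -1 then (∏ j, wt j) / wt i else 0) := by
    intro i
    rw [show (Finset.univ : Finset ℤˣ) = {1, -1} from rfl, Finset.sum_pair (by decide)]
    rw [if_neg (by decide)]
    simp [sub_eq_add_neg]
  simp only [h]
  rw [Finset.prod_univ_sum, Fintype.piFinset_univ]
  refine Finset.sum_congr rfl fun l _ => ?_
  rw [Finset.prod_smul, Finset.prod_pow_eq_pow_sum, signProd, signOffset]
  push_cast
  rfl

end Signs

/-! ### The polynomial `binom (x + d) d` and Bernoulli polynomials -/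

/-- The polynomial `(x + d) ⋯ (x + 1) / d!`. -/
noncomputable def binomPoly (d : ℕ) : Polynomial ℚ :=
  Polynomial.C (1 / (d ! : ℚ)) * ∏ j ∈ Finset.Icc 1 d, (Polynomial.X + Polynomial.C (j : ℚ))

theorem binomPoly_eq (d : ℕ) : binomPoly d =
    Polynomial.C (1 / (d ! : ℚ)) * (ascPochhammer ℚ d).comp (Polynomial.X + 1) := by
  rw [binomPoly]
  congr 1
  induction d with
  | zero => simp
  | succ d ih =>
    rw [Finset.prod_Icc_succ_top (by omega), ih, ascPochhammer_succ_right, Polynomial.mul_comp]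
    congr 1
    simp
    ring

theorem eval_binomPoly (d n : ℕ) : (binomPoly d).eval (n : ℚ) = ((n + d).choose d : ℕ) := by
  have h1 : (Polynomial.eval ((n : ℚ) + 1) (ascPochhammer ℚ d)) = (((n + 1).ascFactorial d : ℕ) : ℚ) := by
    rw [← ascPochhammer_nat_eq_ascFactorial, ascPochhammer_eval_cast]
    push_cast
    rfl
  rw [binomPoly_eq, Polynomial.eval_mul, Polynomial.eval_C, Polynomial.eval_comp,
    Polynomial.eval_add, Polynomial.eval_X, Polynomial.eval_one, h1,
    Nat.ascFactorial_eq_factorial_mul_choose]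
  have : (d ! : ℚ) ≠ 0 := Nat.cast_ne_zero.mpr d.factorial_ne_zero
  push_cast
  field_simp

theorem natDegree_binomPoly_le (d : ℕ) : (binomPoly d).natDegree ≤ d := by
  rw [binomPoly_eq]
  refine (Polynomial.natDegree_C_mul_le _ _).trans (Polynomial.natDegree_comp_le.trans ?_)
  rw [ascPochhammer_natDegree]
  have : (Polynomial.X + 1 : Polynomial ℚ).natDegree = 1 := by
    simpa using Polynomial.natDegree_X_add_C (1 : ℚ)
  rw [this, mul_one]

theorem coeff_binomPoly_self (d : ℕ) : (binomPoly d).coeff d = 1 / (d ! : ℚ) := by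
  have hmon : (∏ j ∈ Finset.Icc 1 d, (Polynomial.X + Polynomial.C (j : ℚ))).Monic :=
    Polynomial.monic_prod_of_monic _ _ fun j _ => Polynomial.monic_X_add_C _
  have hdeg : (∏ j ∈ Finset.Icc 1 d, (Polynomial.X + Polynomial.C (j : ℚ))).natDegree = d := by
    rw [Polynomial.natDegree_prod_of_monic _ _ fun j _ => Polynomial.monic_X_add_C _]
    simp only [Polynomial.natDegree_X_add_C, Finset.sum_const, Nat.card_Icc]
    simp
  have h := hmon.coeff_natDegree
  rw [hdeg] at h
  rw [binomPoly, Polynomial.coeff_C_mul, h, mul_one]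

/-- For `n = 0` only the outer terms of the defining sum survive, the others being alternating sums
of binomial coefficients. -/
theorem bbB_zero (m : ℕ) (a x : ℚ) :
    PlumbingGraph.bbB m 0 a x =
      -((Polynomial.bernoulli (m + 1)).eval x - (-a) ^ (m + 1)) / (m + 1) := by
  have hb : ∀ i, i ≤ m → PlumbingGraph.bCoeff m 0 i = if i = 0 then 1 / (m + 1 : ℚ) else 0 := by
    intro i hi
    rw [PlumbingGraph.bCoeff, min_eq_left hi]
    have h := Int.alternating_sum_range_choose (n := i)
    have h' : ∑ j ∈ Finset.range (i + 1), ((-1 : ℚ) ^ j * (i.choose j : ℚ)) =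
        if i = 0 then 1 else 0 := by exact_mod_cast h
    have h2 : ∑ j ∈ Finset.range (i + 1), (((m + 0 - j).choose 0 : ℕ) : ℚ) * (-1) ^ j /
        ((j ! : ℚ) * ((i - j)! : ℚ)) = (1 / (i ! : ℚ)) *
        ∑ j ∈ Finset.range (i + 1), ((-1 : ℚ) ^ j * (i.choose j : ℚ)) := by
      rw [Finset.mul_sum]
      refine Finset.sum_congr rfl fun j hj => ?_
      rw [Nat.cast_choose ℚ (Nat.lt_succ_iff.mp (Finset.mem_range.mp hj)), Nat.choose_zero_right]
      have h3 : (i ! : ℚ) ≠ 0 := Nat.cast_ne_zero.mpr i.factorial_ne_zero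
      field_simp
      simp
    rw [h2, h']
    have h4 : (m ! : ℚ) ≠ 0 := Nat.cast_ne_zero.mpr m.factorial_ne_zero
    split_ifs with h0
    · subst h0
      simp only [add_zero, Nat.sub_zero, Nat.factorial_succ, Nat.factorial_zero]
      push_cast
      field_simp
    · simp
  have hb' : PlumbingGraph.bCoeff m 0 (m + 1) = (-1) ^ m / (m + 1 : ℚ) := by
    rw [PlumbingGraph.bCoeff, min_eq_right (Nat.le_succ m)]
    have h := Int.alternating_sum_range_choose (n := m + 1)
    have h' : ∑ j ∈ Finset.range (m + 1 + 1), ((-1 : ℚ) ^ j * ((m + 1).choose j : ℚ)) = 0 := by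
      have : ∑ j ∈ Finset.range (m + 1 + 1), ((-1 : ℚ) ^ j * ((m + 1).choose j : ℚ)) =
        if m + 1 = 0 then 1 else 0 := by exact_mod_cast h
      simpa using this
    rw [Finset.sum_range_succ, Nat.choose_self, Nat.cast_one, mul_one] at h'
    have h2 : ∑ j ∈ Finset.range (m + 1), (((m + 0 - j).choose 0 : ℕ) : ℚ) * (-1) ^ j /
        ((j ! : ℚ) * ((m + 1 - j)! : ℚ)) = (1 / ((m + 1)! : ℚ)) *
        ∑ j ∈ Finset.range (m + 1), ((-1 : ℚ) ^ j * ((m + 1).choose j : ℚ)) := by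
      rw [Finset.mul_sum]
      refine Finset.sum_congr rfl fun j hj => ?_
      rw [Nat.cast_choose ℚ (Finset.mem_range.mp hj).le, Nat.choose_zero_right]
      have h3 : ((m + 1)! : ℚ) ≠ 0 := Nat.cast_ne_zero.mpr (m + 1).factorial_ne_zero
      field_simp
      simp
    rw [h2, eq_neg_of_add_eq_zero_left h']
    have h4 : (m ! : ℚ) ≠ 0 := Nat.cast_ne_zero.mpr m.factorial_ne_zero
    simp only [add_zero, Nat.sub_self, Nat.factorial_zero, Nat.factorial_succ]
    push_cast
    field_simp
    ring
  rw [PlumbingGraph.bbB, if_pos le_rfl]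
  simp only [Int.toNat_zero, add_zero]
  rw [Finset.sum_range_succ, Finset.sum_range_succ']
  have hz : ∑ i ∈ Finset.range m, PlumbingGraph.bCoeff m 0 (i + 1) *
      (Polynomial.bernoulli (m + 1 - (i + 1))).eval x * a ^ (i + 1) = 0 := by
    refine Finset.sum_eq_zero fun i hi => ?_
    rw [hb _ (Finset.mem_range.mp hi)]
    simp
  rw [hz, hb 0 (Nat.zero_le _), hb']
  simp only [if_true, Nat.sub_zero, Nat.sub_self, Polynomial.bernoulli_zero, Polynomial.eval_one]
  rw [show -a = (-1) * a by ring, mul_pow, pow_succ (-1 : ℚ)]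
  field_simp
  ring

/-- The linear map on polynomials that sends `x ^ j` to `-k ^ j B_{j+1}(x / k) / (j + 1)`. -/
noncomputable def bernoulliAntidiff (k : ℕ) : Polynomial ℚ →ₗ[ℚ] Polynomial ℚ :=
  Polynomial.lsum fun j => LinearMap.toSpanSingleton ℚ (Polynomial ℚ)
    (Polynomial.C (-(k : ℚ) ^ j / (j + 1)) *
      (Polynomial.bernoulli (j + 1)).comp (Polynomial.C (k : ℚ)⁻¹ * Polynomial.X))

theorem eval_bernoulliAntidiff (k : ℕ) (p : Polynomial ℚ) {d : ℕ} (hd : p.natDegree ≤ d) (x : ℚ) :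
    (bernoulliAntidiff k p).eval x = ∑ j ∈ Finset.range (d + 1),
      p.coeff j * (-(k : ℚ) ^ j / (j + 1) * (Polynomial.bernoulli (j + 1)).eval (x / k)) := by
  rw [bernoulliAntidiff, Polynomial.lsum_apply,
    Polynomial.sum_over_range' p (fun n => by simp) (d + 1) (Nat.lt_succ_of_le hd),
    Polynomial.eval_finsetSum]
  refine Finset.sum_congr rfl fun j _ => ?_
  simp [LinearMap.toSpanSingleton_apply, Polynomial.eval_comp, div_eq_inv_mul]

/-- `bernoulliAntidiff k` inverts minus the difference operator with step `k`. -/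
theorem eval_bernoulliAntidiff_sub (k : ℕ) (hk : 0 < k) (p : Polynomial ℚ) (x : ℚ) :
    (bernoulliAntidiff k p).eval x - (bernoulliAntidiff k p).eval (x + k) = p.eval x := by
  have hk0 : (k : ℚ) ≠ 0 := Nat.cast_ne_zero.mpr hk.ne'
  rw [eval_bernoulliAntidiff k p le_rfl, eval_bernoulliAntidiff k p le_rfl,
    ← Finset.sum_sub_distrib, Polynomial.eval_eq_sum_range]
  refine Finset.sum_congr rfl fun j _ => ?_
  have h := Polynomial.bernoulli_eval_one_add (j + 1) (x / k)
  rw [show (x + k) / (k : ℚ) = 1 + x / k by field_simp; ring, h]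
  have hj : (j + 1 : ℚ) ≠ 0 := by positivity
  push_cast
  rw [div_pow]
  field_simp
  ring

/-- The regularized sum of `ζ ^ n * p n` over `n ≥ 0`. -/
noncomputable def twistedSum (k : ℕ) (ζ : ℂ) (p : Polynomial ℚ) : ℂ :=
  ∑ r ∈ Finset.range k, ζ ^ r * (((bernoulliAntidiff k p).eval (r : ℚ) : ℚ) : ℂ)

/-- Shifting the summation index of the regularized sum splits off the term `n = 0`. -/
theorem twistedSum_sub {k : ℕ} (hk : 0 < k) {ζ : ℂ} (hζ : ζ ^ k = 1) (h1 : ζ ≠ 1)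
    (p : Polynomial ℚ) :
    twistedSum k ζ p - ζ * twistedSum k ζ (p.comp (Polynomial.X + 1)) = (p.eval 0 : ℚ) := by
  set R := bernoulliAntidiff k (p.comp (Polynomial.X + 1)) -
    (bernoulliAntidiff k p).comp (Polynomial.X + 1) with hR
  -- `R` is the defect of `bernoulliAntidiff` from commuting with the shift; it is periodic, hence
  -- constant, and constants are killed by the sum over the powers of `ζ`
  have hper : ∀ x : ℚ, R.eval (x + k) = R.eval x := by
    intro x
    have h2 := eval_bernoulliAntidiff_sub k hk (p.comp (Polynomial.X + 1)) x
    have h3 := eval_bernoulliAntidiff_sub k hk p (x + 1)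
    simp only [hR, Polynomial.eval_sub, Polynomial.eval_comp, Polynomial.eval_add,
      Polynomial.eval_X, Polynomial.eval_one] at h2 ⊢
    rw [show x + k + 1 = x + 1 + (k : ℚ) by ring]
    linarith
  have hnat : ∀ n : ℕ, R.eval ((n * k : ℕ) : ℚ) = R.eval 0 := by
    intro n
    induction n with
    | zero => simp
    | succ n ih =>
      rw [← ih, ← hper ((n * k : ℕ) : ℚ)]
      push_cast
      ring_nf
  have hconst : R = Polynomial.C (R.eval 0) := by
    refine Polynomial.eq_of_infinite_eval_eq _ _ (Set.infinite_of_injective_forall_mem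
      (f := fun n : ℕ => ((n * k : ℕ) : ℚ)) ?_ fun n => ?_)
    · intro a b hab
      have hab' : ((a * k : ℕ) : ℚ) = ((b * k : ℕ) : ℚ) := hab
      have : a * k = b * k := by exact_mod_cast hab'
      exact Nat.eq_of_mul_eq_mul_right hk this
    · simp only [Set.mem_ofPred_eq, hnat, Polynomial.eval_C]
  have hgeom : ∑ r ∈ Finset.range k, ζ ^ r = 0 := by
    have h := mul_geom_sum ζ k
    rw [hζ, sub_self] at h
    exact (mul_eq_zero.mp h).resolve_left (sub_ne_zero.mpr h1)
  have hshift : twistedSum k ζ (p.comp (Polynomial.X + 1)) =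
      ∑ r ∈ Finset.range k, ζ ^ r * (((bernoulliAntidiff k p).eval ((r + 1 : ℕ) : ℚ) : ℚ) : ℂ) := by
    have hr : ∀ r : ℕ, (bernoulliAntidiff k (p.comp (Polynomial.X + 1))).eval (r : ℚ) =
        R.eval 0 + (bernoulliAntidiff k p).eval ((r + 1 : ℕ) : ℚ) := by
      intro r
      have h2 := congrArg (Polynomial.eval (r : ℚ)) hconst
      simp only [hR, Polynomial.eval_sub, Polynomial.eval_comp, Polynomial.eval_add,
        Polynomial.eval_X, Polynomial.eval_one, Polynomial.eval_C] at h2 ⊢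
      push_cast
      linarith
    rw [twistedSum]
    simp only [hr, Rat.cast_add, mul_add, Finset.sum_add_distrib, ← Finset.sum_mul, hgeom]
    simp
  have hend := eval_bernoulliAntidiff_sub k hk p 0
  have htel := Finset.sum_range_sub' (fun r : ℕ =>
    ζ ^ r * (((bernoulliAntidiff k p).eval (r : ℚ) : ℚ) : ℂ)) k
  rw [hshift, twistedSum, Finset.mul_sum, ← Finset.sum_sub_distrib]
  rw [hζ, pow_zero, one_mul, one_mul, Nat.cast_zero, ← Rat.cast_sub] at htel
  rw [zero_add] at hend
  rw [← hend, ← htel]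
  refine Finset.sum_congr rfl fun r _ => ?_
  rw [pow_succ]
  ring

/-- The regularized sum of `ζ ^ n * binom (n + d) d` is the value at `X = 1` of the rational function
`1 / (1 - ζ X) ^ (d + 1)`. -/
theorem twistedSum_binomPoly {k : ℕ} (hk : 0 < k) {ζ : ℂ} (hζ : ζ ^ k = 1) (h1 : ζ ≠ 1) (d : ℕ) :
    twistedSum k ζ (binomPoly d) = ((1 - ζ) ^ (d + 1))⁻¹ := by
  have h0 : 1 - ζ ≠ 0 := sub_ne_zero.mpr h1.symm
  have hadd : ∀ p q : Polynomial ℚ, twistedSum k ζ (p + q) = twistedSum k ζ p + twistedSum k ζ q := by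
    intro p q
    simp [twistedSum, mul_add, Finset.sum_add_distrib]
  -- `asc d` is the polynomial `binom (x + d - 1) d`
  set asc : ℕ → Polynomial ℚ := fun d => Polynomial.C (1 / (d ! : ℚ)) * ascPochhammer ℚ d with hasc
  have hcomp : ∀ d, (asc d).comp (Polynomial.X + 1) = binomPoly d := by
    intro d
    rw [binomPoly_eq, hasc, Polynomial.mul_comp, Polynomial.C_comp]
  induction d with
  | zero =>
    have h := twistedSum_sub hk hζ h1 (asc 0)
    have h2 : asc 0 = binomPoly 0 := by simp [hasc, binomPoly]
    rw [hcomp, h2] at h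
    have h3 : (binomPoly 0).eval 0 = 1 := by simp [binomPoly]
    rw [h3] at h
    rw [zero_add, pow_one]
    refine eq_inv_of_mul_eq_one_left ?_
    push_cast at h
    linear_combination h
  | succ d ih =>
    have h := twistedSum_sub hk hζ h1 (asc (d + 1))
    have h3 : (asc (d + 1)).eval 0 = 0 := by
      simp [hasc, ascPochhammer_succ_left]
    have h4 : binomPoly (d + 1) = asc (d + 1) + binomPoly d := by
      rw [binomPoly_eq, binomPoly_eq, hasc]
      simp only
      have e1 : (ascPochhammer ℚ (d + 1)).comp (Polynomial.X + 1) =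
          (ascPochhammer ℚ d).comp (Polynomial.X + 1) * (Polynomial.X + 1 + (d : Polynomial ℚ)) := by
        rw [ascPochhammer_succ_right, Polynomial.mul_comp]
        simp
      have e2 : Polynomial.C (1 / ((d + 1)! : ℚ)) * (d + 1 : Polynomial ℚ) =
          Polynomial.C (1 / (d ! : ℚ)) := by
        have : (d + 1 : Polynomial ℚ) = Polynomial.C (d + 1 : ℚ) := by simp
        rw [this, ← Polynomial.C_mul]
        congr 1
        have hd : (d ! : ℚ) ≠ 0 := Nat.cast_ne_zero.mpr d.factorial_ne_zero
        rw [Nat.factorial_succ]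
        push_cast
        field_simp
      rw [e1, ascPochhammer_succ_left, ← e2]
      ring
    rw [hcomp, h3, h4, hadd, ih] at h
    rw [h4, hadd, ih]
    refine eq_inv_of_mul_eq_one_left ?_
    have h5 : ((1 - ζ) ^ (d + 1))⁻¹ * (1 - ζ) ^ (d + 1) = 1 :=
      inv_mul_cancel₀ (pow_ne_zero _ h0)
    push_cast at h
    rw [pow_succ]
    linear_combination (1 - ζ) ^ (d + 1) * h + h5

/-! ### The contribution of one vertex -/

/-- The contribution of one vertex to the coefficients of the asymptotic expansion:
`∑ j, p_j k ^ (j + n) 𝔹_{j, n}(a / k, x / k)` where `binom (x + d) d = ∑ j, p_j x ^ j`. -/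
noncomputable def vertexCoeff (k d : ℕ) (n : ℤ) (a : ℚ) (x : ℕ) : ℚ :=
  ∑ j ∈ Finset.range (d + 1), (binomPoly d).coeff j * (k : ℚ) ^ ((j : ℤ) + n) *
    PlumbingGraph.bbB j n (a / k) (x / k)

/-- The antiderivative of `-binom (d - x) d` that vanishes at `0`. -/
noncomputable def primitivePoly (d : ℕ) : Polynomial ℚ :=
  ∑ j ∈ Finset.range (d + 1),
    Polynomial.monomial (j + 1) ((binomPoly d).coeff j * (-1) ^ (j + 1) / (j + 1))

theorem natDegree_primitivePoly_le (d : ℕ) : (primitivePoly d).natDegree ≤ d + 1 := by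
  refine Polynomial.natDegree_sum_le_of_forall_le _ _ fun j hj => ?_
  exact (Polynomial.natDegree_monomial_le _).trans (Finset.mem_range.mp hj)

theorem coeff_primitivePoly (d : ℕ) :
    (primitivePoly d).coeff (d + 1) = (-1) ^ (d + 1) / ((d + 1)! : ℚ) := by
  have hd : (d ! : ℚ) ≠ 0 := Nat.cast_ne_zero.mpr d.factorial_ne_zero
  rw [primitivePoly, Polynomial.finsetSum_coeff, Finset.sum_range_succ, Finset.sum_eq_zero,
    Polynomial.coeff_monomial, if_pos rfl, coeff_binomPoly_self, Nat.factorial_succ]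
  · push_cast
    field_simp
    ring
  · intro j hj
    rw [Polynomial.coeff_monomial, if_neg]
    have := Finset.mem_range.mp hj
    omega

/-- For `n = 0` the contribution of a vertex separates into a function of the residue and a polynomial
in `a`. -/
theorem vertexCoeff_zero {k : ℕ} (hk : 0 < k) (d : ℕ) (a : ℚ) (x : ℕ) :
    vertexCoeff k d 0 a x = (bernoulliAntidiff k (binomPoly d)).eval (x : ℚ) +
      (k : ℚ)⁻¹ * (primitivePoly d).eval a := by
  have hk0 : (k : ℚ) ≠ 0 := Nat.cast_ne_zero.mpr hk.ne'
  rw [vertexCoeff, eval_bernoulliAntidiff k _ (natDegree_binomPoly_le d), primitivePoly,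
    Polynomial.eval_finsetSum, Finset.mul_sum, ← Finset.sum_add_distrib]
  refine Finset.sum_congr rfl fun j _ => ?_
  have hj : (j + 1 : ℚ) ≠ 0 := by positivity
  rw [bbB_zero, Polynomial.eval_monomial, add_zero, zpow_natCast,
    show -(a / (k : ℚ)) = (-1) * a / k by ring, div_pow, mul_pow]
  field_simp
  ring

/-- The part with `n` congruent to `r` modulo `k` of the series
`∑ n, binom (n + d) d * X ^ (N * n)`. -/
noncomputable def residueSeries (k N d r : ℕ) : PowerSeries ℂ :=
  PowerSeries.mk fun z => if N ∣ z ∧ z / N % k = r then ((z / N + d).choose d : ℕ) else 0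

theorem sum_pow_smul_residueSeries {k : ℕ} (hk : 0 < k) {ζ : ℂ} (hζ : ζ ^ k = 1) (N d : ℕ) :
    ∑ r : Fin k, ζ ^ (r : ℕ) • residueSeries k N d r = binomSeries ζ N d := by
  ext z
  rw [map_sum]
  simp only [residueSeries, binomSeries, PowerSeries.coeff_smul, PowerSeries.coeff_mk]
  by_cases hz : N ∣ z
  · simp only [hz, true_and, if_true]
    rw [Finset.sum_eq_single (⟨z / N % k, Nat.mod_lt _ hk⟩ : Fin k)]
    · rw [if_pos rfl, smul_eq_mul]
      congr 1
      conv_rhs => rw [← Nat.div_add_mod (z / N) k, pow_add, pow_mul, hζ, one_pow, one_mul]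
    · intro r _ hr
      rw [if_neg (fun h => hr (Fin.ext h.symm)), smul_zero]
    · simp
  · simp [hz]

theorem polyGrowth_residueSeries (k N d r : ℕ) : PolyGrowth (residueSeries k N d r) := by
  refine ⟨1, d, fun z => le_trans ?_ (norm_coeff_binomSeries_le (ζ := 1) (by simp) N d z)⟩
  rw [residueSeries, binomSeries, PowerSeries.coeff_mk, PowerSeries.coeff_mk]
  by_cases hz : N ∣ z
  · rw [if_pos hz]
    split_ifs <;> simp
  · simp [hz]

section Vertex

variable {J : Type*} [Fintype J] [DecidableEq J]

/-- The series of one vertex with leaf weights `wt`: the summand `n` of residue `r` sits at the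
position of `n + a` in the lattice of mesh `1 / ∏ wt`, where `a` is the shift of the signs `l`. -/
noncomputable def vertexSeries (wt : J → ℕ) (k d : ℕ) (i : Fin k × (J → ℤˣ)) : PowerSeries ℂ :=
  PowerSeries.X ^ signOffset wt i.2 * residueSeries k (∏ j, wt j) d i.1

theorem sum_signProd_eq_zero [Nonempty J] : ∑ l : J → ℤˣ, (signProd l : ℚ) = 0 := by
  have h := sum_signProd_mul_eval (fun _ : J => 1) 1 (by simp) 0
  rw [Polynomial.coeff_one, if_neg Fintype.card_ne_zero] at h
  simpa using h

/-- Weights on residues and signs whose sums over the residues are proportional to the product of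
the signs give series that are regular at `X = 1`. -/
theorem sum_smul_vertexSeries_mem_regularAtOne {wt : J → ℕ} (hwt : ∀ j, 0 < wt j) {k : ℕ}
    (hk : 0 < k) {d : ℕ} (hd : d + 1 ≤ Fintype.card J) (a : ℚ) (w : Fin k × (J → ℤˣ) → ℂ) (G : ℂ)
    (hw : ∀ l, ∑ r, w (r, l) = (signProd l : ℂ) * G) :
    ∑ i, w i • (vertexSeries wt k d i,
      ((vertexCoeff k d 0 (a + signShift wt i.2) (i.1 : ℕ) : ℚ) : ℂ)) ∈ regularAtOne d := by
  have hN : 0 < ∏ j, wt j := Finset.prod_pos fun j _ => hwt j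
  have hk0 : (k : ℂ) ≠ 0 := Nat.cast_ne_zero.mpr hk.ne'
  have hne : Nonempty J := Fintype.card_pos_iff.mp (by omega)
  set y : (J → ℤˣ) → Fin k → PowerSeries ℂ × ℂ := fun l r => (vertexSeries wt k d (r, l),
    ((vertexCoeff k d 0 (a + signShift wt l) (r : ℕ) : ℚ) : ℂ)) with hy
  -- the nontrivial Fourier modes are regular one by one
  have hmode : ∀ l, ∀ ζ : ℂ, ζ ^ k = 1 → ζ ≠ 1 →
      ∑ r : Fin k, ζ ^ (r : ℕ) • y l r ∈ regularAtOne d := by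
    intro l ζ hζ h1
    have hnorm : ‖ζ‖ = 1 := Complex.norm_eq_one_of_pow_eq_one hζ hk.ne'
    convert X_pow_mul_binomSeries_mem_regularAtOne hnorm h1 hN d (signOffset wt l) using 1
    refine Prod.ext ?_ ?_
    · simp only [hy, Prod.fst_sum, Prod.smul_fst, vertexSeries, ← mul_smul_comm]
      rw [← Finset.mul_sum, sum_pow_smul_residueSeries hk hζ]
    · simp only [hy, Prod.snd_sum, Prod.smul_snd, vertexCoeff_zero hk, Rat.cast_add, smul_eq_mul,
        mul_add, Finset.sum_add_distrib, ← Finset.sum_mul]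
      rw [← twistedSum_binomPoly hk hζ h1, twistedSum,
        Fin.sum_univ_eq_sum_range (fun r : ℕ => ζ ^ r),
        Fin.sum_univ_eq_sum_range (fun r : ℕ =>
          ζ ^ r * (((bernoulliAntidiff k (binomPoly d)).eval (r : ℚ) : ℚ) : ℂ))]
      have h := mul_geom_sum ζ k
      rw [hζ, sub_self] at h
      rw [(mul_eq_zero.mp h).resolve_left (sub_ne_zero.mpr h1), zero_mul, add_zero]
  -- the trivial Fourier mode is regular because of the alternating sum over the signs
  have htriv : ∑ l : J → ℤˣ, (signProd l : ℂ) • ∑ r, y l r ∈ regularAtOne d := by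
    convert prod_one_sub_mul_binomSeries_mem_regularAtOne
      (fun i => (∏ j, wt j) / wt i) hN d hd using 1
    refine Prod.ext ?_ ?_
    · have h1 : ∀ l, (∑ r, y l r).1 =
          PowerSeries.X ^ signOffset wt l * binomSeries 1 (∏ j, wt j) d := by
        intro l
        rw [← sum_pow_smul_residueSeries hk (one_pow k), Prod.fst_sum, Finset.mul_sum]
        simp [hy, vertexSeries]
      simp only [Prod.fst_sum, Prod.smul_fst] at h1 ⊢
      simp only [h1, ← smul_mul_assoc]
      rw [← Finset.sum_mul, sum_signProd_smul_X_pow]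
    · have h1 : ∀ l, (∑ r, y l r).2 =
          ((∑ r : Fin k, (bernoulliAntidiff k (binomPoly d)).eval ((r : ℕ) : ℚ) +
            (primitivePoly d).eval (a + signShift wt l) : ℚ) : ℂ) := by
        intro l
        have hk0' : (k : ℚ) ≠ 0 := Nat.cast_ne_zero.mpr hk.ne'
        simp only [hy, Prod.snd_sum, vertexCoeff_zero hk]
        rw [← Rat.cast_sum, Finset.sum_add_distrib]
        simp [hk0]
      simp only [Prod.snd_sum, Prod.smul_snd] at h1 ⊢
      simp only [h1]
      have h2 : ∑ l : J → ℤˣ, (signProd l : ℂ) •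
          ((∑ r : Fin k, (bernoulliAntidiff k (binomPoly d)).eval ((r : ℕ) : ℚ) +
            (primitivePoly d).eval (a + signShift wt l) : ℚ) : ℂ) =
          ((∑ l : J → ℤˣ, (signProd l : ℚ) * (primitivePoly d).eval (a + signShift wt l) : ℚ) : ℂ) := by
        have h3 : ∑ l : J → ℤˣ, (signProd l : ℚ) *
            (∑ r : Fin k, (bernoulliAntidiff k (binomPoly d)).eval ((r : ℕ) : ℚ) +
            (primitivePoly d).eval (a + signShift wt l)) =
            ∑ l : J → ℤˣ, (signProd l : ℚ) * (primitivePoly d).eval (a + signShift wt l) := by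
          simp only [mul_add, Finset.sum_add_distrib]
          rw [← Finset.sum_mul, sum_signProd_eq_zero, zero_mul, zero_add]
        rw [← h3]
        push_cast
        simp
      rw [h2, sum_signProd_mul_eval wt _ ((natDegree_primitivePoly_le d).trans hd)]
      split_ifs with hc
      · rw [hc, coeff_primitivePoly]
        have hf : ((d + 1)! : ℚ) ≠ 0 := Nat.cast_ne_zero.mpr (d + 1).factorial_ne_zero
        have hNq : ((∏ j, wt j : ℕ) : ℚ) ≠ 0 := Nat.cast_ne_zero.mpr hN.ne'
        have h4 : ∏ i, (((∏ j, wt j) / wt i : ℕ) : ℚ) =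
            ((∏ j, wt j : ℕ) : ℚ) ^ (d + 1) * ∏ i, (wt i : ℚ)⁻¹ := by
          rw [← hc, ← Finset.card_univ, ← Finset.prod_const, ← Finset.prod_mul_distrib]
          refine Finset.prod_congr rfl fun i _ => ?_
          rw [Nat.cast_div (Finset.dvd_prod_of_mem _ (Finset.mem_univ i))
            (Nat.cast_ne_zero.mpr (hwt i).ne'), div_eq_mul_inv]
        have h5 : ((-1 : ℚ) ^ (d + 1)) * (-1) ^ (d + 1) = 1 := by
          rw [← mul_pow]; norm_num
        have h6 : (-1 : ℚ) ^ (d + 1) * ((d + 1)! : ℚ) * (∏ i, (wt i : ℚ)⁻¹) *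
            ((-1) ^ (d + 1) / ((d + 1)! : ℚ)) =
            (∏ i, (((∏ j, wt j) / wt i : ℕ) : ℚ)) / ((∏ j, wt j : ℕ) : ℚ) ^ (d + 1) := by
          rw [h4]
          generalize ∏ i, (wt i : ℚ)⁻¹ = Q
          field_simp
          linear_combination Q * h5
        rw [h6]
        push_cast
        rfl
      · rw [Polynomial.coeff_eq_zero_of_natDegree_lt
          ((natDegree_primitivePoly_le d).trans_lt (by omega))]
        simp
  -- modulo the nontrivial modes only the sums over the residues matter, and these are `G` times signs
  have hsum : ∑ i, w i • (vertexSeries wt k d i,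
      ((vertexCoeff k d 0 (a + signShift wt i.2) (i.1 : ℕ) : ℚ) : ℂ)) =
      ∑ l, (∑ r, w (r, l) • y l r - ((∑ r, w (r, l)) / k) • ∑ r, y l r) +
        (G / k) • ∑ l : J → ℤˣ, (signProd l : ℂ) • ∑ r, y l r := by
    rw [Fintype.sum_prod_type_right, Finset.smul_sum, ← Finset.sum_add_distrib]
    refine Finset.sum_congr rfl fun l _ => ?_
    rw [hw, smul_smul, show G / k * (signProd l : ℂ) = (signProd l : ℂ) * G / k by ring,
      sub_add_cancel]
  rw [hsum]
  exact Submodule.add_mem _ (Submodule.sum_mem _ fun l _ =>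
    sum_smul_sub_mean_mem _ hk (y l) (hmode l) _) (Submodule.smul_mem _ _ htriv)

end Vertex

/-! ### Tensor decomposition -/

/-- A subspace `W` of functions on a finite set has a reproducing kernel with rows in `W`. -/
theorem exists_reproducing_kernel {I : Type*} [Fintype I] (W : Submodule ℂ (I → ℂ)) :
    ∃ K : I → I → ℂ, (∀ i, K i ∈ W) ∧ ∀ w ∈ W, ∀ j, w j = ∑ i, w i * K i j := by
  classical
  obtain ⟨g, hg⟩ := LinearMap.exists_leftInverse_of_injective W.subtype W.ker_subtype
  refine ⟨fun i => (g fun j => if i = j then 1 else 0 : W), fun i => Subtype.property _, ?_⟩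
  intro w hw j
  have h1 : g w = ⟨w, hw⟩ := LinearMap.congr_fun hg ⟨w, hw⟩
  have h2 := LinearMap.pi_apply_eq_sum_univ g w
  rw [h1] at h2
  have h3 := congrFun (congrArg Subtype.val h2) j
  simpa using h3

/-- If all slices of `C` in direction `v` lie in `W v`, for every `v`, then `C` is a combination
of products of functions in the spaces `W v`. -/
theorem exists_tensor_decomposition {ι : Type*} [Fintype ι] [DecidableEq ι] {I : ι → Type*}
    [∀ v, Fintype (I v)] (W : ∀ v, Submodule ℂ (I v → ℂ))
    (C : (∀ v, I v) → ℂ) (hC : ∀ v i, (fun a => C (Function.update i v a)) ∈ W v) :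
    ∃ K : ∀ v, I v → I v → ℂ, (∀ v i, K v i ∈ W v) ∧
      ∀ j, C j = ∑ i, C i * ∏ v, K v (i v) (j v) := by
  classical
  choose K hK hrep using fun v => exists_reproducing_kernel (W v)
  refine ⟨K, hK, ?_⟩
  -- replace the identity kernel by `K v`, one vertex at a time
  have key : ∀ s : Finset ι, ∀ j, C j = ∑ i, C i *
      ∏ v, if v ∈ s then K v (i v) (j v) else if i v = j v then 1 else 0 := by
    intro s
    induction s using Finset.induction_on with
    | empty =>
      intro j
      rw [Finset.sum_eq_single j]
      · simp
      · intro i _ hij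
        obtain ⟨v, hv⟩ := Function.ne_iff.mp hij
        rw [Finset.prod_eq_zero (Finset.mem_univ v), mul_zero]
        simp [hv]
      · simp
    | insert u s hu ih =>
      intro j
      have h1 := hrep u _ (hC u j) (j u)
      rw [Function.update_eq_self] at h1
      rw [h1]
      have h2 : ∀ a, C (Function.update j u a) * K u a (j u) = ∑ i, (if i u = a then
          C i * (K u a (j u) * ∏ v ∈ Finset.univ.erase u,
            if v ∈ s then K v (i v) (j v) else if i v = j v then 1 else 0) else 0) := by
        intro a
        rw [ih (Function.update j u a), Finset.sum_mul]
        refine Finset.sum_congr rfl fun i _ => ?_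
        rw [← Finset.mul_prod_erase _ _ (Finset.mem_univ u), if_neg hu, Function.update_self]
        have h3 : ∏ v ∈ Finset.univ.erase u, (if v ∈ s then K v (i v) (Function.update j u a v)
            else if i v = Function.update j u a v then 1 else 0) =
            ∏ v ∈ Finset.univ.erase u,
              if v ∈ s then K v (i v) (j v) else if i v = j v then 1 else 0 := by
          refine Finset.prod_congr rfl fun v hv => ?_
          rw [Function.update_of_ne (Finset.ne_of_mem_erase hv)]
        rw [h3]
        split_ifs <;> ring
      rw [Finset.sum_congr rfl fun a _ => h2 a, Finset.sum_comm]
      refine Finset.sum_congr rfl fun i _ => ?_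
      rw [Finset.sum_ite_eq, if_pos (Finset.mem_univ _),
        ← Finset.mul_prod_erase Finset.univ _ (Finset.mem_univ u),
        if_pos (Finset.mem_insert_self u s)]
      congr 2
      refine Finset.prod_congr rfl fun v hv => ?_
      simp only [Finset.mem_insert, Finset.ne_of_mem_erase hv, false_or]
  intro j
  simpa using key Finset.univ j

/-- A decomposition into products distributes over a sum of products. -/
theorem sum_mul_prod_of_decomposition {ι : Type*} [Fintype ι] [DecidableEq ι] {I : ι → Type*}
    [∀ v, Fintype (I v)] {C : (∀ v, I v) → ℂ} {K : ∀ v, I v → I v → ℂ}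
    (hK : ∀ j, C j = ∑ i, C i * ∏ v, K v (i v) (j v)) (g : ∀ v, I v → ℂ) :
    ∑ j, C j * ∏ v, g v (j v) = ∑ i, C i * ∏ v, ∑ a, K v (i v) a * g v a := by
  classical
  calc ∑ j, C j * ∏ v, g v (j v)
      = ∑ j : ∀ v, I v, ∑ i, C i * ∏ v, K v (i v) (j v) * g v (j v) := by
        refine Finset.sum_congr rfl fun j _ => ?_
        rw [hK j, Finset.sum_mul]
        refine Finset.sum_congr rfl fun i _ => ?_
        rw [Finset.prod_mul_distrib, mul_assoc]
    _ = _ := by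
        rw [Finset.sum_comm]
        refine Finset.sum_congr rfl fun i _ => ?_
        rw [Finset.prod_univ_sum, Fintype.piFinset_univ, Finset.mul_sum]

/-! ### Products of polynomials in separate variables -/

/-- Summation against the coefficients of a product of polynomials in separate variables factors. -/
theorem sum_coeff_mul_prod {σ : Type*} [Fintype σ] [DecidableEq σ] (p : σ → Polynomial ℚ)
    (D : σ → ℕ) (hD : ∀ v, (p v).natDegree ≤ D v) (g : σ → ℕ → ℚ) :
    ∑ m ∈ (∏ v, Polynomial.aeval (MvPolynomial.X v : MvPolynomial σ ℚ) (p v)).support,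
      (∏ v, Polynomial.aeval (MvPolynomial.X v : MvPolynomial σ ℚ) (p v)).coeff m *
        ∏ v, g v (m v) =
      ∏ v, ∑ j ∈ Finset.range (D v + 1), (p v).coeff j * g v j := by
  set L : MvPolynomial σ ℚ →ₗ[ℚ] ℚ :=
    (MvPolynomial.basisMonomials σ ℚ).constr ℚ fun m => ∏ v, g v (m v) with hL
  have hmon : ∀ (m : σ →₀ ℕ) (c : ℚ), L (MvPolynomial.monomial m c) = c * ∏ v, g v (m v) := by
    intro m c
    have h1 : MvPolynomial.monomial m c = c • MvPolynomial.basisMonomials σ ℚ m := by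
      rw [MvPolynomial.coe_basisMonomials, MvPolynomial.smul_monomial, smul_eq_mul, mul_one]
    rw [h1, map_smul, hL, Module.Basis.constr_basis, smul_eq_mul]
  have hsum : ∀ q : MvPolynomial σ ℚ, ∑ m ∈ q.support, q.coeff m * ∏ v, g v (m v) = L q := by
    intro q
    conv_rhs => rw [← MvPolynomial.support_sum_monomial_coeff q]
    rw [map_sum]
    exact Finset.sum_congr rfl fun m _ => (hmon _ _).symm
  have hexp : ∏ v, Polynomial.aeval (MvPolynomial.X v : MvPolynomial σ ℚ) (p v) =
      ∑ m ∈ Fintype.piFinset fun v => Finset.range (D v + 1),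
        MvPolynomial.monomial (Finsupp.equivFunOnFinite.symm m) (∏ v, (p v).coeff (m v)) := by
    have h1 : ∀ v, Polynomial.aeval (MvPolynomial.X v : MvPolynomial σ ℚ) (p v) =
        ∑ j ∈ Finset.range (D v + 1), (p v).coeff j • MvPolynomial.X v ^ j := fun v =>
      Polynomial.aeval_eq_sum_range' (Nat.lt_succ_of_le (hD v)) _
    rw [Finset.prod_congr rfl fun v _ => h1 v, Finset.prod_univ_sum]
    refine Finset.sum_congr rfl fun m _ => ?_
    rw [Finset.prod_smul, MvPolynomial.monomial_eq, Finsupp.prod_fintype _ _ (fun _ => pow_zero _),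
      MvPolynomial.smul_eq_C_mul]
    rfl
  rw [hsum, hexp, map_sum, Finset.prod_univ_sum]
  refine Finset.sum_congr rfl fun m _ => ?_
  rw [hmon, Finset.prod_mul_distrib]
  rfl

/-! ### Leaves and the inverse of the linking matrix -/

namespace PlumbingGraph

variable {V : Type*} [Fintype V] (Γ : PlumbingGraph V)

theorem mem_leaves {v i : V} : i ∈ Γ.leaves v ↔ Γ.deg i = 1 ∧ Γ.graph.Adj i v := by
  simp [leaves]

theorem eq_of_mem_leaves {v i u : V} (hi : i ∈ Γ.leaves v) (hu : Γ.graph.Adj i u) : u = v := by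
  classical
  obtain ⟨h1, h2⟩ := Γ.mem_leaves.mp hi
  rw [deg] at h1
  obtain ⟨w, _, hw⟩ := SimpleGraph.degree_eq_one_iff_existsUnique_adj.mp h1
  rw [hw u hu, hw v h2]

theorem ne_leaf (v : Γ.V2) {u i : V} (hi : i ∈ Γ.leaves u) : i ≠ (v : V) := by
  intro h
  have h1 := (Γ.mem_leaves.mp hi).1
  have h2 := v.2
  rw [← h] at h2
  omega

variable {Γ}

theorem weight_ne_zero (hleaf : ∀ v, Γ.deg v = 1 → Γ.weight v ≤ -2) {u i : V}
    (hi : i ∈ Γ.leaves u) : (Γ.weight i : ℚ) ≠ 0 := by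
  have := hleaf i (Γ.mem_leaves.mp hi).1
  exact_mod_cast (by omega : Γ.weight i ≠ 0)

theorem alphaOf_eq (hleaf : ∀ v, Γ.deg v = 1 → Γ.weight v ≤ -2) (v : V) (l : Γ.leaves v → ℤˣ) :
    Γ.alphaOf v l = Γ.alphaOf v 1 + signShift (fun i : Γ.leaves v => (Γ.weight i).natAbs) l := by
  rw [alphaOf, alphaOf, signShift, add_assoc, ← Finset.sum_add_distrib]
  congr 1
  refine Finset.sum_congr rfl fun i _ => ?_
  have hw := hleaf i (Γ.mem_leaves.mp i.2).1
  have hw0 := weight_ne_zero hleaf i.2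
  have habs : (((Γ.weight i).natAbs : ℕ) : ℚ) = -(Γ.weight i : ℚ) := by
    rw [← Int.cast_natCast, Int.natCast_natAbs, abs_of_nonpos (by omega)]
    simp
  rcases Int.units_eq_one_or (l i) with h1 | h1
  · simp [h1]
  · rw [habs]
    simp [h1]
    field_simp
    norm_num

variable [DecidableEq V]

variable (Γ) in
/-- The rows of the equation `W * W⁻¹ = 1` that belong to leaves. -/
theorem leaf_row (hdet : IsUnit Γ.linkingMatrix.det) {v i : V} (hi : i ∈ Γ.leaves v) (u : V) :
    Γ.weight i * Γ.linkingMatrix⁻¹ i u + Γ.linkingMatrix⁻¹ v u = if i = u then 1 else 0 := by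
  have h := congrFun (congrFun (Matrix.mul_nonsing_inv Γ.linkingMatrix hdet) i) u
  have hadj : Γ.graph.Adj i v := (Γ.mem_leaves.mp hi).2
  have hne : v ≠ i := hadj.ne'
  rw [Matrix.mul_apply, Matrix.one_apply] at h
  rw [← h, ← Finset.add_sum_erase _ _ (Finset.mem_univ i),
    ← Finset.add_sum_erase (Finset.univ.erase i) _
      (Finset.mem_erase.mpr ⟨hne, Finset.mem_univ v⟩), Finset.sum_eq_zero]
  · simp [linkingMatrix, hne.symm, hadj]
  · intro x hx
    obtain ⟨hxv, hx⟩ := Finset.mem_erase.mp hx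
    have hxi := (Finset.mem_erase.mp hx).1
    have : ¬ Γ.graph.Adj i x := fun h => hxv (Γ.eq_of_mem_leaves hi h)
    simp [linkingMatrix, hxi.symm, this]

variable (Γ) in
theorem inv_symm (x y : V) : Γ.linkingMatrix⁻¹ x y = Γ.linkingMatrix⁻¹ y x := by
  have hs : Γ.linkingMatrix.transpose = Γ.linkingMatrix := by
    ext a b
    by_cases h : a = b
    · simp [linkingMatrix, h]
    · by_cases hab : Γ.graph.Adj a b
      · simp [linkingMatrix, h, Ne.symm h, hab, hab.symm]
      · have hba : ¬ Γ.graph.Adj b a := fun h' => hab h'.symm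
        simp [linkingMatrix, h, Ne.symm h, hab, hba]
  have h := Matrix.transpose_nonsing_inv Γ.linkingMatrix
  rw [hs] at h
  exact congrFun (congrFun h y) x

variable (Γ) in
theorem S_eq (hdet : IsUnit Γ.linkingMatrix.det) (u v : Γ.V2) :
    Γ.S u v = -((Γ.linkingMatrix⁻¹ (u : V) (v : V) : ℤ) : ℚ) := by
  have h : (Γ.linkingMatrix.map (fun z : ℤ => (z : ℚ)))⁻¹ =
      Γ.linkingMatrix⁻¹.map (fun z : ℤ => (z : ℚ)) := by
    refine Matrix.inv_eq_right_inv ?_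
    have := congrArg (fun M : Matrix V V ℤ => M.map (Int.castRingHom ℚ))
      (Matrix.mul_nonsing_inv Γ.linkingMatrix hdet)
    simp only [Matrix.map_mul] at this
    rw [Matrix.map_one _ (map_zero _) (map_one _)] at this
    exact this
  rw [S, h]
  rfl

theorem inv_leaf (hdet : IsUnit Γ.linkingMatrix.det) (v u : Γ.V2) {i : V}
    (hi : i ∈ Γ.leaves u) :
    Γ.linkingMatrix⁻¹ (u : V) (v : V) = -(Γ.weight i * Γ.linkingMatrix⁻¹ i (v : V)) := by
  have h := Γ.leaf_row hdet hi v
  rw [if_neg (Γ.ne_leaf v hi)] at h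
  linarith

/-- The weight of a leaf at `v` divides all entries but one of the row of `v` in the inverse. -/
theorem leaf_dvd (hdet : IsUnit Γ.linkingMatrix.det) (v : Γ.V2) {i : V}
    (hi : i ∈ Γ.leaves v) {x : V} (hx : x ≠ i) :
    Γ.weight i ∣ Γ.linkingMatrix⁻¹ (v : V) x := by
  have h := Γ.leaf_row hdet hi x
  rw [if_neg hx.symm] at h
  exact ⟨-Γ.linkingMatrix⁻¹ i x, by linarith⟩

theorem inv_leaf_self (hdet : IsUnit Γ.linkingMatrix.det) (v : Γ.V2) {i : V}
    (hi : i ∈ Γ.leaves v) :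
    Γ.linkingMatrix⁻¹ i (v : V) = 1 - Γ.weight i * Γ.linkingMatrix⁻¹ i i := by
  have h := Γ.leaf_row hdet hi i
  rw [if_pos rfl] at h
  rw [inv_symm]
  linarith

/-- The numbers attached to different choices of signs at the same vertex differ modulo one. -/
theorem alphaOf_injective_mod_int (hdet : IsUnit Γ.linkingMatrix.det)
    (hleaf : ∀ v, Γ.deg v = 1 → Γ.weight v ≤ -2) (v : Γ.V2) (l l' : Γ.leaves v → ℤˣ) (z : ℤ)
    (h : Γ.alphaOf v l = Γ.alphaOf v l' + z) : l = l' := by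
  by_contra hne
  obtain ⟨i₀, hi₀⟩ := Function.ne_iff.mp hne
  -- half the difference of the signs
  set c : Γ.leaves v → ℤ := fun i => if l i = l' i then 0 else (l i : ℤ) with hc
  have hcl : ∀ i, ((l i : ℤ) : ℚ) - ((l' i : ℤ) : ℚ) = 2 * (c i : ℚ) := by
    intro i
    rcases Int.units_eq_one_or (l i) with h1 | h1 <;>
      rcases Int.units_eq_one_or (l' i) with h2 | h2 <;>
      simp [hc, h1, h2, -units_ne_neg_self] <;> norm_num
  have hsum : ∑ i, (c i : ℚ) / (Γ.weight i : ℚ) = z := by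
    have h1 : ∑ i, ((l i : ℤ) : ℚ) / (2 * (Γ.weight i : ℚ)) -
        ∑ i, ((l' i : ℤ) : ℚ) / (2 * (Γ.weight i : ℚ)) = z := by
      simp only [alphaOf] at h
      linarith
    rw [← h1, ← Finset.sum_sub_distrib]
    refine Finset.sum_congr rfl fun i _ => ?_
    have hw := weight_ne_zero hleaf i.2
    rw [← sub_div, hcl]
    field_simp
  -- multiply by the diagonal entry of the inverse at `v`, which every leaf weight divides
  have hint : -∑ i : Γ.leaves v, c i * Γ.linkingMatrix⁻¹ (i : V) (v : V) =
      z * Γ.linkingMatrix⁻¹ (v : V) (v : V) := by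
    have h2 := congrArg (fun t => t * ((Γ.linkingMatrix⁻¹ (v : V) (v : V) : ℤ) : ℚ)) hsum
    simp only [Finset.sum_mul] at h2
    have h3 : ∀ i : Γ.leaves v, (c i : ℚ) / (Γ.weight i : ℚ) *
        ((Γ.linkingMatrix⁻¹ (v : V) (v : V) : ℤ) : ℚ) =
        -((c i * Γ.linkingMatrix⁻¹ (i : V) (v : V) : ℤ) : ℚ) := by
      intro i
      have hw := weight_ne_zero hleaf i.2
      rw [inv_leaf hdet v v i.2]
      push_cast
      field_simp
    rw [Finset.sum_congr rfl fun i _ => h3 i, Finset.sum_neg_distrib] at h2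
    exact_mod_cast h2
  have hdvd : Γ.weight i₀ ∣ c i₀ := by
    have h4 : Γ.weight i₀ ∣ z * Γ.linkingMatrix⁻¹ (v : V) (v : V) :=
      Dvd.dvd.mul_left (leaf_dvd hdet v i₀.2 (Γ.ne_leaf v i₀.2).symm) z
    rw [← hint, dvd_neg, ← Finset.add_sum_erase _ _ (Finset.mem_univ i₀)] at h4
    have h5 : Γ.weight i₀ ∣ ∑ i ∈ Finset.univ.erase i₀,
        c i * Γ.linkingMatrix⁻¹ (i : V) (v : V) := by
      refine Finset.dvd_sum fun i hi => Dvd.dvd.mul_left ?_ _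
      rw [inv_symm]
      exact leaf_dvd hdet v i₀.2 fun h => (Finset.ne_of_mem_erase hi) (Subtype.ext h)
    rw [dvd_add_left h5, inv_leaf_self hdet v i₀.2, mul_sub, mul_one] at h4
    exact (dvd_sub_left ⟨c i₀ * Γ.linkingMatrix⁻¹ (i₀ : V) (i₀ : V), by ring⟩).mp h4
  have hw := hleaf i₀ (Γ.mem_leaves.mp i₀.2).1
  have hc0 : c i₀ = 1 ∨ c i₀ = -1 := by
    rcases Int.units_eq_one_or (l i₀) with h1 | h1 <;> simp only [hc, if_neg hi₀, h1] <;> simp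
  have hc1 : |c i₀| = 1 := by rcases hc0 with h0 | h0 <;> simp [h0]
  have hle := Int.le_of_dvd (by omega : (0 : ℤ) < |c i₀|) ((dvd_abs _ _).mpr (neg_dvd.mpr hdvd))
  omega

theorem epsv_alphaOf (hdet : IsUnit Γ.linkingMatrix.det)
    (hleaf : ∀ v, Γ.deg v = 1 → Γ.weight v ≤ -2) (v : Γ.V2) (l : Γ.leaves v → ℤˣ) :
    Γ.epsv v (Γ.alphaOf v l) = signProd l := by
  have hex : ∃ l' : Γ.leaves v → ℤˣ, ∃ z : ℤ, Γ.alphaOf v l = Γ.alphaOf v l' + z :=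
    ⟨l, 0, by simp⟩
  rw [epsv, dif_pos hex]
  obtain ⟨z, hz⟩ := hex.choose_spec
  rw [← alphaOf_injective_mod_int hdet hleaf v _ _ z hz, signProd]

/-! ### Gauss sums -/

theorem Q_add_single (hdet : IsUnit Γ.linkingMatrix.det) (x : Γ.V2 → ℚ) (v : Γ.V2) (δ : ℚ) :
    Γ.Q (x + Pi.single v δ) = Γ.Q x + δ * (2 * ∑ u, Γ.S v u * x u) + δ ^ 2 * Γ.S v v := by
  have hsymm : ∀ a b, Γ.S a b = Γ.S b a := fun a b => by
    rw [S_eq Γ hdet, S_eq Γ hdet, inv_symm]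
  have hs : ∀ F : Γ.V2 → ℚ, ∑ u, (Pi.single v δ : Γ.V2 → ℚ) u * F u = δ * F v := fun F => by
    simp [Pi.single_apply]
  have hs' : ∀ F : Γ.V2 → ℚ, ∑ u, F u * (Pi.single v δ : Γ.V2 → ℚ) u = F v * δ := fun F => by
    simp [Pi.single_apply]
  simp only [Q, Pi.add_apply, mul_add, add_mul, Finset.sum_add_distrib]
  have e1 : ∑ a, ∑ b, (Pi.single v δ : Γ.V2 → ℚ) a * Γ.S a b * x b = δ * ∑ u, Γ.S v u * x u := by
    simp only [mul_assoc, ← Finset.mul_sum]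
    rw [hs]
  have e2 : ∑ a, ∑ b, x a * Γ.S a b * (Pi.single v δ : Γ.V2 → ℚ) b = δ * ∑ u, Γ.S v u * x u := by
    simp only [hs']
    rw [Finset.mul_sum]
    exact Finset.sum_congr rfl fun u _ => by rw [hsymm u v]; ring
  have e3 : ∑ a, ∑ b, (Pi.single v δ : Γ.V2 → ℚ) a * Γ.S a b * (Pi.single v δ : Γ.V2 → ℚ) b =
      δ ^ 2 * Γ.S v v := by
    simp only [hs']
    simp only [mul_assoc]
    rw [hs]
    ring
  rw [e1, e2, e3]
  ring

theorem e_add (x y : ℚ) : e (x + y) = e x * e y := by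
  rw [e, e, e, ← Complex.exp_add]
  push_cast
  ring_nf

theorem e_eq_one_iff (x : ℚ) : e x = 1 ↔ ∃ n : ℤ, x = n := by
  rw [e, Complex.exp_eq_one_iff]
  refine exists_congr fun n => ?_
  have h : (2 * Real.pi * Complex.I : ℂ) ≠ 0 := Complex.two_pi_I_ne_zero
  rw [mul_comm (n : ℂ), mul_right_inj' h]
  exact_mod_cast Iff.rfl

/-- The point `r + α` given by integers `r` and signs `l`. -/
noncomputable def point (r : Γ.V2 → ℤ) (l : ∀ v : Γ.V2, Γ.leaves v → ℤˣ) : Γ.V2 → ℚ :=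
  fun v => r v + Γ.alphaOf v (l v)

/-- The gradient of the quadratic form at a point `r + α` is integral, and it is congruent to the
sign at a leaf modulo the weight of the leaf. -/
theorem exists_gradient (hdet : IsUnit Γ.linkingMatrix.det)
    (hleaf : ∀ v, Γ.deg v = 1 → Γ.weight v ≤ -2) (r : Γ.V2 → ℤ)
    (l : ∀ v : Γ.V2, Γ.leaves v → ℤˣ) (v : Γ.V2) :
    ∃ b : ℤ, 2 * ∑ u, Γ.S v u * point r l u = b ∧
      ∀ i : Γ.leaves v, Γ.weight i ∣ b - (l v i : ℤ) := by
  refine ⟨∑ u : Γ.V2, (-Γ.linkingMatrix⁻¹ (v : V) (u : V) * (2 * r u + Γ.deg u - 2) +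
    ∑ j : Γ.leaves u, (l u j : ℤ) * Γ.linkingMatrix⁻¹ (j : V) (v : V)), ?_, fun i => ?_⟩
  · rw [Finset.mul_sum, Int.cast_sum]
    refine Finset.sum_congr rfl fun u _ => ?_
    have h1 : ∀ j : Γ.leaves u, Γ.S v u * (2 * (((l u j : ℤ) : ℚ) / (2 * (Γ.weight j : ℚ)))) =
        (((l u j : ℤ) * Γ.linkingMatrix⁻¹ (j : V) (v : V) : ℤ) : ℚ) := by
      intro j
      have hw := weight_ne_zero hleaf j.2
      rw [S_eq Γ hdet, inv_symm, inv_leaf hdet v u j.2]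
      push_cast
      field_simp
    have h2 : 2 * (Γ.S v u * point r l u) = Γ.S v u * (2 * r u + Γ.deg u - 2) +
        ∑ j : Γ.leaves u, Γ.S v u * (2 * (((l u j : ℤ) : ℚ) / (2 * (Γ.weight j : ℚ)))) := by
      rw [← Finset.mul_sum, ← Finset.mul_sum, point, alphaOf]
      ring
    rw [h2, Finset.sum_congr rfl fun j _ => h1 j, S_eq Γ hdet]
    push_cast
    rfl
  · rw [Finset.sum_add_distrib, add_sub_assoc]
    refine dvd_add (Finset.dvd_sum fun u _ => Dvd.dvd.mul_right ((dvd_neg).mpr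
      (leaf_dvd hdet v i.2 (Γ.ne_leaf u i.2).symm)) _) ?_
    rw [← Finset.add_sum_erase _ _ (Finset.mem_univ v),
      ← Finset.add_sum_erase _ _ (Finset.mem_univ i), inv_leaf_self hdet v i.2]
    have h1 : Γ.weight i ∣ ∑ j ∈ Finset.univ.erase i,
        (l v j : ℤ) * Γ.linkingMatrix⁻¹ (j : V) (v : V) := by
      refine Finset.dvd_sum fun j hj => Dvd.dvd.mul_left ?_ _
      rw [inv_symm]
      exact leaf_dvd hdet v i.2 fun h => (Finset.ne_of_mem_erase hj) (Subtype.ext h)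
    have h2 : Γ.weight i ∣ ∑ u ∈ Finset.univ.erase v, ∑ j : Γ.leaves u,
        (l u j : ℤ) * Γ.linkingMatrix⁻¹ (j : V) (v : V) := by
      refine Finset.dvd_sum fun u hu => Finset.dvd_sum fun j _ => Dvd.dvd.mul_left ?_ _
      rw [inv_symm]
      refine leaf_dvd hdet v i.2 fun h => (Finset.ne_of_mem_erase hu) (Subtype.ext ?_)
      have hj := (Γ.mem_leaves.mp j.2).2
      rw [h] at hj
      exact Γ.eq_of_mem_leaves i.2 hj
    obtain ⟨c₁, h1⟩ := h1
    obtain ⟨c₂, h2⟩ := h2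
    rw [h1, h2]
    exact ⟨c₁ + c₂ - (l v i : ℤ) * Γ.linkingMatrix⁻¹ (i : V) (i : V), by ring⟩

variable (Γ) in
/-- The value `e (Q (r + α) / k)`. -/
noncomputable def phase (k : ℕ) (r : Γ.V2 → ℤ) (l : ∀ v : Γ.V2, Γ.leaves v → ℤˣ) : ℂ :=
  e (1 / (k : ℚ) * Γ.Q (point r l))

theorem phase_update_add (hdet : IsUnit Γ.linkingMatrix.det)
    (hleaf : ∀ v, Γ.deg v = 1 → Γ.weight v ≤ -2) (k : ℕ) (r : Γ.V2 → ℤ)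
    (l : ∀ v : Γ.V2, Γ.leaves v → ℤˣ) (v : Γ.V2) :
    ∃ b : ℤ, (∀ i : Γ.leaves v, Γ.weight i ∣ b - (l v i : ℤ)) ∧ ∀ m : ℤ,
      Γ.phase k (r + Pi.single v m) l = Γ.phase k r l *
        e (1 / (k : ℚ) * (m * b - m ^ 2 * Γ.linkingMatrix⁻¹ (v : V) (v : V))) := by
  obtain ⟨b, hb, hdvd⟩ := exists_gradient hdet hleaf r l v
  refine ⟨b, hdvd, fun m => ?_⟩
  have h1 : point (r + Pi.single v m) l = point r l + Pi.single v (m : ℚ) := by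
    funext u
    by_cases h : u = v
    · subst h; simp [point]; ring
    · simp [point, h]
  rw [phase, h1, Q_add_single hdet, hb, S_eq Γ hdet, phase, ← e_add]
  congr 1
  ring

theorem phase_add_period (hdet : IsUnit Γ.linkingMatrix.det)
    (hleaf : ∀ v, Γ.deg v = 1 → Γ.weight v ≤ -2) {k : ℕ} (hk : 0 < k) (r : Γ.V2 → ℤ)
    (l : ∀ v : Γ.V2, Γ.leaves v → ℤˣ) (v : Γ.V2) (m : ℤ) :
    Γ.phase k (r + Pi.single v (k * m)) l = Γ.phase k r l := by
  obtain ⟨b, -, hb⟩ := phase_update_add hdet hleaf k r l v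
  have hk0 : (k : ℚ) ≠ 0 := Nat.cast_ne_zero.mpr hk.ne'
  rw [hb, (e_eq_one_iff _).mpr
    ⟨m * b - k * m ^ 2 * Γ.linkingMatrix⁻¹ (v : V) (v : V), ?_⟩, mul_one]
  push_cast
  field_simp

/-- The phase depends on the residues modulo `k` only. -/
theorem phase_congr (hdet : IsUnit Γ.linkingMatrix.det)
    (hleaf : ∀ v, Γ.deg v = 1 → Γ.weight v ≤ -2) {k : ℕ} (hk : 0 < k) {r r' : Γ.V2 → ℤ}
    (h : ∀ v, r v ≡ r' v [ZMOD k]) (l : ∀ v : Γ.V2, Γ.leaves v → ℤˣ) :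
    Γ.phase k r l = Γ.phase k r' l := by
  choose c hc using fun v => (h v).dvd
  have key : ∀ S : Finset Γ.V2,
      Γ.phase k (r + ∑ v ∈ S, Pi.single v (k * c v)) l = Γ.phase k r l := by
    intro S
    induction S using Finset.induction_on with
    | empty => simp
    | insert a S ha ih =>
      rw [Finset.sum_insert ha, add_comm (Pi.single a _), ← add_assoc,
        phase_add_period hdet hleaf hk, ih]
  rw [← key Finset.univ, Finset.univ_sum_single (fun v => (k : ℤ) * c v)]
  congr 1
  funext v
  simp [← hc]

theorem sum_fin_add_of_periodic {k : ℕ} (g : ℤ → ℂ) (hg : ∀ x, g (x + k) = g x) (m : ℤ) :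
    ∑ r : Fin k, g (r + m) = ∑ r : Fin k, g r := by
  have hstep : ∀ m : ℤ, ∑ r : Fin k, g (r + (m + 1)) = ∑ r : Fin k, g (r + m) := by
    intro m
    rw [Fin.sum_univ_eq_sum_range (fun r : ℕ => g ((r : ℤ) + (m + 1))),
      Fin.sum_univ_eq_sum_range (fun r : ℕ => g ((r : ℤ) + m)), ← sub_eq_zero,
      ← Finset.sum_sub_distrib]
    have h := Finset.sum_range_sub (fun r : ℕ => g ((r : ℤ) + m)) k
    rw [Nat.cast_zero, zero_add, add_comm (k : ℤ), hg, sub_self] at h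
    rw [← h]
    refine Finset.sum_congr rfl fun r _ => ?_
    push_cast
    ring_nf
  induction m using Int.induction_on with
  | zero => simp
  | succ n ih => rw [hstep, ih]
  | pred n ih =>
    rw [← ih, ← hstep]
    simp

/-- The Gauss sum over the residues at `v`, the residues at the other vertices and the signs being
fixed. -/
noncomputable def gaussSum (k : ℕ) (r : Γ.V2 → ℤ) (l : ∀ v : Γ.V2, Γ.leaves v → ℤˣ) (v : Γ.V2) : ℂ :=
  ∑ q : Fin k, Γ.phase k (Function.update r v (q : ℤ)) l

theorem gaussSum_shift (hdet : IsUnit Γ.linkingMatrix.det)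
    (hleaf : ∀ v, Γ.deg v = 1 → Γ.weight v ≤ -2) {k : ℕ} (hk : 0 < k) (r : Γ.V2 → ℤ)
    (l : ∀ v : Γ.V2, Γ.leaves v → ℤˣ) (v : Γ.V2) (m : ℤ) :
    gaussSum k r l v =
      ∑ q : Fin k, Γ.phase k (Function.update r v (q : ℤ) + Pi.single v m) l := by
  have hadd : ∀ x y : ℤ, Function.update r v x + Pi.single v y = Function.update r v (x + y) := by
    intro x y
    funext u
    by_cases h : u = v
    · subst h; simp
    · simp [h]
  rw [gaussSum, ← sum_fin_add_of_periodic (fun x => Γ.phase k (Function.update r v x) l)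
    (fun x => by
      rw [← hadd]
      simpa using phase_add_period hdet hleaf hk (Function.update r v x) l v 1) m]
  simp only [hadd]

/-- If the weight of a leaf and `k` have a common divisor, the Gauss sum vanishes: a shift by
`k / gcd` multiplies it by a nontrivial root of unity. -/
theorem gaussSum_eq_zero (hdet : IsUnit Γ.linkingMatrix.det)
    (hleaf : ∀ v, Γ.deg v = 1 → Γ.weight v ≤ -2) {k : ℕ} (hk : 0 < k) (r : Γ.V2 → ℤ)
    (l : ∀ v : Γ.V2, Γ.leaves v → ℤˣ) (v : Γ.V2) (i : Γ.leaves v)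
    (hg : Int.gcd (Γ.weight i) k ≠ 1) : gaussSum k r l v = 0 := by
  set g := Int.gcd (Γ.weight i) k with hgdef
  have hg0 : g ≠ 0 := fun h => by
    have := (Int.gcd_eq_zero_iff.mp h).2
    omega
  obtain ⟨k', hk'⟩ : (g : ℤ) ∣ k := Int.gcd_dvd_right _ _
  obtain ⟨w', hw'⟩ : (g : ℤ) ∣ Γ.weight i := Int.gcd_dvd_left _ _
  have hgq : (g : ℚ) ≠ 0 := Nat.cast_ne_zero.mpr hg0
  have hk0 : (k : ℚ) ≠ 0 := Nat.cast_ne_zero.mpr hk.ne'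
  have hkq : (k : ℚ) = g * k' := by exact_mod_cast hk'
  have hk'0 : (k' : ℚ) ≠ 0 := fun h => hk0 (by rw [hkq, h, mul_zero])
  have hstep : ∀ q : Fin k, Γ.phase k (Function.update r v (q : ℤ) + Pi.single v k') l =
      Γ.phase k (Function.update r v (q : ℤ)) l * e ((l v i : ℤ) / (g : ℚ)) := by
    intro q
    obtain ⟨b, hdvd, hb⟩ := phase_update_add hdet hleaf k (Function.update r v (q : ℤ)) l v
    rw [hb]
    congr 1
    obtain ⟨c, hc⟩ := hdvd i
    have hA := inv_leaf hdet v v i.2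
    have hb' : (b : ℚ) = (l v i : ℤ) + g * w' * c := by
      have : b = (l v i : ℤ) + g * w' * c := by rw [← hw', ← hc]; ring
      exact_mod_cast this
    have h1 : 1 / (k : ℚ) * (k' * b - k' ^ 2 * Γ.linkingMatrix⁻¹ (v : V) (v : V)) =
        (l v i : ℤ) / (g : ℚ) + ((w' * c + k' * w' * Γ.linkingMatrix⁻¹ (i : V) (v : V) : ℤ) : ℚ) := by
      rw [hA, hw', hkq, hb']
      push_cast
      field_simp
      ring
    rw [h1, e_add, (e_eq_one_iff ((_ : ℤ) : ℚ)).mpr ⟨_, rfl⟩, mul_one]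
  have h := gaussSum_shift hdet hleaf hk r l v k'
  rw [Finset.sum_congr rfl fun q _ => hstep q, ← Finset.sum_mul] at h
  have hne : e ((l v i : ℤ) / (g : ℚ)) ≠ 1 := by
    rw [Ne, e_eq_one_iff]
    rintro ⟨n, hn⟩
    rw [div_eq_iff hgq] at hn
    have hn' : (l v i : ℤ) = n * g := by exact_mod_cast hn
    have hu : IsUnit ((g : ℤ)) := isUnit_of_dvd_unit ⟨n, by rw [hn']; ring⟩ (l v i).isUnit
    exact hg (by simpa using Int.isUnit_iff_natAbs_eq.mp hu)
  have h2 : gaussSum k r l v * (1 - e ((l v i : ℤ) / (g : ℚ))) = 0 := by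
    rw [mul_sub, mul_one, sub_eq_zero]
    exact h
  exact (mul_eq_zero.mp h2).resolve_right (sub_ne_zero.mpr hne.symm)

/-- The Gauss sum does not depend on the sign at a leaf of `v`: if the weight of the leaf is prime
to `k`, an integral shift compensates for a change of the sign. -/
theorem gaussSum_flip (hdet : IsUnit Γ.linkingMatrix.det)
    (hleaf : ∀ v, Γ.deg v = 1 → Γ.weight v ≤ -2) {k : ℕ} (hk : 0 < k) (r : Γ.V2 → ℤ)
    (l : ∀ v : Γ.V2, Γ.leaves v → ℤˣ) (v : Γ.V2) (i : Γ.leaves v) (s : Γ.leaves v → ℤˣ) :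
    gaussSum k r (Function.update l v (Function.update s i 1)) v =
      gaussSum k r (Function.update l v (Function.update s i (-1))) v := by
  by_cases hg : Int.gcd (Γ.weight i) k = 1
  swap
  · rw [gaussSum_eq_zero hdet hleaf hk r _ v i hg, gaussSum_eq_zero hdet hleaf hk r _ v i hg]
  obtain ⟨x, y, hxy⟩ := Int.isCoprime_iff_gcd_eq_one.mpr hg
  have hw := weight_ne_zero hleaf i.2
  have hk0 : (k : ℚ) ≠ 0 := Nat.cast_ne_zero.mpr hk.ne'
  rw [gaussSum_shift hdet hleaf hk r (Function.update l v (Function.update s i 1)) v (-x), gaussSum]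
  refine Finset.sum_congr rfl fun q _ => ?_
  set l₁ := Function.update l v (Function.update s i 1)
  set l₂ := Function.update l v (Function.update s i (-1)) with hl₂
  set ρ := Function.update r v (q : ℤ)
  obtain ⟨b, hb, hdvd⟩ := exists_gradient hdet hleaf ρ l₂ v
  -- with `x w + y k = 1` the change of the sign and the shift by `-x` add up to `k y / w`
  have hpt : point (ρ + Pi.single v (-x)) l₁ =
      point ρ l₂ + Pi.single v ((k : ℚ) * y / Γ.weight i) := by
    have hxyq : (x : ℚ) * Γ.weight i + y * k = 1 := by exact_mod_cast hxy
    funext u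
    by_cases h : u = v
    · subst h
      simp only [point, Pi.add_apply, Pi.single_eq_same, l₁, l₂, Function.update_self, alphaOf]
      rw [← Finset.add_sum_erase _ _ (Finset.mem_univ i),
        ← Finset.add_sum_erase (a := i) _ (fun j => (((Function.update s i (-1) j : ℤˣ) : ℤ) : ℚ) /
          (2 * (Γ.weight j : ℚ))) (Finset.mem_univ i)]
      have he : ∑ j ∈ Finset.univ.erase i, (((Function.update s i 1 j : ℤˣ) : ℤ) : ℚ) /
          (2 * (Γ.weight j : ℚ)) = ∑ j ∈ Finset.univ.erase i,
          (((Function.update s i (-1) j : ℤˣ) : ℤ) : ℚ) / (2 * (Γ.weight j : ℚ)) := by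
        refine Finset.sum_congr rfl fun j hj => ?_
        rw [Function.update_of_ne (Finset.ne_of_mem_erase hj),
          Function.update_of_ne (Finset.ne_of_mem_erase hj)]
      rw [he, Function.update_self, Function.update_self]
      push_cast
      field_simp
      linear_combination -2 * hxyq
    · simp [point, h, l₁, l₂]
  obtain ⟨c, hc⟩ := hdvd i
  have hli : (l₂ v i : ℤ) = -1 := by simp [hl₂]
  have hbq : (b : ℚ) = -1 + Γ.weight i * c := by
    have : b = -1 + Γ.weight i * c := by rw [← hc, hli]; ring
    exact_mod_cast this
  have hkyq : (k : ℚ) * y = 1 - x * Γ.weight i := by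
    have : (k : ℤ) * y = 1 - x * Γ.weight i := by linear_combination hxy
    exact_mod_cast this
  have hA : ((Γ.linkingMatrix⁻¹ (v : V) (v : V) : ℤ) : ℚ) =
      -(Γ.weight i * (1 - Γ.weight i * (Γ.linkingMatrix⁻¹ (i : V) (i : V) : ℤ))) := by
    rw [inv_leaf hdet v v i.2, inv_leaf_self hdet v i.2]
    push_cast
    rfl
  rw [phase, hpt, Q_add_single hdet, hb, S_eq Γ hdet, phase, add_assoc, mul_add, e_add,
    (e_eq_one_iff (_ * (_ + _))).mpr ⟨y * (c - k * y * Γ.linkingMatrix⁻¹ (i : V) (i : V) - x), ?_⟩,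
    mul_one]
  rw [hA, hbq]
  push_cast
  field_simp
  linear_combination (y : ℚ) * hkyq

theorem eq_of_forall_flip {J : Type*} [Fintype J] [DecidableEq J] {X : Type*}
    (g : (J → ℤˣ) → X)
    (h : ∀ i s, g (Function.update s i 1) = g (Function.update s i (-1))) (s t : J → ℤˣ) :
    g s = g t := by
  have h' : ∀ i s (a : ℤˣ), g (Function.update s i a) = g s := by
    intro i s a
    have h1 : ∀ a : ℤˣ, g (Function.update s i a) = g (Function.update s i 1) := by
      intro a
      rcases Int.units_eq_one_or a with rfl | rfl
      · rfl
      · exact (h i s).symm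
    have h2 := h1 (s i)
    rw [Function.update_eq_self] at h2
    rw [h1 a, h2]
  have key : ∀ S : Finset J, g (S.piecewise s t) = g t := by
    intro S
    induction S using Finset.induction_on with
    | empty => simp
    | insert a S _ ih => rw [Finset.piecewise_insert, h', ih]
  simpa using key Finset.univ

/-- The Gauss sum at `v` does not depend on the signs at `v`. -/
theorem gaussSum_update_eq (hdet : IsUnit Γ.linkingMatrix.det)
    (hleaf : ∀ v, Γ.deg v = 1 → Γ.weight v ≤ -2) {k : ℕ} (hk : 0 < k) (r : Γ.V2 → ℤ)
    (l : ∀ v : Γ.V2, Γ.leaves v → ℤˣ) (v : Γ.V2) (s : Γ.leaves v → ℤˣ) :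
    gaussSum k r (Function.update l v s) v = gaussSum k r l v := by
  have h := eq_of_forall_flip (fun s => gaussSum k r (Function.update l v s) v)
    (fun i s => gaussSum_flip hdet hleaf hk r l v i s) s (l v)
  simpa using h

end PlumbingGraph

/-- For negative exponents the contribution of a vertex is a polynomial of degree at most `d` in
`a` and does not depend on the residue. -/
theorem exists_polynomial_vertexCoeff_of_neg (k d : ℕ) {n : ℤ} (hn : n ≤ -1) :
    ∃ q : Polynomial ℚ, q.natDegree ≤ d ∧ ∀ (a : ℚ) (x : ℕ), vertexCoeff k d n a x = q.eval a := by
  refine ⟨∑ j ∈ Finset.range (d + 1), Polynomial.C ((binomPoly d).coeff j * (k : ℚ) ^ ((j : ℤ) + n)) *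
    if -(j : ℤ) - 1 ≤ n then
      Polynomial.C ((-1) ^ n * ((j ! : ℚ) / ((((j : ℤ) + n + 1).toNat)! : ℚ))) *
        (Polynomial.C (-(k : ℚ)⁻¹) * Polynomial.X) ^ ((j : ℤ) + n + 1).toNat else 0, ?_, ?_⟩
  · refine Polynomial.natDegree_sum_le_of_forall_le _ _ fun j hj => ?_
    refine (Polynomial.natDegree_C_mul_le _ _).trans ?_
    split_ifs
    · refine (Polynomial.natDegree_C_mul_le _ _).trans (Polynomial.natDegree_pow_le.trans ?_)
      have h1 : (Polynomial.C (-(k : ℚ)⁻¹) * Polynomial.X).natDegree ≤ 1 :=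
        (Polynomial.natDegree_C_mul_le _ _).trans Polynomial.natDegree_X_le
      have h2 := Finset.mem_range.mp hj
      have h3 : ((j : ℤ) + n + 1).toNat ≤ d := by omega
      nlinarith
    · simp
  · intro a x
    rw [vertexCoeff, Polynomial.eval_finsetSum]
    refine Finset.sum_congr rfl fun j _ => ?_
    rw [PlumbingGraph.bbB, if_neg (by omega)]
    split_ifs
    · simp only [Polynomial.eval_mul, Polynomial.eval_C, Polynomial.eval_pow, Polynomial.eval_X]
      rw [show -(a / (k : ℚ)) = -(k : ℚ)⁻¹ * a by ring]
    · simp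

/-- Functions of a residue and a sign vector whose sums over the residues are proportional to the
product of the signs. -/
def signProportional (J : Type*) [Fintype J] (k : ℕ) : Submodule ℂ (Fin k × (J → ℤˣ) → ℂ) where
  carrier := {w | ∃ G : ℂ, ∀ l, ∑ r, w (r, l) = (signProd l : ℂ) * G}
  add_mem' := by
    rintro w w' ⟨G, hG⟩ ⟨G', hG'⟩
    refine ⟨G + G', fun l => ?_⟩
    simp only [Pi.add_apply, Finset.sum_add_distrib, hG, hG', mul_add]
  zero_mem' := ⟨0, by simp⟩
  smul_mem' := by
    rintro c w ⟨G, hG⟩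
    refine ⟨c * G, fun l => ?_⟩
    simp only [Pi.smul_apply, smul_eq_mul, ← Finset.mul_sum, hG]
    ring

/-- The alternating sum over the signs of at least `d + 1` leaves annihilates polynomials of degree
at most `d`. -/
theorem sum_mul_vertexCoeff_eq_zero {J : Type*} [Fintype J] [DecidableEq J] (wt : J → ℕ) {k d : ℕ}
    (hd : d + 1 ≤ Fintype.card J) {n : ℤ} (hn : n ≤ -1) (a : ℚ) {w : Fin k × (J → ℤˣ) → ℂ}
    (hw : w ∈ signProportional J k) :
    ∑ i, w i * ((vertexCoeff k d n (a + signShift wt i.2) (i.1 : ℕ) : ℚ) : ℂ) = 0 := by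
  obtain ⟨G, hG⟩ := hw
  obtain ⟨q, hq, hqv⟩ := exists_polynomial_vertexCoeff_of_neg k d hn
  have h := sum_signProd_mul_eval wt q (hq.trans (by omega)) a
  rw [Polynomial.coeff_eq_zero_of_natDegree_lt (hq.trans_lt hd), mul_zero] at h
  have h' : ∑ l : J → ℤˣ, (signProd l : ℂ) * ((q.eval (a + signShift wt l) : ℚ) : ℂ) = 0 := by
    exact_mod_cast congrArg (fun x : ℚ => (x : ℂ)) h
  simp only [hqv]
  rw [Fintype.sum_prod_type_right]
  simp only [← Finset.sum_mul, hG]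
  rw [← mul_zero G, ← h', Finset.mul_sum]
  exact Finset.sum_congr rfl fun l _ => by ring

theorem coeff_vertexSeries {J : Type*} [Fintype J] {wt : J → ℕ} (hwt : ∀ j, 0 < wt j)
    (k d : ℕ) (i : Fin k × (J → ℤˣ)) (n : ℕ) :
    PowerSeries.coeff ((∏ j, wt j) * n + signOffset wt i.2) (vertexSeries wt k d i) =
      if n % k = i.1 then ((n + d).choose d : ℂ) else 0 := by
  have hN : 0 < ∏ j, wt j := Finset.prod_pos fun j _ => hwt j
  rw [vertexSeries, PowerSeries.coeff_X_pow_mul', if_pos (Nat.le_add_left _ _), Nat.add_sub_cancel,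
    residueSeries, PowerSeries.coeff_mk, Nat.mul_div_cancel_left _ hN]
  simp

theorem exists_of_coeff_vertexSeries_ne_zero {J : Type*} [Fintype J] {wt : J → ℕ}
    {k d : ℕ} {i : Fin k × (J → ℤˣ)} {z : ℕ}
    (h : PowerSeries.coeff z (vertexSeries wt k d i) ≠ 0) :
    ∃ n, z = (∏ j, wt j) * n + signOffset wt i.2 := by
  rw [vertexSeries, PowerSeries.coeff_X_pow_mul'] at h
  split_ifs at h with h1
  · rw [residueSeries, PowerSeries.coeff_mk] at h
    split_ifs at h with h2
    · obtain ⟨n, hn⟩ := h2.1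
      exact ⟨n, by omega⟩
    · exact absurd rfl h
  · exact absurd rfl h

namespace PlumbingGraph

variable {V : Type*} [Fintype V] (Γ : PlumbingGraph V)

/-! ### Bookkeeping of vertices -/

/-- The inclusion of the vertices of degree at least three. -/
def toV2 (v : Γ.V3) : Γ.V2 := ⟨v, le_trans (by norm_num) v.2⟩

theorem toV2_injective : Function.Injective Γ.toV2 := fun _ _ h =>
  Subtype.ext (congrArg (fun x : Γ.V2 => (x : V)) h)

theorem prod_V3 {R : Type*} [CommMonoid R] (x : Γ.V3 → R) :
    ∏ v, x v = ∏ v : Γ.V2, if h : 3 ≤ Γ.deg v then x ⟨v, h⟩ else 1 := by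
  refine Fintype.prod_of_injective Γ.toV2 Γ.toV2_injective _ _ ?_ ?_
  · intro v hv
    rw [dif_neg]
    exact fun h => hv ⟨⟨v, h⟩, rfl⟩
  · intro v
    have h : 3 ≤ Γ.deg (Γ.toV2 v) := v.2
    rw [dif_pos h]
    rfl

/-- The absolute values of the weights of the leaves at a vertex. -/
def leafWeight (v : Γ.V2) (i : Γ.leaves v) : ℕ := (Γ.weight i).natAbs

variable {Γ}

theorem leafWeight_pos (hleaf : ∀ v, Γ.deg v = 1 → Γ.weight v ≤ -2) (v : Γ.V2)
    (i : Γ.leaves v) : 0 < Γ.leafWeight v i := by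
  have := hleaf i (Γ.mem_leaves.mp i.2).1
  rw [leafWeight]
  omega

variable (Γ) in
/-- The series attached to a vertex; it is trivial for a vertex of degree two. -/
noncomputable def series (k : ℕ) (v : Γ.V2) (i : Fin k × (Γ.leaves v → ℤˣ)) : PowerSeries ℂ :=
  if 3 ≤ Γ.deg v then vertexSeries (Γ.leafWeight v) k (Γ.deg v - 3) i else 1

variable (Γ) in
/-- The contribution of a vertex to the coefficient `c n`; it is trivial for degree two. -/
noncomputable def vertexValue (k : ℕ) (n : Γ.V3 → ℤ) (v : Γ.V2) (i : Fin k × (Γ.leaves v → ℤˣ)) :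
    ℂ :=
  if h : 3 ≤ Γ.deg v then
    ((vertexCoeff k (Γ.deg v - 3) (n ⟨v, h⟩) (Γ.alphaOf v i.2) (i.1 : ℕ) : ℚ) : ℂ) else 1

variable (Γ) in
/-- The functions of the index at a vertex that are admissible weights. -/
noncomputable def admissible (k : ℕ) (v : Γ.V2) :
    Submodule ℂ (Fin k × (Γ.leaves v → ℤˣ) → ℂ) :=
  if 3 ≤ Γ.deg v then signProportional (Γ.leaves v) k else ⊤

theorem sum_smul_series_mem_regularAtOne [DecidableEq V]
    (hleaf : ∀ v, Γ.deg v = 1 → Γ.weight v ≤ -2)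
    {k : ℕ} (hk : 0 < k)
    (hdeg : ∀ v, 3 ≤ Γ.deg v → 0 ≤ ((Γ.leaves v).card : ℤ) + 2 - (Γ.deg v : ℤ)) (v : Γ.V2)
    {w : Fin k × (Γ.leaves v → ℤˣ) → ℂ} (hw : w ∈ Γ.admissible k v) :
    (∑ i, w i • Γ.series k v i, ∑ i, w i * Γ.vertexValue k 0 v i) ∈
      regularAtOne (Γ.deg v - 3) := by
  by_cases h : 3 ≤ Γ.deg v
  · rw [admissible, if_pos h] at hw
    obtain ⟨G, hG⟩ := hw
    have hd : Γ.deg v - 3 + 1 ≤ Fintype.card (Γ.leaves v) := by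
      have := hdeg v h
      rw [Fintype.card_coe]
      omega
    have key := sum_smul_vertexSeries_mem_regularAtOne (leafWeight_pos hleaf v) hk hd
      (Γ.alphaOf v 1) w G hG
    convert key using 1
    refine Prod.ext ?_ ?_
    · simp [Prod.fst_sum, series, h]
    · simp only [Prod.snd_sum, vertexValue, dif_pos h, Prod.smul_snd, smul_eq_mul]
      refine Finset.sum_congr rfl fun i _ => ?_
      rw [alphaOf_eq hleaf v i.2]
      rfl
  · simp only [series, if_neg h, vertexValue, dif_neg h, mul_one]
    convert C_mem_regularAtOne _ (∑ i, w i) using 2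
    rw [← Finset.sum_smul, PowerSeries.smul_eq_C_mul, mul_one]

theorem polyGrowth_series (k : ℕ) (v : Γ.V2) (i : Fin k × (Γ.leaves v → ℤˣ)) :
    PolyGrowth (Γ.series k v i) := by
  rw [series]
  split_ifs
  · rw [vertexSeries]
    simpa using (polyGrowth_residueSeries _ _ _ _).polynomial_mul (Polynomial.X ^ signOffset _ _)
  · exact ⟨1, 0, fun z => by rw [PowerSeries.coeff_one]; split_ifs <;> simp⟩

/-- For a negative exponent at `v`, admissible weights annihilate the contribution of `v`. -/
theorem sum_mul_vertexValue_eq_zero [DecidableEq V]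
    (hleaf : ∀ v, Γ.deg v = 1 → Γ.weight v ≤ -2) {k : ℕ}
    (hdeg : ∀ v, 3 ≤ Γ.deg v → 0 ≤ ((Γ.leaves v).card : ℤ) + 2 - (Γ.deg v : ℤ))
    (n : Γ.V3 → ℤ) (v : Γ.V3) (hn : n v ≤ -1)
    {w : Fin k × (Γ.leaves (Γ.toV2 v) → ℤˣ) → ℂ} (hw : w ∈ Γ.admissible k (Γ.toV2 v)) :
    ∑ i, w i * Γ.vertexValue k n (Γ.toV2 v) i = 0 := by
  have h : 3 ≤ Γ.deg (Γ.toV2 v) := v.2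
  rw [admissible, if_pos h] at hw
  have hd : Γ.deg (Γ.toV2 v) - 3 + 1 ≤ Fintype.card (Γ.leaves (Γ.toV2 v)) := by
    have := hdeg _ h
    rw [Fintype.card_coe]
    omega
  rw [← sum_mul_vertexCoeff_eq_zero (Γ.leafWeight (Γ.toV2 v)) hd hn (Γ.alphaOf (Γ.toV2 v) 1) hw]
  refine Finset.sum_congr rfl fun i _ => ?_
  rw [vertexValue, dif_pos h, alphaOf_eq hleaf _ i.2]
  rfl

/-! ### The weights of the indices -/

variable (Γ) in
/-- The families of residues that vanish at the vertices of degree two. -/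
def Supported {k : ℕ} (r : Γ.V2 → Fin k) : Prop := ∀ v : Γ.V2, Γ.deg v < 3 → (r v : ℕ) = 0

open scoped Classical in
variable (Γ) in
/-- The weight of a family of residues and signs: the product of all signs times
`e (Q (r + α) / k)`, or zero if a residue at a vertex of degree two does not vanish. -/
noncomputable def indexWeight [DecidableEq V] (k : ℕ)
    (i : ∀ v : Γ.V2, Fin k × (Γ.leaves v → ℤˣ)) : ℂ :=
  (∏ v, (signProd (i v).2 : ℂ)) * if Γ.Supported fun v => (i v).1 then
    Γ.phase k (fun v => ((i v).1 : ℤ)) fun v => (i v).2 else 0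

theorem indexWeight_slice_mem [DecidableEq V] (hdet : IsUnit Γ.linkingMatrix.det)
    (hleaf : ∀ v, Γ.deg v = 1 → Γ.weight v ≤ -2) {k : ℕ} (hk : 0 < k) (v : Γ.V2)
    (i : ∀ v : Γ.V2, Fin k × (Γ.leaves v → ℤˣ)) :
    (fun a => Γ.indexWeight k (Function.update i v a)) ∈ Γ.admissible k v := by
  classical
  rw [admissible]
  split_ifs with h
  swap
  · exact Submodule.mem_top
  refine ⟨(∏ u ∈ Finset.univ.erase v, (signProd (i u).2 : ℂ)) *
    if Γ.Supported fun v => (i v).1 then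
      gaussSum k (fun v => ((i v).1 : ℤ)) (fun v => (i v).2) v else 0, fun l => ?_⟩
  have hsupp : ∀ r : Fin k, (Γ.Supported fun u => (Function.update i v (r, l) u).1) ↔
      Γ.Supported fun u => (i u).1 := by
    intro r
    refine forall_congr' fun u => ?_
    by_cases hu : u = v
    · subst hu
      exact ⟨fun _ h' => absurd h' (by omega), fun _ h' => absurd h' (by omega)⟩
    · simp only [Function.update_of_ne hu]
  have hprod : ∀ r : Fin k, ∏ u, (signProd (Function.update i v (r, l) u).2 : ℂ) =
      (signProd l : ℂ) * ∏ u ∈ Finset.univ.erase v, (signProd (i u).2 : ℂ) := by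
    intro r
    rw [← Finset.mul_prod_erase _ _ (Finset.mem_univ v), Function.update_self]
    congr 1
    exact Finset.prod_congr rfl fun u hu => by
      rw [Function.update_of_ne (Finset.ne_of_mem_erase hu)]
  have hres : ∀ r : Fin k, (fun u => ((Function.update i v (r, l) u).1 : ℤ)) =
      Function.update (fun u => ((i u).1 : ℤ)) v (r : ℤ) := by
    intro r
    funext u
    by_cases hu : u = v
    · subst hu; simp
    · simp [hu]
  have hsig : ∀ r : Fin k, (fun u => (Function.update i v (r, l) u).2) =
      Function.update (fun u => (i u).2) v l := by
    intro r
    funext u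
    by_cases hu : u = v
    · subst hu; simp
    · simp [hu]
  simp only [indexWeight, hsupp, hprod, hres, hsig]
  rw [← Finset.mul_sum, mul_assoc]
  congr 2
  split_ifs with hs
  · rw [← gaussSum_update_eq hdet hleaf hk _ _ v l, gaussSum]
  · simp

/-! ### Sums over indices -/

/-- The sum over `calS` as a sum over all families of signs. -/
theorem sum_calS [DecidableEq V] (hdet : IsUnit Γ.linkingMatrix.det)
    (hleaf : ∀ v, Γ.deg v = 1 → Γ.weight v ≤ -2) (H : (Γ.V2 → ℚ) → ℂ) :
    ∑ a ∈ Γ.calS, (Γ.eps a : ℂ) * H a = ∑ l : ∀ v : Γ.V2, Γ.leaves v → ℤˣ,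
      (∏ v, (signProd (l v) : ℂ)) * H fun v => Γ.alphaOf v (l v) := by
  classical
  have himg : Γ.calS = Finset.univ.image
      (fun (l : ∀ v : Γ.V2, Γ.leaves v → ℤˣ) (v : Γ.V2) => Γ.alphaOf v (l v)) := by
    ext a
    simp only [calS, calSv, Fintype.mem_piFinset, Finset.mem_image, Finset.mem_univ, true_and]
    constructor
    · intro h
      choose l hl using h
      exact ⟨l, funext hl⟩
    · rintro ⟨l, rfl⟩ v
      exact ⟨l v, rfl⟩
  rw [himg, Finset.sum_image]
  · refine Finset.sum_congr rfl fun l _ => ?_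
    simp only [eps, epsv_alphaOf hdet hleaf]
    push_cast
    rfl
  · intro l _ l' _ h
    funext v
    exact alphaOf_injective_mod_int hdet hleaf v _ _ 0 (by simpa using congrFun h v)

open scoped Classical in
theorem sum_piFinset_range [DecidableEq V] {k : ℕ} (hk : 0 < k) (H : (Γ.V3 → ℕ) → ℂ) :
    ∑ l ∈ Fintype.piFinset (fun _ : Γ.V3 => Finset.range k), H l =
      ∑ r : Γ.V2 → Fin k, if Γ.Supported r then H fun v => r (Γ.toV2 v) else 0 := by
  rw [← Finset.sum_filter]
  symm
  refine Finset.sum_nbij (fun (r : Γ.V2 → Fin k) (v : Γ.V3) => ((r (Γ.toV2 v) : Fin k) : ℕ))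
    ?_ ?_ ?_ (fun _ _ => rfl)
  · intro r _
    rw [Fintype.mem_piFinset]
    exact fun v => Finset.mem_range.mpr (r _).2
  · intro r hr r' hr' h
    have hr := (Finset.mem_filter.mp hr).2
    have hr' := (Finset.mem_filter.mp hr').2
    funext v
    refine Fin.ext ?_
    by_cases hv : 3 ≤ Γ.deg v
    · exact congrFun h ⟨v, hv⟩
    · rw [hr v (by omega), hr' v (by omega)]
  · intro l hl
    have hl := Fintype.mem_piFinset.mp hl
    refine ⟨fun v => if h : 3 ≤ Γ.deg v then ⟨l ⟨v, h⟩, Finset.mem_range.mp (hl _)⟩ else ⟨0, hk⟩,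
      ?_, ?_⟩
    · refine Finset.mem_coe.mpr (Finset.mem_filter.mpr ⟨Finset.mem_univ _, fun v hv => ?_⟩)
      simp only [dif_neg (not_le.mpr hv)]
    · funext v
      have h : 3 ≤ Γ.deg (Γ.toV2 v) := v.2
      simp only [dif_pos h]
      rfl

open scoped Classical in
theorem sum_index [DecidableEq V] {k : ℕ}
    (H : (Γ.V2 → Fin k) → (∀ v : Γ.V2, Γ.leaves v → ℤˣ) → ℂ) :
    ∑ i : ∀ v : Γ.V2, Fin k × (Γ.leaves v → ℤˣ),
        Γ.indexWeight k i * H (fun v => (i v).1) (fun v => (i v).2) =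
      ∑ l : ∀ v : Γ.V2, Γ.leaves v → ℤˣ, (∏ v, (signProd (l v) : ℂ)) *
        ∑ r : Γ.V2 → Fin k,
          if Γ.Supported r then Γ.phase k (fun v => ((r v : Fin k) : ℤ)) l * H r l else 0 := by
  simp only [Finset.mul_sum]
  rw [← Fintype.sum_prod_type']
  refine Fintype.sum_equiv
    { toFun := fun i => (fun v => (i v).2, fun v => (i v).1)
      invFun := fun x v => (x.2 v, x.1 v)
      left_inv := fun _ => rfl
      right_inv := fun _ => rfl } _ _ fun i => ?_
  simp only [indexWeight, Equiv.coe_fn_mk]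
  split_ifs <;> ring

theorem point_eq_ext0 {k : ℕ} {r : Γ.V2 → Fin k} (hr : Γ.Supported r)
    (l : ∀ v : Γ.V2, Γ.leaves v → ℤˣ) :
    point (fun v => ((r v : Fin k) : ℤ)) l = fun v =>
      Γ.ext0 (fun u : Γ.V3 => ((r (Γ.toV2 u) : ℕ) : ℚ)) v + Γ.alphaOf v (l v) := by
  funext v
  rw [point, ext0]
  split_ifs with h
  · simp [toV2]
  · rw [hr v (by omega)]
    simp

theorem P_eq : Γ.P = ∏ v : Γ.V3, Polynomial.aeval (MvPolynomial.X v : MvPolynomial Γ.V3 ℚ)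
    (binomPoly (Γ.deg v - 3)) := by
  rw [P]
  refine Finset.prod_congr rfl fun v _ => ?_
  rw [binomPoly]
  simp [map_prod, MvPolynomial.algebraMap_eq]

theorem eval_P (n : Γ.V3 → ℕ) : MvPolynomial.eval (fun v => (n v : ℚ)) Γ.P =
    ∏ v : Γ.V3, ((n v + (Γ.deg v - 3)).choose (Γ.deg v - 3) : ℚ) := by
  rw [P_eq, map_prod]
  refine Finset.prod_congr rfl fun v _ => ?_
  rw [← eval_binomPoly, Polynomial.aeval_def, Polynomial.hom_eval₂, MvPolynomial.eval_X,
    Polynomial.eval₂_eq_eval_map]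
  congr 1
  ext j
  simp

/-- The expansion of the product of the contributions of the vertices into monomials of `P`. -/
theorem prod_vertexCoeff (k : ℕ) (n : Γ.V3 → ℤ) (a : Γ.V2 → ℚ) (l : Γ.V3 → ℕ) :
    ∏ v : Γ.V3, vertexCoeff k (Γ.deg v - 3) (n v) (a (Γ.toV2 v)) (l v) =
      ∑ m ∈ Γ.P.support, (Γ.P.coeff m * ∏ v, (k : ℚ) ^ ((m v : ℤ) + n v)) *
        ∏ v : Γ.V3, bbB (m v) (n v) (a (Γ.toV2 v) / (k : ℚ)) ((l v : ℚ) / (k : ℚ)) := by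
  classical
  have h := sum_coeff_mul_prod (fun v : Γ.V3 => binomPoly (Γ.deg v - 3))
    (fun v => Γ.deg v - 3) (fun v => natDegree_binomPoly_le _)
    (fun v j => (k : ℚ) ^ ((j : ℤ) + n v) *
      bbB j (n v) (a (Γ.toV2 v) / (k : ℚ)) ((l v : ℚ) / (k : ℚ)))
  rw [← P_eq] at h
  simp only [vertexCoeff, mul_assoc]
  rw [← h]
  exact Finset.sum_congr rfl fun m _ => by rw [Finset.prod_mul_distrib]

theorem c_eq_sum_prod_vertexCoeff [DecidableEq V] (k : ℕ) (n : Γ.V3 → ℤ) :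
    Γ.c k n = ∑ a ∈ Γ.calS, (Γ.eps a : ℂ) *
      ∑ l ∈ Fintype.piFinset (fun _ : Γ.V3 => Finset.range k),
        e (1 / (k : ℚ) * Γ.Q (fun v => Γ.ext0 (fun u => (l u : ℚ)) v + a v)) *
          ((∏ v : Γ.V3, vertexCoeff k (Γ.deg v - 3) (n v) (a (Γ.toV2 v)) (l v) : ℚ) : ℂ) := by
  simp only [prod_vertexCoeff, c, Rat.cast_sum, Finset.mul_sum]
  rw [Finset.sum_comm]
  refine Finset.sum_congr rfl fun a _ => ?_
  rw [Finset.sum_comm]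
  refine Finset.sum_congr rfl fun l _ => Finset.sum_congr rfl fun m _ => ?_
  rw [Rat.cast_mul ((Γ.P.coeff m * _))]
  simp only [toV2]
  ring

/-- The coefficients `c n` as weighted sums of products of contributions of the vertices. -/
theorem c_eq [DecidableEq V] (hdet : IsUnit Γ.linkingMatrix.det)
    (hleaf : ∀ v, Γ.deg v = 1 → Γ.weight v ≤ -2) {k : ℕ} (hk : 0 < k) (n : Γ.V3 → ℤ) :
    Γ.c k n = ∑ i : ∀ v : Γ.V2, Fin k × (Γ.leaves v → ℤˣ),
      Γ.indexWeight k i * ∏ v, Γ.vertexValue k n v (i v) := by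
  classical
  refine (c_eq_sum_prod_vertexCoeff k n).trans ((sum_calS hdet hleaf _).trans
    (Eq.trans ?_ (sum_index fun r l => ∏ v, Γ.vertexValue k n v (r v, l v)).symm))
  refine Finset.sum_congr rfl fun l _ => congrArg _ ?_
  refine (sum_piFinset_range hk _).trans (Finset.sum_congr rfl fun r _ => ?_)
  split_ifs with hr
  · rw [phase, point_eq_ext0 hr, prod_V3, Rat.cast_prod]
    refine congrArg _ (Finset.prod_congr rfl fun v _ => ?_)
    rw [vertexValue]
    split_ifs
    · rfl
    · exact Rat.cast_one
  · rfl

end PlumbingGraph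

namespace PlumbingGraph

variable {V : Type*} [Fintype V] {Γ : PlumbingGraph V}

/-! ### The series as a sum over a finer lattice -/

variable (Γ) in
/-- The product of the absolute values of the weights of the leaves at a vertex. -/
noncomputable def leafProduct (v : Γ.V2) : ℕ := ∏ i, Γ.leafWeight v i

variable (Γ) in
/-- The lattice point that corresponds to `n + α`: at a vertex `v` of degree at least three the
numbers `n v + α v`, measured from `alphaOf v 1`, are multiples of the inverse of the product of
the leaf weights. -/
noncomputable def latticeIndex (l : ∀ v : Γ.V2, Γ.leaves v → ℤˣ) (n : Γ.V3 → ℕ) (v : Γ.V2) : ℕ :=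
  if h : 3 ≤ Γ.deg v then
    Γ.leafProduct v * n ⟨v, h⟩ + signOffset (Γ.leafWeight v) (l v) else 0

variable (Γ) in
/-- The origin of the finer lattice. -/
noncomputable def latticeOrigin (v : Γ.V2) : ℝ :=
  if 3 ≤ Γ.deg v then (Γ.leafProduct v : ℝ) * ((Γ.alphaOf v 1 : ℚ) : ℝ) else 0

theorem leafProduct_pos (hleaf : ∀ v, Γ.deg v = 1 → Γ.weight v ≤ -2) (v : Γ.V2) :
    0 < Γ.leafProduct v := Finset.prod_pos fun i _ => leafWeight_pos hleaf v i

theorem latticeIndex_injective (hleaf : ∀ v, Γ.deg v = 1 → Γ.weight v ≤ -2)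
    (l : ∀ v : Γ.V2, Γ.leaves v → ℤˣ) : Function.Injective (Γ.latticeIndex l) := by
  intro n n' h
  funext v
  have h3 : 3 ≤ Γ.deg (Γ.toV2 v) := v.2
  have hv := congrFun h (Γ.toV2 v)
  simp only [latticeIndex, dif_pos h3] at hv
  exact Nat.eq_of_mul_eq_mul_left (leafProduct_pos hleaf _) (Nat.add_right_cancel hv)

theorem sample_latticeIndex (hleaf : ∀ v, Γ.deg v = 1 → Γ.weight v ≤ -2)
    (f : (Γ.V2 → ℝ) → ℂ) {η : Γ.V2 → ℝ} {t : Γ.V3 → ℝ}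
    (hη : ∀ v, η (Γ.toV2 v) * (Γ.leafProduct (Γ.toV2 v) : ℝ) = t v)
    (l : ∀ v : Γ.V2, Γ.leaves v → ℤˣ) (n : Γ.V3 → ℕ) :
    sample f η Γ.latticeOrigin (Γ.latticeIndex l n) =
      f (fun v => Γ.ext0 t v * (Γ.ext0 (fun u => (n u : ℝ)) v + ((Γ.alphaOf v (l v) : ℚ) : ℝ))) := by
  rw [sample]
  congr 1
  funext v
  by_cases h : 3 ≤ Γ.deg v
  · have h1 : ((signOffset (Γ.leafWeight v) (l v) : ℕ) : ℝ) =
        (Γ.leafProduct v : ℝ) * ((signShift (Γ.leafWeight v) (l v) : ℚ) : ℝ) := by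
      exact_mod_cast congrArg (fun x : ℚ => (x : ℝ)) (signOffset_cast (leafWeight_pos hleaf v) (l v))
    have h2 : Γ.alphaOf v (l v) = Γ.alphaOf v 1 + signShift (Γ.leafWeight v) (l v) :=
      alphaOf_eq hleaf v (l v)
    have h3 : η v * (Γ.leafProduct v : ℝ) = t ⟨v, h⟩ := hη ⟨v, h⟩
    simp only [latticeIndex, latticeOrigin, ext0, dif_pos h, if_pos h]
    rw [h2, ← h3, Nat.cast_add, h1, Nat.cast_mul, Rat.cast_add]
    ring
  · simp [latticeIndex, latticeOrigin, ext0, h]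

theorem prod_coeff_series_latticeIndex (hleaf : ∀ v, Γ.deg v = 1 → Γ.weight v ≤ -2) {k : ℕ}
    (r : Γ.V2 → Fin k) (l : ∀ v : Γ.V2, Γ.leaves v → ℤˣ) (n : Γ.V3 → ℕ) :
    ∏ v, PowerSeries.coeff (Γ.latticeIndex l n v) (Γ.series k v (r v, l v)) =
      if ∀ v, n v % k = r (Γ.toV2 v) then
        ((MvPolynomial.eval (fun v => (n v : ℚ)) Γ.P : ℚ) : ℂ) else 0 := by
  have h : ∏ v, PowerSeries.coeff (Γ.latticeIndex l n v) (Γ.series k v (r v, l v)) =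
      ∏ v : Γ.V3, if n v % k = r (Γ.toV2 v) then
        ((n v + (Γ.deg v - 3)).choose (Γ.deg v - 3) : ℂ) else 0 := by
    rw [prod_V3]
    refine Finset.prod_congr rfl fun v _ => ?_
    by_cases h3 : 3 ≤ Γ.deg v
    · rw [latticeIndex, dif_pos h3, dif_pos h3, series, if_pos h3]
      exact coeff_vertexSeries (leafWeight_pos hleaf v) k _ (r v, l v) _
    · simp [latticeIndex, series, h3]
  rw [h, eval_P]
  split_ifs with hn
  · push_cast
    exact Finset.prod_congr rfl fun v _ => if_pos (hn v)
  · obtain ⟨v, hv⟩ := not_forall.mp hn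
    exact Finset.prod_eq_zero (Finset.mem_univ v) (if_neg hv)

theorem exists_latticeIndex_of_ne_zero {k : ℕ} (r : Γ.V2 → Fin k)
    (l : ∀ v : Γ.V2, Γ.leaves v → ℤˣ) (z : Γ.V2 → ℕ)
    (h : ∏ v, PowerSeries.coeff (z v) (Γ.series k v (r v, l v)) ≠ 0) :
    z ∈ Set.range (Γ.latticeIndex l) := by
  have hz : ∀ v : Γ.V3, ∃ n, z (Γ.toV2 v) =
      Γ.leafProduct (Γ.toV2 v) * n +
        signOffset (Γ.leafWeight (Γ.toV2 v)) (l (Γ.toV2 v)) := by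
    intro v
    have h3 : 3 ≤ Γ.deg (Γ.toV2 v) := v.2
    have hv := Finset.prod_ne_zero_iff.mp h (Γ.toV2 v) (Finset.mem_univ _)
    rw [series, if_pos h3] at hv
    exact exists_of_coeff_vertexSeries_ne_zero hv
  choose n hn using hz
  refine ⟨n, funext fun v => ?_⟩
  by_cases h3 : 3 ≤ Γ.deg v
  · rw [latticeIndex, dif_pos h3]
    exact (hn ⟨v, h3⟩).symm
  · have hv := Finset.prod_ne_zero_iff.mp h v (Finset.mem_univ _)
    rw [series, if_neg h3, PowerSeries.coeff_one] at hv
    rw [latticeIndex, dif_neg h3]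
    by_contra hne
    exact hv (if_neg (Ne.symm hne))

variable (Γ) in
/-- The terms of the sum over the finer lattice for fixed residues and signs. -/
noncomputable def latticeTerm {k : ℕ} (f : (Γ.V2 → ℝ) → ℂ) (η : Γ.V2 → ℝ)
    (i : ∀ v : Γ.V2, Fin k × (Γ.leaves v → ℤˣ)) (z : Γ.V2 → ℕ) : ℂ :=
  (∏ v, PowerSeries.coeff (z v) (Γ.series k v (i v))) * sample f η Γ.latticeOrigin z

/-- The terms of the sum over the finer lattice vanish off the points that come from some `n`. -/
theorem tsum_latticeTerm (hleaf : ∀ v, Γ.deg v = 1 → Γ.weight v ≤ -2) {k : ℕ}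
    (f : (Γ.V2 → ℝ) → ℂ) (η : Γ.V2 → ℝ) (r : Γ.V2 → Fin k)
    (l : ∀ v : Γ.V2, Γ.leaves v → ℤˣ) :
    ∑' n, Γ.latticeTerm f η (fun v => (r v, l v)) (Γ.latticeIndex l n) =
      ∑' z, Γ.latticeTerm f η (fun v => (r v, l v)) z :=
  (latticeIndex_injective hleaf l).tsum_eq fun z hz =>
    exists_latticeIndex_of_ne_zero r l z fun h => hz (by rw [latticeTerm, h, zero_mul])

variable (Γ) in
/-- The mesh of the finer lattice for the parameters `t`; the value at the vertices of degree two
plays no role, and `x` is taken there. -/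
noncomputable def mesh (t : Γ.V3 → ℝ) (x : ℝ) (v : Γ.V2) : ℝ :=
  if h : 3 ≤ Γ.deg v then t ⟨v, h⟩ / (Γ.leafProduct v : ℝ) else x

theorem mesh_pos (hleaf : ∀ v, Γ.deg v = 1 → Γ.weight v ≤ -2) {t : Γ.V3 → ℝ}
    (ht : ∀ v, 0 < t v) {x : ℝ} (hx : 0 < x) (v : Γ.V2) : 0 < Γ.mesh t x v := by
  rw [mesh]
  split_ifs
  · exact div_pos (ht _) (Nat.cast_pos.mpr (leafProduct_pos hleaf v))
  · exact hx

theorem mesh_mul (hleaf : ∀ v, Γ.deg v = 1 → Γ.weight v ≤ -2) (t : Γ.V3 → ℝ) (x : ℝ)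
    (v : Γ.V3) :
    Γ.mesh t x (Γ.toV2 v) * (Γ.leafProduct (Γ.toV2 v) : ℝ) = t v := by
  have h3 : 3 ≤ Γ.deg (Γ.toV2 v) := v.2
  rw [mesh, dif_pos h3]
  exact div_mul_cancel₀ _ (Nat.cast_ne_zero.mpr (leafProduct_pos hleaf _).ne')

variable [DecidableEq V]

theorem summable_latticeTerm {k : ℕ} {f : (Γ.V2 → ℝ) → ℂ} (hf : ContDiff ℝ ∞ f)
    (hR : RapidDecay f) {η : Γ.V2 → ℝ} (hη : ∀ v, 0 < η v)
    (i : ∀ v : Γ.V2, Fin k × (Γ.leaves v → ℤˣ)) : Summable (Γ.latticeTerm f η i) :=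
  summable_prod_coeff_mul (fun v => polyGrowth_series k v (i v))
    (latticeDecay_sample hf hR _ η hη)

open scoped Classical in
/-- Only the family of residues of `n` contributes to the sum. -/
theorem term_eq (hdet : IsUnit Γ.linkingMatrix.det)
    (hleaf : ∀ v, Γ.deg v = 1 → Γ.weight v ≤ -2) {k : ℕ} (hk : 0 < k)
    (f : (Γ.V2 → ℝ) → ℂ) {η : Γ.V2 → ℝ} {t : Γ.V3 → ℝ}
    (hη : ∀ v, η (Γ.toV2 v) * (Γ.leafProduct (Γ.toV2 v) : ℝ) = t v)
    (l : ∀ v : Γ.V2, Γ.leaves v → ℤˣ) (n : Γ.V3 → ℕ) :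
    Γ.term k f t (fun v => Γ.alphaOf v (l v)) n =
      ∑ r : Γ.V2 → Fin k, if Γ.Supported r then
        Γ.phase k (fun v => ((r v : Fin k) : ℤ)) l *
          Γ.latticeTerm f η (fun v => (r v, l v)) (Γ.latticeIndex l n) else 0 := by
  -- the residues of `n`, extended by zero
  set ρ : Γ.V2 → Fin k := fun v =>
    if h : 3 ≤ Γ.deg v then ⟨n ⟨v, h⟩ % k, Nat.mod_lt _ hk⟩ else ⟨0, hk⟩ with hρ
  have hsupp : Γ.Supported ρ := fun v hv => by
    rw [hρ]
    simp only [dif_neg (not_le.mpr hv)]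
  have hmod : ∀ v, n v % k = ρ (Γ.toV2 v) := fun v => by
    have h3 : 3 ≤ Γ.deg (Γ.toV2 v) := v.2
    rw [hρ]
    simp only [dif_pos h3]
    rfl
  rw [Finset.sum_eq_single ρ]
  · rw [if_pos hsupp, latticeTerm, prod_coeff_series_latticeIndex hleaf, if_pos hmod,
      sample_latticeIndex hleaf f hη, term, ← mul_assoc]
    congr 2
    have hcongr : ∀ v, ((ρ v : ℕ) : ℤ) ≡ Γ.ext0 (fun u => (n u : ℤ)) v [ZMOD k] := by
      intro v
      rw [hρ, ext0]
      by_cases h3 : 3 ≤ Γ.deg v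
      · simp only [dif_pos h3]
        push_cast
        exact Int.mod_modEq _ _
      · simp only [dif_neg h3]
        rfl
    rw [phase_congr hdet hleaf hk hcongr, phase]
    congr 3
    funext v
    rw [point, ext0, ext0]
    split_ifs <;> simp
  · intro r _ hr
    split_ifs with hs
    · rw [latticeTerm, prod_coeff_series_latticeIndex hleaf, if_neg, zero_mul, mul_zero]
      intro h
      refine hr (funext fun v => Fin.ext ?_)
      by_cases h3 : 3 ≤ Γ.deg v
      · exact ((h ⟨v, h3⟩).symm.trans (hmod ⟨v, h3⟩))
      · rw [hs v (by omega), hsupp v (by omega)]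
    · rfl
  · exact fun h => absurd (Finset.mem_univ _) h

theorem summable_comp_latticeIndex (hleaf : ∀ v, Γ.deg v = 1 → Γ.weight v ≤ -2) {k : ℕ}
    {f : (Γ.V2 → ℝ) → ℂ} (hf : ContDiff ℝ ∞ f) (hR : RapidDecay f) {η : Γ.V2 → ℝ}
    (hη : ∀ v, 0 < η v) (r : Γ.V2 → Fin k) (l : ∀ v : Γ.V2, Γ.leaves v → ℤˣ) :
    Summable fun n => Γ.latticeTerm f η (fun v => (r v, l v)) (Γ.latticeIndex l n) :=
  (summable_latticeTerm hf hR hη _).comp_injective (latticeIndex_injective hleaf l)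

open scoped Classical in
theorem hasSum_term (hdet : IsUnit Γ.linkingMatrix.det)
    (hleaf : ∀ v, Γ.deg v = 1 → Γ.weight v ≤ -2) {k : ℕ} (hk : 0 < k)
    {f : (Γ.V2 → ℝ) → ℂ} (hf : ContDiff ℝ ∞ f) (hR : RapidDecay f)
    {η : Γ.V2 → ℝ} (hη : ∀ v, 0 < η v) {t : Γ.V3 → ℝ}
    (ht : ∀ v, η (Γ.toV2 v) * (Γ.leafProduct (Γ.toV2 v) : ℝ) = t v)
    (l : ∀ v : Γ.V2, Γ.leaves v → ℤˣ) :
    HasSum (Γ.term k f t fun v => Γ.alphaOf v (l v))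
      (∑ r : Γ.V2 → Fin k, if Γ.Supported r then
        Γ.phase k (fun v => ((r v : Fin k) : ℤ)) l *
          ∑' z, Γ.latticeTerm f η (fun v => (r v, l v)) z else 0) := by
  rw [funext (term_eq hdet hleaf hk f ht l)]
  refine hasSum_sum fun r _ => ?_
  split_ifs
  · rw [← tsum_latticeTerm hleaf]
    exact (summable_comp_latticeIndex hleaf hf hR hη r l).hasSum.mul_left _
  · exact hasSum_zero

theorem summable_term (hdet : IsUnit Γ.linkingMatrix.det)
    (hleaf : ∀ v, Γ.deg v = 1 → Γ.weight v ≤ -2) {k : ℕ} (hk : 0 < k)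
    {f : (Γ.V2 → ℝ) → ℂ} (hf : ContDiff ℝ ∞ f) (hR : RapidDecay f) {t : Γ.V3 → ℝ}
    (ht : ∀ v, 0 < t v) {a : Γ.V2 → ℚ} (ha : a ∈ Γ.calS) : Summable (Γ.term k f t a) := by
  classical
  simp only [calS, calSv, Fintype.mem_piFinset, Finset.mem_image, Finset.mem_univ,
    true_and] at ha
  choose l hl using ha
  rw [← funext hl]
  exact (hasSum_term hdet hleaf hk hf hR (mesh_pos hleaf ht one_pos) (mesh_mul hleaf t 1)
    l).summable

/-- The series `F` as a weighted sum of series over the finer lattice. -/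
theorem F_eq (hdet : IsUnit Γ.linkingMatrix.det)
    (hleaf : ∀ v, Γ.deg v = 1 → Γ.weight v ≤ -2) {k : ℕ} (hk : 0 < k)
    {f : (Γ.V2 → ℝ) → ℂ} (hf : ContDiff ℝ ∞ f) (hR : RapidDecay f)
    {η : Γ.V2 → ℝ} (hη : ∀ v, 0 < η v) {t : Γ.V3 → ℝ}
    (ht : ∀ v, η (Γ.toV2 v) * (Γ.leafProduct (Γ.toV2 v) : ℝ) = t v) :
    Γ.F k f t = ∑ i : ∀ v : Γ.V2, Fin k × (Γ.leaves v → ℤˣ),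
      Γ.indexWeight k i * ∑' z, Γ.latticeTerm f η i z := by
  classical
  refine (sum_calS hdet hleaf _).trans (Eq.trans ?_
    (sum_index fun r l => ∑' z, Γ.latticeTerm f η (fun v => (r v, l v)) z).symm)
  exact Finset.sum_congr rfl fun l _ =>
    congrArg _ (hasSum_term hdet hleaf hk hf hR hη ht l).tsum_eq

/-! ### The limit -/

/-- The weights of the indices decompose into products of admissible ones, and for these the sums
over the lattice are regular at every vertex. -/
theorem tendsto_sum_indexWeight_mul (hdet : IsUnit Γ.linkingMatrix.det)
    (hleaf : ∀ v, Γ.deg v = 1 → Γ.weight v ≤ -2) {k : ℕ} (hk : 0 < k)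
    (hdeg : ∀ v, 3 ≤ Γ.deg v → 0 ≤ ((Γ.leaves v).card : ℤ) + 2 - (Γ.deg v : ℤ))
    {f : (Γ.V2 → ℝ) → ℂ} (hf : ContDiff ℝ ∞ f) (hR : RapidDecay f) :
    Filter.Tendsto (fun η : Γ.V2 → ℝ => ∑ i : ∀ v : Γ.V2, Fin k × (Γ.leaves v → ℤˣ),
        Γ.indexWeight k i * ∑' z, Γ.latticeTerm f η i z)
      (𝓝[{η | ∀ v, 0 < η v}] 0) (𝓝 (Γ.c k 0 * f 0)) := by
  classical
  obtain ⟨K, hK, hdec⟩ := exists_tensor_decomposition (Γ.admissible k) (Γ.indexWeight k)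
    (indexWeight_slice_mem hdet hleaf hk)
  have hlim := tendsto_finsetSum Finset.univ
    fun (i : ∀ v : Γ.V2, Fin k × (Γ.leaves v → ℤˣ)) _ =>
    (tendsto_tsum_prod_coeff_mul_sample (fun v : Γ.V2 => Γ.deg v - 3)
      (fun v => ∑ a, K v (i v) a • Γ.series k v a)
      (fun v => ∑ a, K v (i v) a * Γ.vertexValue k 0 v a)
      (fun v => sum_smul_series_mem_regularAtOne hleaf hk hdeg v (hK v (i v)))
      hf hR Γ.latticeOrigin).const_mul (Γ.indexWeight k i)
  have hval : ∑ i, Γ.indexWeight k i *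
      ((∏ v, ∑ a, K v (i v) a * Γ.vertexValue k 0 v a) * f 0) = Γ.c k 0 * f 0 := by
    rw [c_eq hdet hleaf hk, sum_mul_prod_of_decomposition hdec, Finset.sum_mul]
    exact Finset.sum_congr rfl fun i _ => (mul_assoc _ _ _).symm
  rw [hval] at hlim
  refine hlim.congr' ?_
  filter_upwards [self_mem_nhdsWithin] with η hη
  have hs := fun i => summable_latticeTerm (k := k) hf hR hη i
  have hs' : ∀ i : ∀ v : Γ.V2, Fin k × (Γ.leaves v → ℤˣ), Summable fun z : Γ.V2 → ℕ =>
      (∏ v, PowerSeries.coeff (z v) (∑ a, K v (i v) a • Γ.series k v a)) *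
        sample f η Γ.latticeOrigin z := by
    intro i
    have h := summable_sum (s := Finset.univ)
      fun (j : ∀ v : Γ.V2, Fin k × (Γ.leaves v → ℤˣ)) _ =>
        (hs j).mul_left (∏ v, K v (i v) (j v))
    refine h.congr fun z => ?_
    simp only [map_sum, PowerSeries.coeff_smul, smul_eq_mul]
    rw [Finset.prod_univ_sum, Fintype.piFinset_univ, Finset.sum_mul]
    refine Finset.sum_congr rfl fun j _ => ?_
    rw [latticeTerm, Finset.prod_mul_distrib, mul_assoc]
  simp only [← tsum_mul_left]
  rw [← Summable.tsum_finsetSum fun i _ => (hs' i).mul_left _,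
    ← Summable.tsum_finsetSum fun i _ => (hs i).mul_left _]
  refine tsum_congr fun z => ?_
  have h := sum_mul_prod_of_decomposition hdec fun v a => PowerSeries.coeff (z v) (Γ.series k v a)
  simp only [latticeTerm, ← mul_assoc, ← Finset.sum_mul]
  rw [h]
  simp only [map_sum, PowerSeries.coeff_smul, smul_eq_mul]

theorem tendsto_F (hdet : IsUnit Γ.linkingMatrix.det)
    (hleaf : ∀ v, Γ.deg v = 1 → Γ.weight v ≤ -2) {k : ℕ} (hk : 0 < k)
    (hdeg : ∀ v, 3 ≤ Γ.deg v → 0 ≤ ((Γ.leaves v).card : ℤ) + 2 - (Γ.deg v : ℤ))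
    {f : (Γ.V2 → ℝ) → ℂ} (hf : ContDiff ℝ ∞ f) (hR : RapidDecay f) :
    Filter.Tendsto (Γ.F k f) (𝓝[{t | ∀ v, 0 < t v}] 0) (𝓝 (Γ.c k 0 * f 0)) := by
  have hlim := tendsto_sum_indexWeight_mul hdet hleaf hk hdeg hf hR
  rw [Metric.tendsto_nhdsWithin_nhds] at hlim ⊢
  intro ε hε
  obtain ⟨δ, hδ, h⟩ := hlim ε hε
  refine ⟨δ, hδ, fun t ht hdist => ?_⟩
  -- `F` does not see the mesh at the vertices of degree two, so it can be chosen small there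
  have hη := mesh_pos hleaf ht (half_pos hδ)
  rw [F_eq hdet hleaf hk hf hR hη (mesh_mul hleaf t _)]
  refine h hη ?_
  rw [dist_pi_lt_iff hδ] at hdist ⊢
  intro v
  rw [Pi.zero_apply, Real.dist_0_eq_abs, abs_of_pos (hη v), mesh]
  split_ifs with h3
  · have h1 := hdist ⟨v, h3⟩
    rw [Pi.zero_apply, Real.dist_0_eq_abs, abs_of_pos (ht _)] at h1
    refine lt_of_le_of_lt (div_le_self (ht _).le ?_) h1
    exact_mod_cast leafProduct_pos hleaf v
  · exact half_lt_self hδ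

theorem c_eq_zero_of_neg (hdet : IsUnit Γ.linkingMatrix.det)
    (hleaf : ∀ v, Γ.deg v = 1 → Γ.weight v ≤ -2) {k : ℕ} (hk : 0 < k)
    (hdeg : ∀ v, 3 ≤ Γ.deg v → 0 ≤ ((Γ.leaves v).card : ℤ) + 2 - (Γ.deg v : ℤ))
    {n : Γ.V3 → ℤ} {v : Γ.V3} (hn : n v ≤ -1) : Γ.c k n = 0 := by
  obtain ⟨K, hK, hdec⟩ := exists_tensor_decomposition (Γ.admissible k) (Γ.indexWeight k)
    (indexWeight_slice_mem hdet hleaf hk)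
  rw [c_eq hdet hleaf hk, sum_mul_prod_of_decomposition hdec]
  refine Finset.sum_eq_zero fun i _ => mul_eq_zero_of_right _ ?_
  exact Finset.prod_eq_zero (Finset.mem_univ (Γ.toV2 v))
    (sum_mul_vertexValue_eq_zero hleaf hdeg n v hn (hK _ _))

end PlumbingGraph

theorem mainTheorem7 {V : Type*} [Fintype V] [DecidableEq V] (Γ : PlumbingGraph V)
    (hneg : Γ.IsNegDef)
    (hdet : Γ.linkingMatrix.det = 1 ∨ Γ.linkingMatrix.det = -1)
    (hleaf : ∀ v, Γ.deg v = 1 → Γ.weight v ≤ -2)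
    (k : ℕ) (hk : 0 < k)
    (hdeg : ∀ v, 3 ≤ Γ.deg v → 0 ≤ ((Γ.leaves v).card : ℤ) + 2 - (Γ.deg v : ℤ)) :
    (∀ n : Γ.V3 → ℤ, (∃ v, n v ≤ -1) → Γ.c k n = 0) ∧
      ∀ f : (Γ.V2 → ℝ) → ℂ, ContDiff ℝ ∞ f → RapidDecay f →
        (∀ t : Γ.V3 → ℝ, (∀ v, 0 < t v) → ∀ a ∈ Γ.calS, Summable (Γ.term k f t a)) ∧
        Filter.Tendsto (Γ.F k f) (𝓝[{t | ∀ v, 0 < t v}] 0) (𝓝 (Γ.c k 0 * f 0)) := by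
  have hunit : IsUnit Γ.linkingMatrix.det := Int.isUnit_iff.mpr hdet
  refine ⟨fun n ⟨v, hv⟩ => PlumbingGraph.c_eq_zero_of_neg hunit hleaf hk hdeg hv,
    fun f hf hR => ⟨fun t ht a ha => PlumbingGraph.summable_term hunit hleaf hk hf hR ht ha,
      PlumbingGraph.tendsto_F hunit hleaf hk hdeg hf hR⟩⟩
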